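/- Let $F:\mathbb{R}^4\to\mathbb{R}^4$ and $H:\mathbb{R}^4\to\mathbb{R}$ be smooth with $\langle F(u),\nabla H(u)\rangle=0$ for all $u$, and consider the ODE $\dot u=F(u)$. Let $\gamma_1,\dots,\gamma_p$ be periodic orbits of it, with minimal periods $T_1,\dots,T_p$, lying in one common level set of $H$, with $\nabla H\neq 0$ along each of them. Assume each $\gamma_i$ is hyperbolic: precisely two of its four Floquet multipliers (counted with multiplicity) equal $1$, and no others lie on the unit circle. Let $W^s(\gamma_i)$ (resp. $W^u(\gamma_i)$) be the stable (resp. unstable) manifold of $\gamma_i$, i.e. the set of points whose trajectory converges to the orbit $\gamma_i$ as $t\to\infty$ (resp. $t\to-\infty$). Let $\mathcal{W}_0$ be a finite set of transverse homoclinic and heteroclinic trajectories: each $h\in\mathcal{W}_0$ is a trajectory, not contained in the periodic orbits that it connects, that lies in $W^u(\gamma_i)\cap W^s(\gamma_j)$ for some $i,j$, with $T_xW^u(\gamma_i)+T_xW^s(\gamma_j)=\ker DH(x)$ at every point $x$ of $h$. Let $\mathcal{G}$ be the directed graph (loops and multiple edges allowed) with vertices $1,\dots,p$ whose edges are the elements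 of $\mathcal{W}_0$, where $h$ is an edge from $i$ to $j$ iff $h(t)\in W^u(\gamma_i)\cap W^s(\gamma_j)$ for all $t$. Let $k\ge 1$, let $(E_1,\dots,E_k)$ be a walk on $\mathcal{G}$ through the vertices $(V_1,\dots,V_{k+1})$, write $h_j\in\mathcal W_0$ for the trajectory that is the edge $E_j$, and let $\varepsilon>0$. Then there are $\sigma_j<\tau_j$ ($1\le j\le k$) with $$|h_j(\sigma_j+s)-\gamma_{V_j}(s)|<\varepsilon\ (s\le 0),\qquad |h_j(\tau_j+s)-\gamma_{V_{j+1}}(s)|<\varepsilon\ (s\ge 0),$$ and an integer $M_k\ge 1$, such that the following holds. For a trajectory $u$ and times $a_j$ (arrival near $\gamma_{V_j}$) and $b_j$ (departure from it), say that $u$ *follows $E_j$* if $a_{j+1}=b_j+(\tau_j-\sigma_j)$ and $|u(b_j+s)-h_j(\sigma_j+s)|<\varepsilon$ for $0\le s\le\tau_j-\sigma_j$, and that $u$ *winds $N_j$ times around $\gamma_{V_j}$* if $b_j=a_j+N_jT_{V_j}$ and $|u(a_j+s)-\gamma_{V_j}(s)|<\varepsilon$ for $0\le s\le N_jT_{V_j}$.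 1. For all integers $N_2,\dots,N_k\ge M_k$ there exist a trajectory $u$ in $W^u(\gamma_{V_1})\cap W^s(\gamma_{V_{k+1}})$, not contained in $\gamma_{V_1}$ or $\gamma_{V_{k+1}}$, and times $b_1,a_2,b_2,\dots,a_k,b_k,a_{k+1}$, such that $|u(b_1+s)-\gamma_{V_1}(s)|<\varepsilon$ for $s\le0$; $u$ follows $E_j$ for $1\le j\le k$; $u$ winds $N_j$ times around $\gamma_{V_j}$ for $2\le j\le k$; and $|u(a_{k+1}+s)-\gamma_{V_{k+1}}(s)|<\varepsilon$ for $s\ge0$. 2. If $V_{k+1}=V_1$, then for all integers $N_1,\dots,N_k\ge M_k$ there exist a non-constant periodic trajectory $u$, a period $P>0$ of $u$, and times $a_1,b_1,\dots,a_k,b_k,a_{k+1}$, such that $u$ winds $N_j$ times around $\gamma_{V_j}$ and follows $E_j$ for $1\le j\le k$, and $|P-(a_{k+1}-a_1)|<\varepsilon$. -/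

import Mathlib

open Set Filter Topology
open scoped ContDiff

/-- The phase space `ℝ⁴` with its Euclidean structure. -/
abbrev Phase : Type := EuclideanSpace ℝ (Fin 4)

/-- `u : ℝ → ℝ⁴` is a trajectory, defined for all times, of the autonomous equation `u' = F(u)`. -/
def IsTrajectory (F : Phase → Phase) (u : ℝ → Phase) : Prop :=
  IsIntegralCurve u (fun _ => F)

/-- `H` is a smooth conserved quantity: `⟨F(u), ∇H(u)⟩ = 0` for all `u`. -/
structure IsConservedQuantity (F : Phase → Phase) (H : Phase → ℝ) : Prop where
  smooth : ContDiff ℝ ∞ H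
  orthogonal : ∀ u, inner ℝ (F u) (gradient H u) = 0

/-- `γ` is a periodic orbit of `u' = F(u)` with minimal period `T`. -/
structure IsPeriodicOrbit (F : Phase → Phase) (γ : ℝ → Phase) (T : ℝ) : Prop where
  trajectory : IsTrajectory F γ
  pos : 0 < T
  periodic : Function.Periodic γ T
  minimal : ∀ s ∈ Ioo 0 T, γ s ≠ γ 0

/-- `Φ` is the principal fundamental solution of the variational equation `Φ' = DF(γ(t)) Φ`,
`Φ(0) = 1`. -/
structure IsPrincipalSolution (F : Phase → Phase) (γ : ℝ → Phase)
    (Φ : ℝ → Phase →L[ℝ] Phase) : Prop where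
  initial : Φ 0 = ContinuousLinearMap.id ℝ Phase
  variational : ∀ t, HasDerivAt Φ ((fderiv ℝ F (γ t)).comp (Φ t)) t

/-- The complex eigenvalues, counted with algebraic multiplicity, of a real linear map. Applied to
the monodromy map `Φ(T)` of a `T`-periodic orbit these are its Floquet multipliers. -/
noncomputable def complexEigenvalues (A : Phase →L[ℝ] Phase) : Multiset ℂ :=
  ((A : Phase →ₗ[ℝ] Phase).charpoly.map (algebraMap ℝ ℂ)).roots

open Classical in
/-- A `T`-periodic orbit is hyperbolic, relative to a level set of a conserved quantity, if
precisely two of its Floquet multipliers are equal to one and no others lie on the unit circle. -/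
def IsHyperbolicOrbit (F : Phase → Phase) (γ : ℝ → Phase) (T : ℝ) : Prop :=
  ∃ Φ : ℝ → Phase →L[ℝ] Phase, IsPrincipalSolution F γ Φ ∧
    (complexEigenvalues (Φ T)).count 1 = 2 ∧
    ∀ μ ∈ complexEigenvalues (Φ T), ‖μ‖ = 1 → μ = 1

/-- `W^s(γ)`: the points whose forward trajectory exists for all `t ≥ 0` and converges to the
orbit of `γ` as `t → ∞`. -/
def stableManifold (F : Phase → Phase) (γ : ℝ → Phase) : Set Phase :=
  {x | ∃ u : ℝ → Phase, IsIntegralCurveOn u (fun _ => F) (Ici 0) ∧ u 0 = x ∧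
    Tendsto (fun t => Metric.infDist (u t) (range γ)) atTop (𝓝 0)}

/-- `W^u(γ)`: the points whose backward trajectory exists for all `t ≤ 0` and converges to the
orbit of `γ` as `t → -∞`. -/
def unstableManifold (F : Phase → Phase) (γ : ℝ → Phase) : Set Phase :=
  {x | ∃ u : ℝ → Phase, IsIntegralCurveOn u (fun _ => F) (Iic 0) ∧ u 0 = x ∧
    Tendsto (fun t => Metric.infDist (u t) (range γ)) atBot (𝓝 0)}

/-- The tangent space of `W^s(γ)` at `x`: the velocities at `x` of the `C¹` curves through `x` that
run in `W^s(γ)`. Since `W^s(γ)` is an immersed submanifold that may accumulate on itself, the curves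
have to stay in one sheet: the forward trajectories `φ s` of the points `c s` of the curve converge
to `γ` uniformly along the curve, that is, one common time takes the whole curve into a given
local stable manifold. -/
def stableTangent (F : Phase → Phase) (γ : ℝ → Phase) (x : Phase) : Set Phase :=
  {v | ∃ (c : ℝ → Phase) (φ : ℝ → ℝ → Phase), ContDiff ℝ 1 c ∧ c 0 = x ∧ deriv c 0 = v ∧
    (∀ s, IsIntegralCurveOn (φ s) (fun _ => F) (Ici 0) ∧ φ s 0 = c s) ∧
    TendstoUniformly (fun t s => Metric.infDist (φ s t) (range γ)) (fun _ => 0) atTop}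

/-- The tangent space of `W^u(γ)` at `x`, likewise with backward trajectories. -/
def unstableTangent (F : Phase → Phase) (γ : ℝ → Phase) (x : Phase) : Set Phase :=
  {v | ∃ (c : ℝ → Phase) (φ : ℝ → ℝ → Phase), ContDiff ℝ 1 c ∧ c 0 = x ∧ deriv c 0 = v ∧
    (∀ s, IsIntegralCurveOn (φ s) (fun _ => F) (Iic 0) ∧ φ s 0 = c s) ∧
    TendstoUniformly (fun t s => Metric.infDist (φ s t) (range γ)) (fun _ => 0) atBot}

/-- `h` is a homoclinic or heteroclinic trajectory from `γ` to `γ'`: it lies in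
`W^u(γ) ∩ W^s(γ')`, and it is not one of the periodic orbits themselves. -/
structure IsConnection (F : Phase → Phase) (γ γ' h : ℝ → Phase) : Prop where
  trajectory : IsTrajectory F h
  unstable : ∀ t, h t ∈ unstableManifold F γ
  stable : ∀ t, h t ∈ stableManifold F γ'
  nontrivial : ∀ t, h t ∉ range γ ∧ h t ∉ range γ'

/-- `W^u(γ)` and `W^s(γ')` intersect transversely along `h`, inside the level set of `H`: at each
point of `h` their tangent spaces together span the tangent space `ker DH` of the level set. -/
def IsTransverseAlong (F : Phase → Phase) (H : Phase → ℝ) (γ γ' h : ℝ → Phase) : Prop :=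
  ∀ t, {w : Phase | ∃ v ∈ unstableTangent F γ (h t), ∃ v' ∈ stableTangent F γ' (h t), v + v' = w} =
    {w : Phase | fderiv ℝ H (h t) w = 0}

/-- `E 0, …, E (k-1)` is a walk through the vertices `V 0, …, V k` on the directed graph whose
vertices are the labels of the periodic orbits and whose edges are the elements of `W₀`: the
element `h` is an edge from `i` to `j` iff it lies in `W^u(γ i)` and in `W^s(γ j)`. -/
def IsWalk {p : ℕ} (F : Phase → Phase) (γ : Fin p → ℝ → Phase) (W₀ : Set (ℝ → Phase)) {k : ℕ}
    (E : Fin k → ℝ → Phase) (V : Fin (k + 1) → Fin p) : Prop :=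
  ∀ j : Fin k, E j ∈ W₀ ∧
    (∀ t, E j t ∈ unstableManifold F (γ (V j.castSucc))) ∧
    (∀ t, E j t ∈ stableManifold F (γ (V j.succ)))

/-- For each edge of the walk, `[σ j, τ j]` is a time window that contains the whole excursion of
`E j` away from the `ε`-neighbourhoods of the two periodic orbits it connects. The windows are cut
so that `E j` is in phase with the periodic orbits at its two ends. -/
structure IsTransitWindow {p k : ℕ} (γ : Fin p → ℝ → Phase) (E : Fin k → ℝ → Phase)
    (V : Fin (k + 1) → Fin p) (ε : ℝ) (σ τ : Fin k → ℝ) : Prop where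
  lt : ∀ j, σ j < τ j
  before : ∀ j, ∀ s ≤ 0, dist (E j (σ j + s)) (γ (V j.castSucc) s) < ε
  after : ∀ j, ∀ s ≥ 0, dist (E j (τ j + s)) (γ (V j.succ) s) < ε

/-- `u` departs from the periodic orbit at the start of edge `j` at time `b j`, follows `E j`
`ε`-closely through its whole transit window, and arrives at the next periodic orbit at time
`a j.succ`. -/
def FollowsEdge {k : ℕ} (E : Fin k → ℝ → Phase) (ε : ℝ) (σ τ : Fin k → ℝ)
    (u : ℝ → Phase) (a : Fin (k + 1) → ℝ) (b : Fin k → ℝ) (j : Fin k) : Prop :=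
  a j.succ = b j + (τ j - σ j) ∧
    ∀ s ∈ Icc 0 (τ j - σ j), dist (u (b j + s)) (E j (σ j + s)) < ε

/-- Between its arrival at time `a j.castSucc` and its departure at time `b j`, the trajectory `u`
winds `n` times around the periodic orbit at the starting vertex of edge `j`: it stays `ε`-close to
that orbit, in phase with it, for `n` full periods. -/
def WindsAround {p k : ℕ} (γ : Fin p → ℝ → Phase) (T : Fin p → ℝ)
    (V : Fin (k + 1) → Fin p) (ε : ℝ)
    (u : ℝ → Phase) (a : Fin (k + 1) → ℝ) (b : Fin k → ℝ) (j : Fin k) (n : ℕ) : Prop :=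
  b j = a j.castSucc + n * T (V j.castSucc) ∧
    ∀ s ∈ Icc 0 (n * T (V j.castSucc)), dist (u (a j.castSucc + s)) (γ (V j.castSucc) s) < ε

/-! The obstacle is the double Floquet multiplier 1. One copy belongs to the flow direction and
disappears on passing to a return map; the other belongs to the conserved quantity. The latter is
removed by replacing `F` by `F - (H - c) ∇H`, cut off far away (`cutoffField`), where `c` is the
value of `H` on the given orbits. Inside the cutoff ball nothing changes on the level set `H = c`,
but this set becomes attracting: over one period the linearized flow multiplies `DH` by `μ = exp(-∫
‖∇H‖²) < 1`. The return map to a hyperplane is taken on a full neighbourhood in `ℝ⁴`, so that its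
linearization kills the flow direction. Its eigenvalues are `0`, `μ` and the two nontrivial
multipliers, and it is hyperbolic (`IsPeriodicOrbit.exists_hyperbolicCycle`). The direction
transverse to the level set is now stable, so transversality inside the level set becomes
transversality in `ℝ⁴`.

Hyperbolicity enters only through a summable Green's function (`exists_isGreenKernel`); no stable or
unstable subspaces are constructed. It yields bounded solutions for bounded sources, and an `ℓ¹`
estimate: two orbits of the return map that stay small are summably close, with a bound by their
distances at the two ends (`IsGreenKernel.exists_sum_dist_le`). This estimate turns tangent vectors
of stable manifolds into bounded orbits of the linearized maps, and it bounds the accumulated drift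
of the return times independently of the number of turns, which keeps the orbits in phase
(`IsReturnTime.exists_shadow`).

Each connecting trajectory is cut at the sections into a two-sided orbit of a sequence of maps:
returns at the first cycle, one transit map, returns at the second cycle
(`HyperbolicCycle.exists_crossing`). By transversality the linearization along it is onto for
bounded sequences. `exists_chain_shadow` joins such orbits along segments of prescribed large
lengths by a Newton iteration: the linear correction is solved for every transition separately, and
neighbouring corrections are blended by a linear ramp, whose error is small if the segments are
long. A cyclic chain gives a periodic orbit; a chain over `ℤ`, continued by fixed points at both
ends, gives a connecting orbit.

These orbits belong to the modified flow. Since `|H - c|` never increases along it, an orbit that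
emanates from the level set lies in it, and so does a periodic orbit that meets a regular point of
`H` inside the cutoff ball. There the modified field is `F`. -/

section Flow

/-! ### Global `C¹` flows of compactly supported fields. -/

variable {E : Type*} [NormedAddCommGroup E] [NormedSpace ℝ E]

/-- Grönwall's inequality in both time directions. -/
theorem norm_le_gronwallBound_abs {w w' : ℝ → E} {h K ε : ℝ}
    (hw : ∀ t ∈ Ioo (-h) h, HasDerivAt w (w' t) t)
    (hb : ∀ t ∈ Ioo (-h) h, ‖w' t‖ ≤ K * ‖w t‖ + ε) :
    ∀ t ∈ Ioo (-h) h, ‖w t‖ ≤ gronwallBound ‖w 0‖ K ε |t| := by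
  intro t ht
  rcases le_total 0 t with h0 | h0
  · have hsub : ∀ s ∈ Icc 0 t, s ∈ Ioo (-h) h := fun s hs =>
      ⟨by linarith [hs.1, hs.2, ht.2], by linarith [hs.2, ht.2]⟩
    have := norm_le_gronwallBound_of_norm_deriv_right_le (f := w) (f' := w') (K := K) (ε := ε)
      (δ := ‖w 0‖) (a := 0) (b := t)
      (fun s hs => (hw s (hsub s hs)).continuousAt.continuousWithinAt)
      (fun s hs => (hw s (hsub s ⟨hs.1, hs.2.le⟩)).hasDerivWithinAt) le_rfl
      (fun s hs => hb s (hsub s ⟨hs.1, hs.2.le⟩)) t ⟨h0, le_rfl⟩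
    simpa [abs_of_nonneg h0] using this
  · have hsub : ∀ s ∈ Icc 0 (-t), -s ∈ Ioo (-h) h := fun s hs =>
      ⟨by linarith [hs.1, hs.2, ht.1], by linarith [hs.1, hs.2, ht.1]⟩
    have hd : ∀ s ∈ Icc 0 (-t), HasDerivAt (fun s => w (-s)) (-w' (-s)) s := fun s hs => by
      simpa [Function.comp_def] using (hw (-s) (hsub s hs)).scomp s (hasDerivAt_neg s)
    have := norm_le_gronwallBound_of_norm_deriv_right_le (f := fun s => w (-s))
      (f' := fun s => -w' (-s)) (K := K) (ε := ε)
      (δ := ‖w 0‖) (a := 0) (b := -t)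
      (fun s hs => (hd s hs).continuousAt.continuousWithinAt)
      (fun s hs => (hd s ⟨hs.1, hs.2.le⟩).hasDerivWithinAt) (by simp)
      (fun s hs => by simpa using hb (-s) (hsub s ⟨hs.1, hs.2.le⟩)) (-t) ⟨by linarith, le_rfl⟩
    simpa [abs_of_nonpos h0] using this

/-- Boundedness lets Picard–Lindelöf run on `[-(n+1), n+1]` in a ball of radius `L (n+1)` for every
`n`; by uniqueness the pieces agree. -/
theorem exists_global_solution [CompleteSpace E] {f : E → E} {K L : NNReal}
    (hK : LipschitzWith K f) (hL : ∀ x, ‖f x‖ ≤ L) (x : E) :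
    ∃ u : ℝ → E, u 0 = x ∧ ∀ t, HasDerivAt u (f (u t)) t := by
  have key : ∀ n : ℕ, ∃ α : ℝ → E, α 0 = x ∧
      ∀ t ∈ Ioo (-(n + 1 : ℝ)) (n + 1), HasDerivAt α (f (α t)) t := by
    intro n
    have hn : (0 : ℝ) ≤ n + 1 := by positivity
    have hpl : IsPicardLindelof (fun _ => f) (tmin := -(n + 1 : ℝ)) (tmax := n + 1)
        ⟨0, by constructor <;> linarith⟩ x (L * (n + 1)) 0 L K :=
      IsPicardLindelof.of_time_independent (fun x _ => hL x) hK.lipschitzOnWith (by simp)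
    obtain ⟨α, h0, hα⟩ := hpl.exists_eq_forall_mem_Icc_hasDerivWithinAt₀
    exact ⟨α, h0, fun t ht =>
      (hα t (Ioo_subset_Icc_self ht)).hasDerivAt (Icc_mem_nhds ht.1 ht.2)⟩
  choose α h0 hα using key
  have huniq : ∀ (n m : ℕ) (t : ℝ), |t| < n + 1 → |t| < m + 1 → α n t = α m t := by
    intro n m t hn hm
    wlog hnm : n ≤ m generalizing n m
    · exact (this m n hm hn (le_of_not_ge hnm)).symm
    have hnm' : (n : ℝ) ≤ m := by exact_mod_cast hnm
    refine ODE_solution_unique_of_mem_Ioo (v := fun _ => f) (K := K) (s := fun _ => univ)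
      (a := -(n + 1 : ℝ)) (b := n + 1) (t₀ := 0) (fun _ _ => hK.lipschitzOnWith)
      ⟨by linarith [Nat.cast_nonneg (α := ℝ) n], by positivity⟩
      (fun s hs => ⟨hα n s hs, mem_univ _⟩)
      (fun s hs => ⟨hα m s ⟨by linarith [hs.1], by linarith [hs.2]⟩, mem_univ _⟩)
      (by rw [h0, h0]) (abs_lt.1 hn)
  refine ⟨fun t => α ⌈|t|⌉₊ t, by simpa using h0 0, fun t => ?_⟩
  have ht : |t| < (⌈|t|⌉₊ : ℝ) + 1 := by linarith [Nat.le_ceil |t|]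
  refine (hα ⌈|t|⌉₊ t (abs_lt.1 ht)).congr_of_eventuallyEq ?_
  filter_upwards [Ioo_mem_nhds (abs_lt.1 ht).1 (abs_lt.1 ht).2] with s hs
  exact huniq _ _ _ (by linarith [Nat.le_ceil |s|]) (abs_lt.2 hs)

/-- `φ` is the global `C¹` flow of the bounded Lipschitz vector field `f`. -/
structure IsFlow (f : E → E) (φ : ℝ → E → E) : Prop where
  zero : ∀ x, φ 0 x = x
  hasDerivAt : ∀ x t, HasDerivAt (fun t => φ t x) (f (φ t x)) t
  contDiff : ContDiff ℝ 1 (fun q : E × ℝ => φ q.2 q.1)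
  lipschitz : ∃ K, LipschitzWith K f
  bounded : ∃ L : ℝ, ∀ x, ‖f x‖ ≤ L
  variational : ∀ x t v, HasDerivAt (fun t => fderiv ℝ (φ t) x v)
    (fderiv ℝ f (φ t x) (fderiv ℝ (φ t) x v)) t

/-- Existence and continuous dependence for the linear equation on a short interval. -/
theorem exists_linear_solution [CompleteSpace E] {A : ℝ → E →L[ℝ] E} {K : NNReal}
    (hA : Continuous A) (hK : ∀ t, ‖A t‖ ≤ K) {h : ℝ} (h0 : 0 < h) (hh : 2 * K * h ≤ 1) :
    ∃ M : ℝ → E →L[ℝ] E, M 0 = ContinuousLinearMap.id ℝ E ∧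
      ∀ t ∈ Ioo (-h) h, HasDerivAt M ((A t).comp (M t)) t := by
  -- On the unit ball around the identity the field has norm at most `2K`, so a solution cannot
  -- leave it before time `h` if `2Kh ≤ 1`.
  have hpl : IsPicardLindelof (fun t (M : E →L[ℝ] E) => (A t).comp M) (tmin := -h) (tmax := h)
      ⟨0, by constructor <;> linarith⟩ (ContinuousLinearMap.id ℝ E) 1 0 (K * 2) K := by
    refine ⟨fun t _ => LipschitzWith.lipschitzOnWith ?_, fun M _ => ?_, fun t _ M hM => ?_, ?_⟩
    · refine LipschitzWith.of_dist_le_mul fun M N => ?_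
      rw [dist_eq_norm, dist_eq_norm, ← ContinuousLinearMap.comp_sub]
      exact (ContinuousLinearMap.opNorm_comp_le _ _).trans
        (mul_le_mul_of_nonneg_right (hK t) (norm_nonneg _))
    · exact (hA.clm_comp continuous_const).continuousOn
    · have h1 : ‖M‖ ≤ 2 := by
        have h2 : ‖M - ContinuousLinearMap.id ℝ E‖ ≤ 1 := by simpa [dist_eq_norm] using hM
        have h3 : ‖ContinuousLinearMap.id ℝ E‖ ≤ 1 := ContinuousLinearMap.norm_id_le
        calc ‖M‖ = ‖(M - ContinuousLinearMap.id ℝ E) + ContinuousLinearMap.id ℝ E‖ := by simp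
          _ ≤ 1 + 1 := (norm_add_le _ _).trans (add_le_add h2 h3)
          _ = 2 := by norm_num
      calc ‖(A t).comp M‖ ≤ ‖A t‖ * ‖M‖ := ContinuousLinearMap.opNorm_comp_le _ _
        _ ≤ K * 2 := by gcongr; exact hK t
        _ = _ := by simp
    · simp only [sub_zero, zero_sub, neg_neg, max_self]
      push_cast
      linarith
  obtain ⟨α, hα0, hα⟩ := hpl.exists_eq_forall_mem_Icc_hasDerivWithinAt₀
  exact ⟨α, hα0, fun t ht =>
      (hα t (Ioo_subset_Icc_self ht)).hasDerivAt (Icc_mem_nhds ht.1 ht.2)⟩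


theorem gronwallBound_zero_le {K ε t : ℝ} (hK : 0 ≤ K) (hε : 0 ≤ ε) :
    gronwallBound 0 K ε t ≤ ε * (t * Real.exp (K * t)) := by
  rcases hK.eq_or_lt with rfl | hK
  · simp [gronwallBound_K0]
  · rw [gronwallBound_of_K_ne_0 hK.ne']
    have h1 : Real.exp (K * t) - 1 ≤ K * t * Real.exp (K * t) := by
      have h2 := Real.add_one_le_exp (-(K * t))
      have h3 : Real.exp (-(K * t)) * Real.exp (K * t) = 1 := by
        rw [← Real.exp_add]; simp
      nlinarith [Real.exp_pos (K * t)]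
    calc 0 * Real.exp (K * t) + ε / K * (Real.exp (K * t) - 1)
        ≤ 0 + ε / K * (K * t * Real.exp (K * t)) := by
          rw [zero_mul]; gcongr
      _ = _ := by field_simp; ring

theorem dist_flow_le {f : E → E} {φ : ℝ → E → E} {K : NNReal} (hK : LipschitzWith K f)
    (h0 : ∀ x, φ 0 x = x) (hφ : ∀ x t, HasDerivAt (fun t => φ t x) (f (φ t x)) t)
    (t : ℝ) (x y : E) : ‖φ t x - φ t y‖ ≤ ‖x - y‖ * Real.exp (K * |t|) := by
  have := norm_le_gronwallBound_abs (w := fun s => φ s x - φ s y)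
    (w' := fun s => f (φ s x) - f (φ s y)) (h := |t| + 1) (K := K) (ε := 0)
    (fun s _ => (hφ x s).sub (hφ y s))
    (fun s _ => by simpa using hK.norm_sub_le (φ s x) (φ s y)) t
    ⟨by linarith [neg_abs_le t], by linarith [le_abs_self t]⟩
  simpa [gronwallBound_ε0, h0] using this

/-- The candidate `M` solves the variational equation. Grönwall applied to `φ s y - φ s x - M x s (y
- x)` gives a quadratic bound, because a Lipschitz derivative makes the Taylor remainder of `f`
quadratic. -/
theorem exists_local_flow_derivative [CompleteSpace E] {f : E → E} {φ : ℝ → E → E} {K C : NNReal}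
    (hf : ContDiff ℝ 1 f) (hK : LipschitzWith K f) (hC : LipschitzWith C (fderiv ℝ f))
    (h0 : ∀ x, φ 0 x = x) (hφ : ∀ x t, HasDerivAt (fun t => φ t x) (f (φ t x)) t)
    {h : ℝ} (hh0 : 0 < h) (hh : 2 * K * h ≤ 1) :
    ∃ M : E → ℝ → E →L[ℝ] E, (∀ x, M x 0 = ContinuousLinearMap.id ℝ E) ∧
      (∀ x, ∀ t ∈ Ioo (-h) h, HasDerivAt (M x) ((fderiv ℝ f (φ t x)).comp (M x t)) t) ∧
      (∀ x, ∀ t ∈ Ioo (-h) h, HasFDerivAt (φ t) (M x t) x) ∧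
      ContinuousOn (fun q : E × ℝ => M q.1 q.2) (univ ×ˢ Ioo (-h) h) := by
  have hKf : ∀ x, ‖fderiv ℝ f x‖ ≤ K := fun x => norm_fderiv_le_of_lipschitz ℝ hK
  have hcont : ∀ x, Continuous fun t => φ t x := fun x =>
    continuous_iff_continuousAt.2 fun t => (hφ x t).continuousAt
  have hcf : Continuous (fderiv ℝ f) := hC.continuous
  choose M hM0 hM using fun x => exists_linear_solution (hcf.comp (hcont x))
    (fun t => hKf (φ t x)) hh0 hh
  set B : ℝ := Real.exp (K * h) with hB
  have hBpos : 0 < B := Real.exp_pos _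
  have hexp : ∀ t ∈ Ioo (-h) h, Real.exp (K * |t|) ≤ B := fun t ht =>
    Real.exp_le_exp.2 (mul_le_mul_of_nonneg_left (abs_lt.2 ht).le K.2)
  have hMb : ∀ x, ∀ t ∈ Ioo (-h) h, ‖M x t‖ ≤ B := by
    intro x t ht
    have h1 := norm_le_gronwallBound_abs (K := K) (ε := 0) (hM x) (fun s hs => by
      simpa using (ContinuousLinearMap.opNorm_comp_le _ _).trans
        (mul_le_mul_of_nonneg_right (hKf (φ s x)) (norm_nonneg _))) t ht
    rw [gronwallBound_ε0, hM0] at h1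
    calc ‖M x t‖ ≤ _ := h1
      _ ≤ 1 * B := mul_le_mul ContinuousLinearMap.norm_id_le (hexp t ht) (Real.exp_pos _).le
        zero_le_one
      _ = B := one_mul B
  have hφd : ∀ x y, ∀ t ∈ Ioo (-h) h, ‖φ t x - φ t y‖ ≤ ‖x - y‖ * B := fun x y t ht =>
    (dist_flow_le hK h0 hφ t x y).trans (mul_le_mul_of_nonneg_left (hexp t ht) (norm_nonneg _))
  have hgr : ∀ ε : ℝ, 0 ≤ ε → ∀ t ∈ Ioo (-h) h, gronwallBound 0 K ε |t| ≤ ε * (h * B) := by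
    intro ε hε t ht
    refine (gronwallBound_zero_le K.2 hε ).trans ?_
    have := (abs_lt.2 ht).le
    gcongr
    exact hexp t ht
  have hML : ∀ x y, ∀ t ∈ Ioo (-h) h, ‖M y t - M x t‖ ≤ C * B * B * (h * B) * ‖y - x‖ := by
    intro x y t ht
    have h1 := norm_le_gronwallBound_abs (w := fun s => M y s - M x s) (K := K)
      (ε := C * (‖y - x‖ * B) * B)
      (fun s hs => (hM y s hs).sub (hM x s hs)) (fun s hs => by
        have h2 : (fderiv ℝ f (φ s y)).comp (M y s) - (fderiv ℝ f (φ s x)).comp (M x s)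
          = (fderiv ℝ f (φ s x)).comp (M y s - M x s)
            + (fderiv ℝ f (φ s y) - fderiv ℝ f (φ s x)).comp (M y s) := by
          ext v; simp
        rw [Function.comp_apply, Function.comp_apply, h2]
        refine (norm_add_le _ _).trans (add_le_add ?_ ?_)
        · exact (ContinuousLinearMap.opNorm_comp_le _ _).trans
            (mul_le_mul_of_nonneg_right (hKf (φ s x)) (norm_nonneg _))
        · refine (ContinuousLinearMap.opNorm_comp_le _ _).trans
            (mul_le_mul ?_ (hMb y s hs) (norm_nonneg _) (by positivity))
          exact (hC.norm_sub_le _ _).trans (mul_le_mul_of_nonneg_left (hφd y x s hs) C.2)) t ht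
    simp only [hM0, sub_self, norm_zero] at h1
    refine (h1.trans (hgr _ (by positivity) t ht)).trans (le_of_eq (by ring))
  refine ⟨M, hM0, hM, fun x t ht => ?_, ?_⟩
  · have hquad : ∀ a b : E, ‖f b - f a - fderiv ℝ f a (b - a)‖ ≤ C * ‖b - a‖ * ‖b - a‖ := by
      intro a b
      refine Convex.norm_image_sub_le_of_norm_hasFDerivWithin_le' (s := segment ℝ a b)
        (fun z _ => ((hf.differentiable one_ne_zero) z).hasFDerivAt.hasFDerivWithinAt)
        (fun z hz => ?_) (convex_segment a b) (left_mem_segment ℝ a b) (right_mem_segment ℝ a b)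
      refine (hC.norm_sub_le z a).trans (mul_le_mul_of_nonneg_left ?_ C.2)
      exact norm_sub_le_of_mem_segment hz
    have hest : ∀ y, ‖φ t y - φ t x - M x t (y - x)‖ ≤ C * B * B * (h * B) * ‖y - x‖ * ‖y - x‖ := by
      intro y
      have h1 := norm_le_gronwallBound_abs (w := fun s => φ s y - φ s x - M x s (y - x)) (K := K)
        (ε := C * (‖y - x‖ * B) * (‖y - x‖ * B))
        (w' := fun s => f (φ s y) - f (φ s x) - (fderiv ℝ f (φ s x)) (M x s (y - x)))
        (fun s hs => ((hφ y s).sub (hφ x s)).sub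
          (by simpa using (hM x s hs).clm_apply (hasDerivAt_const s (y - x)))) (fun s hs => by
          have h2 : f (φ s y) - f (φ s x) - (fderiv ℝ f (φ s x)) (M x s (y - x))
            = fderiv ℝ f (φ s x) (φ s y - φ s x - M x s (y - x))
              + (f (φ s y) - f (φ s x) - fderiv ℝ f (φ s x) (φ s y - φ s x)) := by
            rw [map_sub (fderiv ℝ f (φ s x)) (φ s y - φ s x)]; abel
          rw [h2]
          refine (norm_add_le _ _).trans (add_le_add ?_ ?_)
          · exact ((fderiv ℝ f (φ s x)).le_opNorm _).trans
              (mul_le_mul_of_nonneg_right (hKf (φ s x)) (norm_nonneg _))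
          · refine (hquad _ _).trans ?_
            have := hφd y x s hs
            gcongr) t ht
      simp only [h0, hM0, ContinuousLinearMap.id_apply, sub_self, norm_zero] at h1
      refine (h1.trans (hgr _ (by positivity) t ht)).trans (le_of_eq (by ring))
    refine HasFDerivAt.of_isLittleO ?_
    refine Asymptotics.IsBigO.trans_isLittleO (g := fun y => ‖y - x‖ * ‖y - x‖)
      (Asymptotics.IsBigO.of_bound (C * B * B * (h * B)) (Eventually.of_forall fun y => ?_)) ?_
    · refine (hest y).trans (le_of_eq ?_)
      rw [Real.norm_of_nonneg (by positivity)]; ring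
    · have h3 : (fun y : E => ‖y - x‖) =o[𝓝 x] (fun _ => (1 : ℝ)) := by
        rw [Asymptotics.isLittleO_one_iff]
        have : Continuous fun y : E => ‖y - x‖ := by fun_prop
        simpa using this.tendsto x
      simpa using! h3.mul_isBigO (Asymptotics.isBigO_refl (fun y : E => ‖y - x‖) (𝓝 x)) |>.norm_right
  · refine continuousOn_prod_of_continuousOn_lipschitzOnWith _
      (Real.toNNReal (C * B * B * (h * B))) (fun x _ => ?_) (fun t ht => ?_)
    · exact fun t ht => (hM x t ht).continuousAt.continuousWithinAt
    · refine LipschitzOnWith.of_dist_le_mul fun x _ y _ => ?_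
      rw [dist_eq_norm, dist_eq_norm, Real.coe_toNNReal _ (by positivity)]
      exact hML y x t ht


theorem flow_add_of_hasDerivAt {f : E → E} {φ : ℝ → E → E} {K : NNReal} (hK : LipschitzWith K f)
    (h0 : ∀ x, φ 0 x = x) (hφ : ∀ x t, HasDerivAt (fun t => φ t x) (f (φ t x)) t)
    (s t : ℝ) (x : E) : φ (s + t) x = φ s (φ t x) := by
  have := ODE_solution_unique_univ (v := fun _ => f) (K := K) (s := fun _ => univ)
    (f := fun s => φ (s + t) x) (g := fun s => φ s (φ t x)) (t₀ := 0)
    (fun _ => hK.lipschitzOnWith)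
    (fun s => ⟨(hφ x (s + t)).comp_add_const s t, mem_univ _⟩)
    (fun s => ⟨hφ (φ t x) s, mem_univ _⟩) (by simp [h0])
  exact congrFun this s

/-- For short times the partial derivatives `M` and `f ∘ φ` are continuous, which gives joint `C¹`
regularity; the group law carries this, and the variational equation at time `0`, to all times. -/
theorem exists_isFlow [CompleteSpace E] {f : E → E} (hf : ContDiff ℝ 2 f)
    (hsupp : HasCompactSupport f) : ∃ φ, IsFlow f φ := by
  have hf1 : ContDiff ℝ 1 f := hf.of_le (by norm_num)
  obtain ⟨K, hK⟩ := hf1.lipschitzWith_of_hasCompactSupport hsupp one_ne_zero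
  obtain ⟨C, hC⟩ := (hf.fderiv_right (m := 1) (by norm_num)).lipschitzWith_of_hasCompactSupport
    (hsupp.fderiv ℝ) one_ne_zero
  obtain ⟨L, hL⟩ := hsupp.exists_bound_of_continuous hf1.continuous
  choose u hu0 hu using exists_global_solution (L := L.toNNReal) hK
    (fun x => (hL x).trans (Real.le_coe_toNNReal L))
  set φ : ℝ → E → E := fun t x => u x t with hφdef
  have h0 : ∀ x, φ 0 x = x := hu0
  have hφ : ∀ x t, HasDerivAt (fun t => φ t x) (f (φ t x)) t := hu
  have hadd := flow_add_of_hasDerivAt hK h0 hφ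
  obtain ⟨h, hh0, hh⟩ : ∃ h : ℝ, 0 < h ∧ 2 * K * h ≤ 1 := by
    refine ⟨1 / (2 * K + 1), by positivity, ?_⟩
    rw [mul_one_div, div_le_one (by positivity)]
    linarith
  obtain ⟨M, hM0, hM, hMf, hMc⟩ := exists_local_flow_derivative hf1 hK hC h0 hφ hh0 hh
  have hcφ : Continuous fun q : E × ℝ => φ q.2 q.1 := by
    rw [continuous_iff_continuousAt]
    intro q
    have : ContinuousOn (fun q : E × ℝ => φ q.2 q.1) (univ ×ˢ Ioo (-(|q.2| + 1)) (|q.2| + 1)) := by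
      refine continuousOn_prod_of_continuousOn_lipschitzOnWith _
        (Real.toNNReal (Real.exp (K * (|q.2| + 1)))) (fun x _ => ?_) (fun t ht => ?_)
      · exact fun t _ => (hφ x t).continuousAt.continuousWithinAt
      · refine LipschitzOnWith.of_dist_le_mul fun x _ y _ => ?_
        rw [dist_eq_norm, dist_eq_norm, Real.coe_toNNReal _ (Real.exp_pos _).le, mul_comm]
        refine (dist_flow_le hK h0 hφ t x y).trans ?_
        have := (abs_lt.2 ht).le
        gcongr
    refine this.continuousAt (prod_mem_nhds univ_mem (Ioo_mem_nhds ?_ ?_))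
    · linarith [neg_abs_le q.2]
    · linarith [le_abs_self q.2]
  have hloc : ∀ x, ∀ t ∈ Ioo (-h) h, ContDiffAt ℝ 1 (fun q : E × ℝ => φ q.2 q.1) (x, t) := by
    intro x t ht
    have hopen : IsOpen ((univ : Set E) ×ˢ Ioo (-h) h) := isOpen_univ.prod isOpen_Ioo
    have hcf2 : Continuous fun q : E × ℝ => ContinuousLinearMap.toSpanSingleton ℝ (f (φ q.2 q.1)) :=
      (ContinuousLinearMap.toSpanSingletonCLE (𝕜 := ℝ) (E := E)).continuous.comp
        (hf1.continuous.comp hcφ)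
    refine contDiffAt_one_iff.2 ⟨fun q => (M q.1 q.2).coprod
      (ContinuousLinearMap.toSpanSingleton ℝ (f (φ q.2 q.1))), _,
      hopen.mem_nhds (⟨mem_univ _, ht⟩ : (x, t) ∈ univ ×ˢ Ioo (-h) h), ?_, ?_⟩
    · exact hMc.continuousLinearMapCoprod hcf2.continuousOn
    · rintro ⟨y, s⟩ hs
      have hn := hopen.mem_nhds hs
      refine (hasStrictFDerivAt_uncurry_coprod (f := fun y s => φ s y) (u := (y, s))
        (f₁ := fun y s => M y s)
        (f₂ := fun y s => ContinuousLinearMap.toSpanSingleton ℝ (f (φ s y))) ?_ ?_ ?_ ?_).hasFDerivAt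
      · filter_upwards [hn] with q hq using hMf q.1 q.2 hq.2
      · exact Eventually.of_forall fun q => (hφ q.1 q.2).hasFDerivAt
      · exact hMc.continuousAt hn
      · exact hcf2.continuousAt
  have hslice : ∀ t ∈ Ioo (-h) h, ContDiff ℝ 1 (φ t) := fun t ht =>
    contDiff_iff_contDiffAt.2 fun x =>
      (hloc x t ht).comp x (contDiffAt_id.prodMk contDiffAt_const)
  -- `φ t` is an iterate of `φ (t / n)`, where `t / n` lies in the short interval already treated.
  have hslice' : ∀ t, ContDiff ℝ 1 (φ t) := by
    intro t
    obtain ⟨n, hn⟩ := exists_nat_gt (|t| / h)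
    have hn0 : (0 : ℝ) < n := (div_nonneg (abs_nonneg t) hh0.le).trans_lt hn
    have hsmall : t / n ∈ Ioo (-h) h := by
      rw [mem_Ioo, ← abs_lt, abs_div, Nat.abs_cast, div_lt_comm₀ hn0 hh0]
      exact hn
    have hit : ∀ m : ℕ, ContDiff ℝ 1 (φ (m * (t / n))) := by
      intro m
      induction m with
      | zero => rw [Nat.cast_zero, zero_mul, show φ 0 = id from funext h0]; exact contDiff_id
      | succ m ih =>
        have : φ ((m + 1 : ℕ) * (t / n)) = φ (t / n) ∘ φ (m * (t / n)) := by
          ext x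
          rw [Function.comp_apply, ← hadd]
          congr 1; push_cast; ring
        rw [this]
        exact (hslice _ hsmall).comp ih
    have := hit n
    rwa [mul_div_cancel₀ t hn0.ne'] at this
  have hcd : ContDiff ℝ 1 (fun q : E × ℝ => φ q.2 q.1) := by
    rw [contDiff_iff_contDiffAt]
    rintro ⟨x, t⟩
    have : (fun q : E × ℝ => φ q.2 q.1) = fun q => φ t ((fun q : E × ℝ => φ q.2 q.1) (q.1, q.2 - t)) := by
      ext q
      rw [← hadd]; congr 1; ring
    rw [this]
    have hg : ContDiffAt ℝ 1 (fun q : E × ℝ => (q.1, q.2 - t)) (x, t) := by fun_prop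
    have hl : ContDiffAt ℝ 1 (fun q : E × ℝ => φ q.2 q.1) ((fun q : E × ℝ => (q.1, q.2 - t)) (x, t)) :=
      hloc x _ (by simp [hh0])
    exact ContDiffAt.comp (g := φ t) (f := fun q : E × ℝ => φ (q.2 - t) q.1) (x, t)
      (hslice' t).contDiffAt
      (ContDiffAt.comp (g := fun q : E × ℝ => φ q.2 q.1) (f := fun q : E × ℝ => (q.1, q.2 - t))
        (x, t) hl hg)
  refine ⟨φ, h0, hφ, hcd, ⟨K, hK⟩, ⟨L, hL⟩, fun x t v => ?_⟩
  have hd : ∀ t x, DifferentiableAt ℝ (φ t) x := fun t x =>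
    (hslice' t).differentiable one_ne_zero x
  have hev : (fun s => fderiv ℝ (φ s) x v) =ᶠ[𝓝 t]
      fun s => M (φ t x) (s - t) (fderiv ℝ (φ t) x v) := by
    filter_upwards [Ioo_mem_nhds (sub_lt_self t hh0) (lt_add_of_pos_right t hh0)] with s hs
    have : φ s = φ (s - t) ∘ φ t := by
      ext y; simp [← hadd]
    rw [this, fderiv_comp x (hd _ _) (hd _ _),
      (hMf (φ t x) (s - t) ⟨by linarith [hs.1], by linarith [hs.2]⟩).fderiv]
    rfl
  refine HasDerivAt.congr_of_eventuallyEq ?_ hev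
  have h1 := (hM (φ t x) 0 ⟨by linarith, hh0⟩)
  rw [h0, hM0, ContinuousLinearMap.comp_id, ← sub_self t] at h1
  have h2 := (h1.comp_sub_const t t).clm_apply (hasDerivAt_const t (fderiv ℝ (φ t) x v))
  simpa using h2

namespace IsFlow

variable {f : E → E} {φ : ℝ → E → E}

theorem add (hφ : IsFlow f φ) (s t : ℝ) (x : E) : φ (s + t) x = φ s (φ t x) := by
  obtain ⟨K, hK⟩ := hφ.lipschitz
  exact flow_add_of_hasDerivAt hK hφ.zero hφ.hasDerivAt s t x

theorem neg_apply (hφ : IsFlow f φ) (t : ℝ) (x : E) : φ (-t) (φ t x) = x := by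
  rw [← hφ.add, neg_add_cancel, hφ.zero]

theorem apply_neg (hφ : IsFlow f φ) (t : ℝ) (x : E) : φ t (φ (-t) x) = x := by
  rw [← hφ.add, add_neg_cancel, hφ.zero]

theorem continuous (hφ : IsFlow f φ) : Continuous fun q : E × ℝ => φ q.2 q.1 :=
  hφ.contDiff.continuous

theorem contDiff_slice (hφ : IsFlow f φ) (t : ℝ) : ContDiff ℝ 1 (φ t) :=
  hφ.contDiff.comp (contDiff_id.prodMk contDiff_const)

theorem hasFDerivAt_slice (hφ : IsFlow f φ) (t : ℝ) (x : E) :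
    HasFDerivAt (φ t) (fderiv ℝ (φ t) x) x :=
  ((hφ.contDiff_slice t).differentiable one_ne_zero x).hasFDerivAt

theorem exists_dist_le (hφ : IsFlow f φ) : ∃ K : ℝ, 0 ≤ K ∧
    ∀ t x y, dist (φ t x) (φ t y) ≤ Real.exp (K * |t|) * dist x y := by
  obtain ⟨K, hK⟩ := hφ.lipschitz
  refine ⟨K, K.2, fun t x y => ?_⟩
  rw [dist_eq_norm, dist_eq_norm, mul_comm]
  exact dist_flow_le hK hφ.zero hφ.hasDerivAt t x y

theorem exists_dist_time_le (hφ : IsFlow f φ) : ∃ L : ℝ, 0 ≤ L ∧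
    ∀ t s x, dist (φ t x) (φ s x) ≤ L * |t - s| := by
  obtain ⟨L, hL⟩ := hφ.bounded
  refine ⟨L, (norm_nonneg _).trans (hL 0 : ‖f 0‖ ≤ L), fun t s x => ?_⟩
  rw [dist_eq_norm, ← Real.norm_eq_abs]
  exact Convex.norm_image_sub_le_of_norm_hasDerivWithin_le (s := univ)
    (fun r _ => (hφ.hasDerivAt x r).hasDerivWithinAt) (fun r _ => hL _) convex_univ
    (mem_univ s) (mem_univ t)

theorem eq_of_hasDerivAt (hφ : IsFlow f φ) {u : ℝ → E} (hu : ∀ t, HasDerivAt u (f (u t)) t)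
    (s t : ℝ) : u (s + t) = φ s (u t) := by
  obtain ⟨K, hK⟩ := hφ.lipschitz
  have := ODE_solution_unique_univ (v := fun _ => f) (K := K) (s := fun _ => univ)
    (f := fun s => u (s + t)) (g := fun s => φ s (u t)) (t₀ := 0)
    (fun _ => hK.lipschitzOnWith)
    (fun s => ⟨(hu (s + t)).comp_add_const s t, mem_univ _⟩)
    (fun s => ⟨hφ.hasDerivAt (u t) s, mem_univ _⟩) (by simp [hφ.zero])
  exact congrFun this s

theorem eq_of_integralCurveOn_Icc (hφ : IsFlow f φ) {u : ℝ → E} {a b : ℝ}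
    (hu : IsIntegralCurveOn u (fun _ => f) (Icc a b)) :
    ∀ t ∈ Icc a b, u t = φ (t - a) (u a) := by
  obtain ⟨K, hK⟩ := hφ.lipschitz
  refine ODE_solution_unique (v := fun _ => f) (K := K) (fun _ => hK) hu.continuousOn
    (fun t ht => ?_) ?_ (fun t _ => ?_) (by simp [hφ.zero])
  · exact (hu t ⟨ht.1, ht.2.le⟩).mono_of_mem_nhdsWithin (Icc_mem_nhdsGE_of_mem ht)
  · exact fun t _ => ((hφ.hasDerivAt (u a) (t - a)).comp_sub_const t a).continuousAt.continuousWithinAt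
  · exact ((hφ.hasDerivAt (u a) (t - a)).comp_sub_const t a).hasDerivWithinAt

theorem fderiv_zero_time (hφ : IsFlow f φ) (x : E) :
    fderiv ℝ (φ 0) x = ContinuousLinearMap.id ℝ E := by
  rw [show φ 0 = id from funext hφ.zero, fderiv_id]

/-- Differentiate `φ t (φ s x) = φ s (φ t x)` in `s` at `s = 0`. -/
theorem fderiv_apply_field (hφ : IsFlow f φ) (t : ℝ) (x : E) :
    fderiv ℝ (φ t) x (f x) = f (φ t x) := by
  have h1 : HasDerivAt (fun s => φ t (φ s x)) (fderiv ℝ (φ t) x (f x)) 0 := by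
    have h2 := hφ.hasFDerivAt_slice t (φ 0 x)
    have h3 := h2.comp_hasDerivAt (0 : ℝ) (hφ.hasDerivAt x 0)
    simpa only [hφ.zero, Function.comp_def] using h3
  have h4 : HasDerivAt (fun s => φ t (φ s x)) (f (φ t x)) 0 := by
    have h5 := hφ.hasDerivAt (φ t x) 0
    rw [hφ.zero] at h5
    refine h5.congr_of_eventuallyEq (Eventually.of_forall fun s => ?_)
    change φ t (φ s x) = φ s (φ t x)
    rw [← hφ.add, ← hφ.add, add_comm]
  exact h1.unique h4

theorem reverse (hφ : IsFlow f φ) : IsFlow (fun x => -f x) (fun t => φ (-t)) where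
  zero x := by simp [hφ.zero]
  hasDerivAt x t := by
    simpa [Function.comp_def] using (hφ.hasDerivAt x (-t)).scomp t (hasDerivAt_neg t)
  contDiff := hφ.contDiff.comp (g := fun q : E × ℝ => φ q.2 q.1) (f := fun q : E × ℝ => (q.1, -q.2))
    (by fun_prop)
  lipschitz := by
    obtain ⟨K, hK⟩ := hφ.lipschitz
    exact ⟨K, hK.neg⟩
  bounded := by
    obtain ⟨L, hL⟩ := hφ.bounded
    exact ⟨L, fun x => by simpa using hL x⟩
  variational x t v := by
    have h := (hφ.variational x (-t) v).scomp t (hasDerivAt_neg t)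
    rw [show (fun x => -f x) = -f from rfl, fderiv_neg]
    simpa [Function.comp_def] using h

end IsFlow

end Flow

/-! ### Green's functions of hyperbolic linear maps, and Newton's method. -/

section GreenKernels

open Polynomial

/-- The solution is the convolution `κ n = ∑ m, z ^ m * c (n - 1 - m)` with a geometric sequence. -/
theorem exists_summable_shift_sub_of_norm_lt_one {z : ℂ} (hz : ‖z‖ < 1) {c : ℤ → ℂ}
    (hc : Summable fun n => ‖c n‖) :
    ∃ κ : ℤ → ℂ, (Summable fun n => ‖κ n‖) ∧ ∀ n, κ (n + 1) - z * κ n = c n := by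
  set g : ℤ × ℕ → ℂ := fun q => z ^ q.2 * c (q.1 - 1 - q.2) with hg
  have hs : Summable fun q => ‖g q‖ := by
    have h1 : Summable fun q : ℤ × ℕ => ‖c q.1‖ * ‖z‖ ^ q.2 :=
      hc.mul_of_nonneg (summable_geometric_of_lt_one (norm_nonneg _) hz)
        (fun _ => norm_nonneg _) (fun _ => by positivity)
    have h2 : Function.Injective fun q : ℤ × ℕ => ((q.1 - 1 - q.2 : ℤ), q.2) := by
      rintro ⟨a, b⟩ ⟨a', b'⟩ h
      simp only [Prod.mk.injEq] at h
      obtain ⟨h1, rfl⟩ := h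
      simpa using h1
    refine (h1.comp_injective h2).congr fun q => ?_
    simp [hg, mul_comm]
  have hs1 : ∀ n, Summable fun m => g (n, m) := fun n =>
    (hs.comp_injective (Prod.mk_right_injective n)).of_norm
  refine ⟨fun n => ∑' m, g (n, m), ?_, fun n => ?_⟩
  · exact Summable.of_nonneg_of_le (fun _ => norm_nonneg _)
      (fun n => norm_tsum_le_tsum_norm (hs.comp_injective (Prod.mk_right_injective n))) hs.prod
  · beta_reduce
    rw [(hs1 (n + 1)).tsum_eq_zero_add, ← tsum_mul_left]
    have : ∀ m : ℕ, g (n + 1, m + 1) = z * g (n, m) := fun m => by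
      simp only [hg, pow_succ]
      rw [show n + 1 - 1 - ((m + 1 : ℕ) : ℤ) = n - 1 - m by push_cast; ring]
      ring
    rw [tsum_congr this]
    simp [hg]

/-- For `‖z‖ > 1` the reflection `n ↦ -n` turns the recursion into one with factor `z⁻¹`. -/
theorem exists_summable_shift_sub {z : ℂ} (hz : ‖z‖ ≠ 1) {c : ℤ → ℂ}
    (hc : Summable fun n => ‖c n‖) :
    ∃ κ : ℤ → ℂ, (Summable fun n => ‖κ n‖) ∧ ∀ n, κ (n + 1) - z * κ n = c n := by
  rcases lt_or_gt_of_ne hz with h | h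
  · exact exists_summable_shift_sub_of_norm_lt_one h hc
  · have h0 : z ≠ 0 := by
      rintro rfl
      simp at h
      linarith
    have h1 : ‖z⁻¹‖ < 1 := by
      rw [norm_inv]
      exact inv_lt_one_of_one_lt₀ h
    have h2 : Summable fun n : ℤ => ‖-z⁻¹ * c (-n - 1)‖ := by
      have h3 : Function.Injective fun n : ℤ => -n - 1 := fun a b hab => by simpa using hab
      simpa [norm_mul] using (hc.comp_injective h3).mul_left ‖z⁻¹‖
    obtain ⟨κ, hκ, hκe⟩ := exists_summable_shift_sub_of_norm_lt_one h1 h2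
    refine ⟨fun n => κ (-n), hκ.comp_injective neg_injective, fun n => ?_⟩
    have h4 := hκe (-n - 1)
    simp only [sub_add_cancel, neg_sub, sub_neg_eq_add] at h4
    rw [show (1 + n - 1 : ℤ) = n by ring] at h4
    beta_reduce
    rw [show -(n + 1) = -n - 1 by ring]
    have h5 : c n = z * (z⁻¹ * c n) := by field_simp
    have h6 : κ (-n - 1) = z * (z⁻¹ * κ (-n - 1)) := by field_simp
    rw [h5, h6]
    linear_combination -z * h4

/-- The shift of complex sequences. -/
noncomputable def seqShift : Module.End ℂ (ℤ → ℂ) := LinearMap.funLeft ℂ ℂ (· + 1)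

theorem aeval_seqShift_apply (p : ℂ[X]) (f : ℤ → ℂ) (n : ℤ) :
    aeval seqShift p f n = ∑ i ∈ Finset.range (p.natDegree + 1), p.coeff i * f (n + i) := by
  have h : ∀ (i : ℕ) (n : ℤ), (seqShift ^ i) f n = f (n + i) := by
    intro i
    induction i with
    | zero => simp
    | succ i ih =>
      intro n
      rw [pow_succ', Module.End.mul_apply]
      change (seqShift ^ i) f (n + 1) = _
      rw [ih]; congr 1; push_cast; ring
  rw [aeval_eq_sum_range, LinearMap.sum_apply, Finset.sum_apply]
  simp [h]

/-- The polynomial in the shift is a product of first-order factors, which are inverted one after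
the other. -/
theorem exists_summable_aeval_seqShift (s : Multiset ℂ) (hs : ∀ z ∈ s, ‖z‖ ≠ 1) :
    ∀ {c : ℤ → ℂ}, (Summable fun n => ‖c n‖) →
    ∃ κ : ℤ → ℂ, (Summable fun n => ‖κ n‖) ∧
      aeval seqShift (s.map fun z => X - C z).prod κ = c := by
  induction s using Multiset.induction with
  | empty => intro c hc; exact ⟨c, hc, by simp⟩
  | cons z s ih =>
    intro c hc
    obtain ⟨κ₁, h1, h1e⟩ := exists_summable_shift_sub (hs z (by simp)) hc
    obtain ⟨κ, h2, h2e⟩ := ih (fun y hy => hs y (by simp [hy])) h1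
    refine ⟨κ, h2, ?_⟩
    rw [Multiset.map_cons, Multiset.prod_cons, map_mul, Module.End.mul_apply, h2e]
    ext n
    simpa [seqShift, LinearMap.funLeft] using h1e n

/-- Solve over `ℂ`, where the polynomial splits; as its coefficients are real, the real part of the
solution still works. -/
theorem exists_summable_real_kernel {χ : ℝ[X]} (hχ : ∀ z : ℂ, aeval z χ = 0 → ‖z‖ ≠ 1) :
    ∃ κ : ℤ → ℝ, (Summable fun n => |κ n|) ∧ ∀ n,
      ∑ i ∈ Finset.range (χ.natDegree + 1), χ.coeff i * κ (n + i) = if n = 0 then 1 else 0 := by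
  set P : ℂ[X] := χ.map (algebraMap ℝ ℂ) with hP
  have hP0 : P ≠ 0 := by
    intro h
    rw [hP, Polynomial.map_eq_zero] at h
    exact hχ 1 (by simp [h]) (by simp)
  have hsplit : P = C P.leadingCoeff * (P.roots.map fun z => X - C z).prod :=
    (IsAlgClosed.splits P).eq_prod_roots
  have hlead : P.leadingCoeff ≠ 0 := leadingCoeff_ne_zero.2 hP0
  have hroots : ∀ z ∈ P.roots, ‖z‖ ≠ 1 := fun z hz => hχ z (by
    have := (mem_roots hP0).1 hz
    rwa [IsRoot.def, hP, eval_map_algebraMap] at this)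
  have hc : Summable fun n : ℤ => ‖if n = 0 then P.leadingCoeff⁻¹ else 0‖ :=
    summable_of_ne_finset_zero (s := {0}) fun n hn => by simp at hn; simp [hn]
  obtain ⟨κ, hκ, hκe⟩ := exists_summable_aeval_seqShift P.roots hroots hc
  have hPκ : ∀ n, aeval seqShift P κ n = if n = 0 then 1 else 0 := by
    intro n
    rw [hsplit, map_mul, Module.End.mul_apply, hκe]
    simp [hlead]
  refine ⟨fun n => (κ n).re, Summable.of_nonneg_of_le (fun _ => abs_nonneg _)
    (fun n => Complex.abs_re_le_norm _) hκ, fun n => ?_⟩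
  have h := congrArg Complex.re (hPκ n)
  rw [aeval_seqShift_apply, hP, natDegree_map, Complex.re_sum] at h
  simp only [coeff_map, Complex.coe_algebraMap, Complex.re_ofReal_mul] at h
  rw [h]
  split_ifs <;> simp

/-- `Γ` is a summable two-sided Green's function of the difference equation `w (n + 1) = a * w n`. -/
structure IsGreenKernel {𝔸 : Type*} [NormedRing 𝔸] (a : 𝔸) (Γ : ℤ → 𝔸) : Prop where
  summable : Summable fun n => ‖Γ n‖
  left : ∀ n, Γ (n + 1) = a * Γ n + if n = 0 then 1 else 0
  right : ∀ n, Γ (n + 1) = Γ n * a + if n = 0 then 1 else 0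

/-- With `S` the shift and `χ(S) κ = δ₀`, the kernel is `Γ = ((χ(S) - χ(a)) / (S - a)) κ`, a
polynomial expression in `S` and `a`. Then `(S - a) Γ = χ(S) κ - χ(a) κ = δ₀`. Neither spectral
projections nor invertibility of `a` are needed. -/
theorem exists_isGreenKernel {𝔸 : Type*} [NormedRing 𝔸] [NormedAlgebra ℝ 𝔸] {a : 𝔸} {χ : ℝ[X]}
    (ha : aeval a χ = 0) (hχ : ∀ z : ℂ, aeval z χ = 0 → ‖z‖ ≠ 1) : ∃ Γ, IsGreenKernel a Γ := by
  obtain ⟨κ, hκ, hκe⟩ := exists_summable_real_kernel hχ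
  set Γ : ℤ → 𝔸 := fun n => ∑ k ∈ Finset.range (χ.natDegree + 1), χ.coeff k •
    ∑ j ∈ Finset.range k, κ (n + k - 1 - j) • a ^ j with hΓ
  have hleft : ∀ n, Γ (n + 1) = a * Γ n + if n = 0 then 1 else 0 := by
    intro n
    rw [← sub_eq_iff_eq_add']
    -- The telescoping identity `(S - a) ∑ S^(k-1-j) a^j = S^k - a^k`, applied to `κ`.
    have h1 : ∀ k : ℕ, (∑ j ∈ Finset.range k, κ (n + 1 + k - 1 - j) • a ^ j)
        - a * (∑ j ∈ Finset.range k, κ (n + k - 1 - j) • a ^ j)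
        = κ (n + k) • 1 - κ n • a ^ k := by
      intro k
      rw [Finset.mul_sum, ← Finset.sum_sub_distrib]
      have := Finset.sum_range_sub' (fun j : ℕ => κ (n + k - j) • a ^ j) k
      simp only [Nat.cast_zero, sub_zero, pow_zero, add_sub_cancel_right] at this
      rw [← this]
      refine Finset.sum_congr rfl fun j _ => ?_
      rw [mul_smul_comm, ← pow_succ']
      congr 3 <;> push_cast <;> ring
    rw [hΓ]
    simp only [Finset.mul_sum (a := a) (s := Finset.range (χ.natDegree + 1)), mul_smul_comm]
    rw [← Finset.sum_sub_distrib]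
    simp only [← smul_sub, h1]
    simp only [smul_sub, Finset.sum_sub_distrib, smul_smul, ← Finset.sum_smul]
    rw [hκe]
    have h2 : ∑ k ∈ Finset.range (χ.natDegree + 1), (χ.coeff k * κ n) • a ^ k = 0 := by
      simp only [mul_comm _ (κ n), ← smul_smul]
      rw [← Finset.smul_sum, ← aeval_eq_sum_range, ha, smul_zero]
    rw [h2]
    split_ifs <;> simp
  refine ⟨Γ, ?_, hleft, fun n => ?_⟩
  · have h1 : ∀ k j : ℕ, Summable fun n : ℤ => ‖χ.coeff k • κ (n + k - 1 - j) • a ^ j‖ := by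
      intro k j
      have h3 : Function.Injective fun n : ℤ => n + k - 1 - j := fun a b hab => by simpa using hab
      have := ((hκ.comp_injective h3).mul_right ‖a ^ j‖).mul_left ‖χ.coeff k‖
      refine this.congr fun n => ?_
      simp [norm_smul]
    refine Summable.of_nonneg_of_le (fun _ => norm_nonneg _) (fun n => ?_)
      (summable_sum fun k (_ : k ∈ Finset.range (χ.natDegree + 1)) =>
        summable_sum fun j (_ : j ∈ Finset.range k) => h1 k j)
    refine (norm_sum_le _ _).trans (Finset.sum_le_sum fun k _ => ?_)
    rw [Finset.smul_sum]
    exact norm_sum_le _ _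
  · rw [hleft]
    congr 1
    -- `Γ n` is a real polynomial in `a`, so the left equation implies the right one.
    have h1 : Commute a (Γ n) := by
      refine Commute.sum_right _ _ _ fun k _ => Commute.smul_right ?_ _
      exact Commute.sum_right _ _ _ fun j _ =>
        Commute.smul_right (Commute.pow_right (Commute.refl a) j) _
    exact h1.eq

/-- A quantitative Newton iteration for systems of equations `G x i = 0` indexed by `i`, with
uniform bounds in `i`. -/
theorem exists_zero_of_newton_step {ι κ E E' : Type*} [NormedAddCommGroup E] [CompleteSpace E]
    [NormedAddCommGroup E'] (G : (ι → E) → κ → E') (x₀ : ι → E) {K b₀ : ℝ} (hK : 0 ≤ K)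
    (hb₀ : 0 ≤ b₀) (h₀ : ∀ i, ‖G x₀ i‖ ≤ b₀)
    (hstep : ∀ x b, 0 ≤ b → (∀ i, ‖x i - x₀ i‖ + K * b ≤ 2 * K * b₀) → (∀ i, ‖G x i‖ ≤ b) →
      ∃ x', (∀ i, ‖x' i - x i‖ ≤ K * b) ∧ ∀ i, ‖G x' i‖ ≤ b / 2)
    (hcont : ∀ (y : ℕ → ι → E) (x : ι → E), (∀ i, Tendsto (fun m => y m i) atTop (𝓝 (x i))) →
      (∀ m i, ‖y m i - x₀ i‖ ≤ 2 * K * b₀) → (∀ i, ‖x i - x₀ i‖ ≤ 2 * K * b₀) →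
      ∀ j, Tendsto (fun m => G (y m) j) atTop (𝓝 (G x j))) :
    ∃ x, (∀ i, ‖x i - x₀ i‖ ≤ 2 * K * b₀) ∧ ∀ j, G x j = 0 := by
  -- Invariant: distance from `x₀` at most `2 K b₀ (1 - 2⁻ᵐ)`, residual at most `b₀ 2⁻ᵐ`. It stands
  -- as a premise inside the existential so that `choose` yields a next iterate for every `x`.
  have hnext : ∀ (m : ℕ) (x : ι → E), ∃ x' : ι → E,
      ((∀ i, ‖x i - x₀ i‖ ≤ 2 * K * b₀ * (1 - (1 / 2) ^ m)) ∧ ∀ i, ‖G x i‖ ≤ b₀ * (1 / 2) ^ m) →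
      ((∀ i, ‖x' i - x₀ i‖ ≤ 2 * K * b₀ * (1 - (1 / 2) ^ (m + 1))) ∧
        ∀ i, ‖G x' i‖ ≤ b₀ * (1 / 2) ^ (m + 1)) ∧
      ∀ i, ‖x' i - x i‖ ≤ K * b₀ * (1 / 2) ^ m := by
    intro m x
    by_cases hx : (∀ i, ‖x i - x₀ i‖ ≤ 2 * K * b₀ * (1 - (1 / 2) ^ m)) ∧
        ∀ i, ‖G x i‖ ≤ b₀ * (1 / 2) ^ m
    · have hKb : 0 ≤ K * b₀ * (1 / 2) ^ m := by positivity
      obtain ⟨x', h1, h2⟩ := hstep x (b₀ * (1 / 2) ^ m) (by positivity)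
        (fun i => by linarith [hx.1 i]) hx.2
      refine ⟨x', fun _ => ⟨⟨fun i => ?_, fun i => ?_⟩, fun i => ?_⟩⟩
      · have h3 : ‖x' i - x₀ i‖ ≤ ‖x' i - x i‖ + ‖x i - x₀ i‖ := norm_sub_le_norm_sub_add_norm_sub _ _ _
        have := h1 i
        have := hx.1 i
        rw [pow_succ]
        linarith
      · refine (h2 i).trans (le_of_eq ?_)
        rw [pow_succ]; ring
      · refine (h1 i).trans (le_of_eq (by ring))
    · exact ⟨x, fun h => absurd h hx⟩
  choose next hn using hnext
  set y : ℕ → ι → E := fun m => Nat.rec x₀ (fun m x => next m x) m with hy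
  have hy1 : ∀ m, y (m + 1) = next m (y m) := fun m => rfl
  have hinv : ∀ m, (∀ i, ‖y m i - x₀ i‖ ≤ 2 * K * b₀ * (1 - (1 / 2) ^ m)) ∧
      ∀ i, ‖G (y m) i‖ ≤ b₀ * (1 / 2) ^ m := by
    intro m
    induction m with
    | zero => exact ⟨fun i => by simp [hy], fun i => by simpa [hy] using h₀ i⟩
    | succ m ih => exact (hn m (y m) ih).1
  have hdiff : ∀ m i, ‖y (m + 1) i - y m i‖ ≤ K * b₀ * (1 / 2) ^ m := fun m i =>
    (hn m (y m) (hinv m)).2 i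
  have hcau : ∀ i, CauchySeq fun m => y m i := fun i =>
    cauchySeq_of_le_geometric (1 / 2) (K * b₀) (by norm_num) fun m => by
      rw [dist_comm, dist_eq_norm]; exact hdiff m i
  choose x hx using fun i => cauchySeq_tendsto_of_complete (hcau i)
  have hball : ∀ m i, ‖y m i - x₀ i‖ ≤ 2 * K * b₀ := fun m i => by
    refine ((hinv m).1 i).trans ?_
    have : (0 : ℝ) ≤ (1 / 2) ^ m := by positivity
    nlinarith [mul_nonneg hK hb₀]
  have hxball : ∀ i, ‖x i - x₀ i‖ ≤ 2 * K * b₀ := fun i =>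
    le_of_tendsto ((hx i).sub_const (x₀ i)).norm (Eventually.of_forall fun m => hball m i)
  refine ⟨x, hxball, fun j => ?_⟩
  have h1 : Tendsto (fun m => b₀ * (1 / 2 : ℝ) ^ m) atTop (𝓝 0) := by
    simpa using (tendsto_pow_atTop_nhds_zero_of_lt_one (by norm_num : (0 : ℝ) ≤ 1 / 2)
      (by norm_num)).const_mul b₀
  exact tendsto_nhds_unique (hcont y x hx hball hxball j)
    (squeeze_zero_norm (fun m => (hinv m).2 j) h1)

namespace IsGreenKernel

variable {E : Type*} [NormedAddCommGroup E] [NormedSpace ℝ E] {A : E →L[ℝ] E}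
  {Γ : ℤ → E →L[ℝ] E}

/-- Discrete variation of constants: the right equation makes `Γ (n - m + 1) (w m) - Γ (n - m) (A (w
m))` equal to `w n` for `m = n` and `0` otherwise; sum over `m ≤ N` and shift the index in the first
term. -/
theorem representation (hΓ : IsGreenKernel A Γ) (w : ℕ → E) {n N : ℕ} (hn : n ≤ N) :
    w n = Γ (n + 1) (w 0) + ∑ m ∈ Finset.range N, Γ (n - m) (w (m + 1) - A (w m))
      - Γ (n - N) (A (w N)) := by
  have h1 : ∑ m ∈ Finset.range (N + 1), Γ (n - m + 1) (w m)
      = Γ (n + 1) (w 0) + ∑ m ∈ Finset.range N, Γ (n - m) (w (m + 1)) := by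
    rw [Finset.sum_range_succ', add_comm]
    refine congrArg₂ (· + ·) (by simp) (Finset.sum_congr rfl fun m _ => ?_)
    rw [show (n : ℤ) - (m + 1 : ℕ) + 1 = n - m by push_cast; ring]
  have h2 : ∑ m ∈ Finset.range (N + 1), Γ (n - m) (A (w m))
      = ∑ m ∈ Finset.range N, Γ (n - m) (A (w m)) + Γ (n - N) (A (w N)) :=
    Finset.sum_range_succ _ _
  have h3 : ∀ m : ℕ, Γ (n - m + 1) (w m) - Γ (n - m) (A (w m)) = if n = m then w m else 0 := by
    intro m
    rw [hΓ.right]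
    by_cases h : n = m
    · subst h; simp
    · have h' : (n : ℤ) - m ≠ 0 := by omega
      simp [h, h']
  have h4 : ∑ m ∈ Finset.range (N + 1), (Γ (n - m + 1) (w m) - Γ (n - m) (A (w m))) = w n := by
    simp only [h3]
    rw [Finset.sum_ite_eq]
    simp [Nat.lt_succ_of_le hn]
  rw [Finset.sum_sub_distrib, h1, h2] at h4
  rw [← h4]
  simp only [map_sub, Finset.sum_sub_distrib]
  abel

/-- Take norms in the representation and sum over `n` first: each column contributes at most `∑
‖Γ‖`, independently of `N`. -/
theorem sum_norm_le (hΓ : IsGreenKernel A Γ) (w : ℕ → E) (N : ℕ) :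
    ∑ n ∈ Finset.range (N + 1), ‖w n‖ ≤ (∑' n, ‖Γ n‖) *
      (‖w 0‖ + ∑ m ∈ Finset.range N, ‖w (m + 1) - A (w m)‖ + ‖A (w N)‖) := by
  have hC : ∀ d : ℤ, ∑ n ∈ Finset.range (N + 1), ‖Γ (n + d)‖ ≤ ∑' n, ‖Γ n‖ := by
    intro d
    have hinj : Function.Injective fun n : ℕ => (n : ℤ) + d := fun a b h => by simpa using h
    exact ((hΓ.summable.comp_injective hinj).sum_le_tsum _ fun _ _ => norm_nonneg _).trans
      (tsum_comp_le_tsum_of_inj hΓ.summable (fun _ => norm_nonneg _) hinj)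
  calc ∑ n ∈ Finset.range (N + 1), ‖w n‖
      ≤ ∑ n ∈ Finset.range (N + 1), (‖Γ (n + 1)‖ * ‖w 0‖
        + ∑ m ∈ Finset.range N, ‖Γ (n + (-m))‖ * ‖w (m + 1) - A (w m)‖
        + ‖Γ (n + (-N))‖ * ‖A (w N)‖) := by
        refine Finset.sum_le_sum fun n hn => ?_
        have hn' : n ≤ N := Nat.lt_succ_iff.1 (Finset.mem_range.1 hn)
        conv_lhs => rw [hΓ.representation w hn']
        refine (norm_sub_le _ _).trans (add_le_add ((norm_add_le _ _).trans (add_le_add ?_ ?_)) ?_)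
        · exact (Γ _).le_opNorm _
        · exact (norm_sum_le _ _).trans (Finset.sum_le_sum fun m _ => (Γ _).le_opNorm _)
        · exact (Γ _).le_opNorm _
    _ = (∑ n ∈ Finset.range (N + 1), ‖Γ (n + 1)‖) * ‖w 0‖
        + ∑ m ∈ Finset.range N, (∑ n ∈ Finset.range (N + 1), ‖Γ (n + (-m))‖) * ‖w (m + 1) - A (w m)‖
        + (∑ n ∈ Finset.range (N + 1), ‖Γ (n + (-N))‖) * ‖A (w N)‖ := by
        rw [Finset.sum_add_distrib, Finset.sum_add_distrib, Finset.sum_comm]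
        simp only [Finset.sum_mul]
    _ ≤ (∑' n, ‖Γ n‖) * ‖w 0‖
        + ∑ m ∈ Finset.range N, (∑' n, ‖Γ n‖) * ‖w (m + 1) - A (w m)‖
        + (∑' n, ‖Γ n‖) * ‖A (w N)‖ := by
        gcongr
        · exact hC 1
        · exact hC _
        · exact hC _
    _ = _ := by rw [← Finset.mul_sum]; ring

/-- The `ℓ¹` estimate: an approximate orbit of a hyperbolic linear map has total length bounded by
its two end points. -/
theorem exists_sum_norm_le (hΓ : IsGreenKernel A Γ) : ∃ η > 0, ∃ C, 0 ≤ C ∧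
    ∀ (w : ℕ → E) (N : ℕ), (∀ n < N, ‖w (n + 1) - A (w n)‖ ≤ η * ‖w n‖) →
      ∑ n ∈ Finset.range (N + 1), ‖w n‖ ≤ C * (‖w 0‖ + ‖w N‖) := by
  set c := ∑' n, ‖Γ n‖ with hc
  have hc0 : 0 ≤ c := tsum_nonneg fun _ => norm_nonneg _
  -- With this `η` the defects contribute at most half of the total length, which is absorbed on the
  -- left.
  refine ⟨1 / (2 * (c + 1)), by positivity, 2 * (c + 1) * (1 + ‖A‖), by positivity,
    fun w N hw => ?_⟩
  have h1 := hΓ.sum_norm_le w N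
  set S := ∑ n ∈ Finset.range (N + 1), ‖w n‖
  have hS0 : 0 ≤ S := Finset.sum_nonneg fun _ _ => norm_nonneg _
  have h2 : ∑ m ∈ Finset.range N, ‖w (m + 1) - A (w m)‖ ≤ 1 / (2 * (c + 1)) * S := by
    rw [Finset.mul_sum, Finset.sum_range_succ]
    have : 0 ≤ 1 / (2 * (c + 1)) * ‖w N‖ := by positivity
    have := Finset.sum_le_sum fun m hm => hw m (Finset.mem_range.1 hm)
    linarith
  have h3 : ‖A (w N)‖ ≤ ‖A‖ * ‖w N‖ := A.le_opNorm _
  have h4 : c * (1 / (2 * (c + 1)) * S) ≤ 1 / 2 * S := by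
    have : c * (1 / (2 * (c + 1))) ≤ 1 / 2 := by
      rw [mul_one_div, div_le_div_iff₀ (by positivity) (by norm_num)]; linarith
    nlinarith
  have h5 : S ≤ c * (‖w 0‖ + ‖A‖ * ‖w N‖) + 1 / 2 * S := by
    refine h1.trans ?_
    have : c * (‖w 0‖ + ∑ m ∈ Finset.range N, ‖w (m + 1) - A (w m)‖ + ‖A (w N)‖)
        ≤ c * (‖w 0‖ + 1 / (2 * (c + 1)) * S + ‖A‖ * ‖w N‖) := by gcongr
    linarith
  have h6 : c * (‖w 0‖ + ‖A‖ * ‖w N‖) ≤ (c + 1) * ((1 + ‖A‖) * (‖w 0‖ + ‖w N‖)) := by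
    have := norm_nonneg A
    have := norm_nonneg (w 0)
    have := norm_nonneg (w N)
    gcongr
    · linarith
    · nlinarith [mul_nonneg (norm_nonneg A) (norm_nonneg (w 0))]
  linarith

/-- The solution is the convolution of `Γ` with the source. -/
theorem exists_bounded_solution [CompleteSpace E] (hΓ : IsGreenKernel A Γ) {f : ℤ → E} {b : ℝ}
    (hf : ∀ n, ‖f n‖ ≤ b) :
    ∃ w : ℤ → E, (∀ n, ‖w n‖ ≤ (∑' n, ‖Γ n‖) * b) ∧ ∀ n, w (n + 1) = A (w n) + f n := by
  have hb : ∀ n m : ℤ, ‖Γ m (f (n - m))‖ ≤ ‖Γ m‖ * b := fun n m =>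
    ((Γ m).le_opNorm _).trans (mul_le_mul_of_nonneg_left (hf _) (norm_nonneg _))
  have hs : ∀ n, Summable fun m => Γ m (f (n - m)) := fun n =>
    Summable.of_norm_bounded (hΓ.summable.mul_right b) (hb n)
  refine ⟨fun n => ∑' m, Γ m (f (n - m)), fun n => ?_, fun n => ?_⟩
  · exact (tsum_of_norm_bounded (hΓ.summable.mul_right b).hasSum (hb n)).trans
      (le_of_eq tsum_mul_right)
  · beta_reduce
    rw [← (Equiv.addRight (1 : ℤ)).tsum_eq, ContinuousLinearMap.map_tsum _ (hs n)]
    have h1 : ∀ m : ℤ, Γ (Equiv.addRight 1 m) (f (n + 1 - Equiv.addRight 1 m))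
        = A (Γ m (f (n - m))) + if m = 0 then f n else 0 := by
      intro m
      rw [Equiv.coe_addRight, hΓ.left, show n + 1 - (m + 1) = n - m by ring]
      by_cases h : m = 0
      · subst h; simp
      · simp [h]
    simp only [h1]
    have h2 : HasSum (fun m : ℤ => if m = 0 then f n else 0) (f n) := hasSum_ite_eq 0 (f n)
    rw [((hs n).mapL A).tsum_add h2.summable, h2.tsum_eq]

/-- Bounded inhomogeneous terms have bounded solutions, also for nearby non-autonomous systems. -/
theorem exists_bounded_solution_perturbed [CompleteSpace E] (hΓ : IsGreenKernel A Γ) :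
    ∃ η > 0, ∃ K, 0 ≤ K ∧ ∀ B : ℤ → E →L[ℝ] E, (∀ n, ‖B n - A‖ ≤ η) →
      ∀ (f : ℤ → E) (b : ℝ), (∀ n, ‖f n‖ ≤ b) →
      ∃ w : ℤ → E, (∀ n, ‖w n‖ ≤ K * b) ∧ ∀ n, w (n + 1) = B n (w n) + f n := by
  set c := ∑' n, ‖Γ n‖ with hc
  have hc0 : 0 ≤ c := tsum_nonneg fun _ => norm_nonneg _
  refine ⟨1 / (2 * (c + 1)), by positivity, 2 * c, by positivity, fun B hB f b hf => ?_⟩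
  have hb : 0 ≤ b := (norm_nonneg _).trans (hf 0)
  -- Correct by a solution for the constant map `A`; the new residual `-(B n - A) (ξ n)` is at most
  -- half of the old bound.
  obtain ⟨w, h1, h2⟩ := exists_zero_of_newton_step
    (fun (w : ℤ → E) n => w (n + 1) - B n (w n) - f n) (fun _ => 0) hc0 hb
    (fun n => by simpa using hf n) (fun x d hd _ hx => by
      obtain ⟨ξ, h1, h2⟩ := hΓ.exists_bounded_solution
        (f := fun n => -(x (n + 1) - B n (x n) - f n)) (b := d) (fun n => by rw [norm_neg]; exact hx n)
      refine ⟨fun n => x n + ξ n, fun n => by simpa using h1 n, fun n => ?_⟩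
      have h3 : x (n + 1) + ξ (n + 1) - B n (x n + ξ n) - f n = -((B n - A) (ξ n)) := by
        rw [h2, map_add, sub_apply]; abel
      rw [h3, norm_neg]
      calc ‖(B n - A) (ξ n)‖ ≤ 1 / (2 * (c + 1)) * (c * d) :=
            ((B n - A).le_opNorm _).trans (mul_le_mul (hB n) (h1 n) (norm_nonneg _) (by positivity))
        _ ≤ d / 2 := by
          rw [one_div_mul_eq_div, div_le_div_iff₀ (by positivity) (by norm_num)]
          nlinarith)
    (fun y x hyx _ _ n => by
      exact ((hyx (n + 1)).sub (((B n).continuous.tendsto _).comp (hyx n))).sub_const _)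
  refine ⟨w, fun n => by simpa [mul_assoc] using h1 n, fun n => ?_⟩
  have := h2 n
  rw [sub_sub, sub_eq_zero] at this
  exact this

end IsGreenKernel

end GreenKernels

/-! ### Shadowing of chains of transitions. -/

section ChainShadowing

theorem eventually_all_int {R : ℝ → ℤ → Prop} {l : Filter ℝ} (h : ∀ n, ∀ᶠ r in l, R r n)
    (htop : ∃ n₀, ∀ᶠ r in l, ∀ n ≥ n₀, R r n) (hbot : ∃ n₀, ∀ᶠ r in l, ∀ n ≤ n₀, R r n) :
    ∀ᶠ r in l, ∀ n, R r n := by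
  obtain ⟨a, ha⟩ := htop
  obtain ⟨b, hb⟩ := hbot
  filter_upwards [ha, hb, (eventually_all_finite (Set.finite_Icc b a)).2 fun n _ => h n]
    with r h1 h2 h3 n
  rcases le_total a n with h4 | h4
  · exact h1 n h4
  rcases le_total n b with h5 | h5
  · exact h2 n h5
  exact h3 n ⟨h5, h4⟩

variable {E : Type*} [NormedAddCommGroup E] [NormedSpace ℝ E]

/-- `p` is an orbit of the sequence of maps `G`, asymptotic to the fixed point `0` of `P` in the
past and of `P'` in the future, and transverse: the linearization `D` along `p` is onto for bounded
sequences. -/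
structure IsTransition (P : E → E) (A : E →L[ℝ] E) (P' : E → E) (A' : E →L[ℝ] E)
    (p : ℤ → E) (G : ℤ → E → E) (D : ℤ → E →L[ℝ] E) : Prop where
  left : ∀ n < 0, G n = P
  right : ∀ n > 0, G n = P'
  step : ∀ n, p (n + 1) = G n (p n)
  deriv : ∀ n, HasStrictFDerivAt (G n) (D n) (p n)
  tendsto_bot : Tendsto p atBot (𝓝 0)
  tendsto_top : Tendsto p atTop (𝓝 0)
  deriv_bot : Tendsto D atBot (𝓝 A)
  deriv_top : Tendsto D atTop (𝓝 A')
  onto : ∀ (f : ℤ → E) (b : ℝ), (∀ n, ‖f n‖ ≤ b) →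
    ∃ (w : ℤ → E) (c : ℝ), (∀ n, ‖w n‖ ≤ c) ∧ ∀ n, w (n + 1) = D n (w n) + f n

theorem eventually_linear_approx {G : E → E} {D : E →L[ℝ] E} {p : E}
    (h : HasStrictFDerivAt G D p) {c : ℝ} (hc : 0 < c) :
    ∀ᶠ r in 𝓝[>] (0 : ℝ), ∀ x y, ‖x - p‖ ≤ r → ‖y - p‖ ≤ r →
      ‖G x - G y - D (x - y)‖ ≤ c * ‖x - y‖ := by
  have h1 := h.isLittleO.def hc
  rw [Metric.eventually_nhds_iff] at h1
  obtain ⟨ε, hε, h1⟩ := h1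
  filter_upwards [Ioo_mem_nhdsGT hε] with r hr x y hx hy
  refine h1 (y := (x, y)) ?_
  rw [Prod.dist_eq, max_lt_iff, dist_eq_norm, dist_eq_norm]
  exact ⟨hx.trans_lt hr.2, hy.trans_lt hr.2⟩

namespace IsTransition

variable {P P' : E → E} {A A' : E →L[ℝ] E} {p : ℤ → E} {G : ℤ → E → E} {D : ℤ → E →L[ℝ] E}

theorem eventually_norm_deriv_le (h : IsTransition P A P' A' p G D) :
    ∀ᶠ B in atTop, ∀ n, ‖D n‖ ≤ B := by
  refine eventually_all_int (fun n => eventually_ge_atTop _) ?_ ?_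
  · obtain ⟨n, hn⟩ := eventually_atTop.1
      (h.deriv_top.norm.eventually (gt_mem_nhds (lt_add_one ‖A'‖)))
    exact ⟨n, (eventually_ge_atTop _).mono fun r hr m hm => (hn m hm).le.trans hr⟩
  · obtain ⟨n, hn⟩ := eventually_atBot.1
      (h.deriv_bot.norm.eventually (gt_mem_nhds (lt_add_one ‖A‖)))
    exact ⟨n, (eventually_ge_atTop _).mono fun r hr m hm => (hn m hm).le.trans hr⟩

/-- Surjectivity on the Banach space of bounded sequences gives a bounded choice of preimages, by
the open mapping theorem. -/
theorem eventually_onto [CompleteSpace E] (h : IsTransition P A P' A' p G D) :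
    ∀ᶠ K in atTop, ∀ (f : ℤ → E) (b : ℝ), (∀ n, ‖f n‖ ≤ b) →
      ∃ w : ℤ → E, (∀ n, ‖w n‖ ≤ K * b) ∧ ∀ n, w (n + 1) = D n (w n) + f n := by
  obtain ⟨B, hB, hB0⟩ := (h.eventually_norm_deriv_le.and (eventually_ge_atTop 0)).exists
  let L₀ : BoundedContinuousFunction ℤ E →ₗ[ℝ] BoundedContinuousFunction ℤ E :=
    { toFun := fun w => BoundedContinuousFunction.ofNormedAddCommGroupDiscrete
        (fun n => w (n + 1) - D n (w n)) ((1 + B) * ‖w‖) (fun n => by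
          calc ‖w (n + 1) - D n (w n)‖ ≤ ‖w (n + 1)‖ + ‖D n (w n)‖ := norm_sub_le _ _
            _ ≤ ‖w‖ + B * ‖w‖ := add_le_add (w.norm_coe_le_norm _)
              (((D n).le_opNorm _).trans (mul_le_mul (hB n) (w.norm_coe_le_norm _)
                (norm_nonneg _) hB0))
            _ = (1 + B) * ‖w‖ := by ring)
      map_add' := fun v w => by ext n; simp; abel
      map_smul' := fun c w => by ext n; simp [smul_sub] }
  have hL₀ : ∀ w n, L₀ w n = w (n + 1) - D n (w n) := fun _ _ => rfl
  let L := L₀.mkContinuous (1 + B) (fun w => by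
    rw [BoundedContinuousFunction.norm_le (by positivity)]
    intro n
    rw [hL₀]
    calc ‖w (n + 1) - D n (w n)‖ ≤ ‖w (n + 1)‖ + ‖D n (w n)‖ := norm_sub_le _ _
      _ ≤ ‖w‖ + B * ‖w‖ := add_le_add (w.norm_coe_le_norm _)
        (((D n).le_opNorm _).trans (mul_le_mul (hB n) (w.norm_coe_le_norm _)
          (norm_nonneg _) hB0))
      _ = (1 + B) * ‖w‖ := by ring)
  have hL : ∀ w n, L w n = w (n + 1) - D n (w n) := fun _ _ => rfl
  have hsurj : Function.Surjective L := by
    intro f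
    obtain ⟨w, c, hw, hwf⟩ := h.onto f ‖f‖ (fun n => f.norm_coe_le_norm n)
    refine ⟨BoundedContinuousFunction.ofNormedAddCommGroupDiscrete w c hw, ?_⟩
    ext n
    rw [hL]
    simp [hwf]
  obtain ⟨K, hK0, hK⟩ := L.exists_preimage_norm_le hsurj
  filter_upwards [eventually_ge_atTop K] with K' hK' f b hf
  have hb : 0 ≤ b := (norm_nonneg _).trans (hf 0)
  obtain ⟨w, hw, hwn⟩ := hK (BoundedContinuousFunction.ofNormedAddCommGroupDiscrete f b hf)
  refine ⟨w, fun n => (w.norm_coe_le_norm n).trans (hwn.trans ?_), fun n => ?_⟩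
  · exact mul_le_mul hK' ((BoundedContinuousFunction.norm_le hb).2 hf) (norm_nonneg _)
      (hK0.le.trans hK')
  · have := DFunLike.congr_fun hw n
    rw [hL, sub_eq_iff_eq_add] at this
    rw [this, add_comm]; rfl

/-- One radius serves all `n`: on the tails `G n` is a fixed map, strictly differentiable at `0`,
with `p n` near `0` and `D n` near its derivative; only finitely many `n` remain. -/
theorem eventually_uniform_approx (h : IsTransition P A P' A' p G D)
    (hP : HasStrictFDerivAt P A 0) (hP' : HasStrictFDerivAt P' A' 0) {c : ℝ} (hc : 0 < c) :
    ∀ᶠ r in 𝓝[>] (0 : ℝ), ∀ n, ∀ x y, ‖x - p n‖ ≤ r → ‖y - p n‖ ≤ r →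
      ‖G n x - G n y - D n (x - y)‖ ≤ c * ‖x - y‖ := by
  have tail : ∀ {Q : E → E} {C : E →L[ℝ] E}, HasStrictFDerivAt Q C 0 →
      ∀ {l : Filter ℤ}, Tendsto p l (𝓝 0) → Tendsto D l (𝓝 C) → (∀ᶠ n in l, G n = Q) →
      ∃ ε > 0, ∀ᶠ n in l, ∀ x y, ‖x - p n‖ ≤ ε → ‖y - p n‖ ≤ ε →
        ‖G n x - G n y - D n (x - y)‖ ≤ c * ‖x - y‖ := by
    intro Q C hQ l hp hD hG
    obtain ⟨ε, hε, hε0⟩ := ((eventually_linear_approx hQ (half_pos hc)).and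
      self_mem_nhdsWithin).exists
    refine ⟨ε / 2, half_pos hε0, ?_⟩
    filter_upwards [hG, hp.norm.eventually (gt_mem_nhds (show ‖(0 : E)‖ < ε / 2 by simpa using half_pos hε0)),
      (tendsto_iff_norm_sub_tendsto_zero.1 hD).eventually (gt_mem_nhds (half_pos hc))]
      with n h1 h2 h3 x y hx hy
    have hx' : ‖x - 0‖ ≤ ε := by
      rw [sub_zero]
      have := norm_add_le (x - p n) (p n)
      rw [sub_add_cancel] at this
      linarith
    have hy' : ‖y - 0‖ ≤ ε := by
      rw [sub_zero]
      have := norm_add_le (y - p n) (p n)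
      rw [sub_add_cancel] at this
      linarith
    have h4 := hε x y hx' hy'
    have h5 : G n x - G n y - D n (x - y) = (Q x - Q y - C (x - y)) - (D n - C) (x - y) := by
      rw [h1, sub_apply]; abel
    rw [h5]
    refine (norm_sub_le _ _).trans ?_
    have h6 : ‖(D n - C) (x - y)‖ ≤ c / 2 * ‖x - y‖ :=
      ((D n - C).le_opNorm _).trans (mul_le_mul_of_nonneg_right h3.le (norm_nonneg _))
    linarith
  refine eventually_all_int (fun n => eventually_linear_approx (h.deriv n) hc) ?_ ?_
  · obtain ⟨ε, hε, hn⟩ := tail hP' h.tendsto_top h.deriv_top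
      ((eventually_gt_atTop 0).mono fun n hn => h.right n hn)
    obtain ⟨n₀, hn⟩ := eventually_atTop.1 hn
    refine ⟨n₀, ?_⟩
    filter_upwards [Ioo_mem_nhdsGT hε] with r hr n hn' x y hx hy
    exact hn n hn' x y (hx.trans hr.2.le) (hy.trans hr.2.le)
  · obtain ⟨ε, hε, hn⟩ := tail hP h.tendsto_bot h.deriv_bot
      ((eventually_lt_atBot 0).mono fun n hn => h.left n hn)
    obtain ⟨n₀, hn⟩ := eventually_atBot.1 hn
    refine ⟨n₀, ?_⟩
    filter_upwards [Ioo_mem_nhdsGT hε] with r hr n hn' x y hx hy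
    exact hn n hn' x y (hx.trans hr.2.le) (hy.trans hr.2.le)

theorem eventually_near (h : IsTransition P A P' A' p G D) {η : ℝ} (hη : 0 < η) :
    ∀ᶠ m : ℕ in atTop, ∀ n : ℤ, (m ≤ n → ‖p n‖ ≤ η ∧ ‖D n - A'‖ ≤ η) ∧
      (n ≤ -m → ‖p n‖ ≤ η ∧ ‖D n - A‖ ≤ η) := by
  obtain ⟨a, ha⟩ := eventually_atTop.1 ((h.tendsto_top.norm.eventually
    (gt_mem_nhds (by simpa using hη))).and
    ((tendsto_iff_norm_sub_tendsto_zero.1 h.deriv_top).eventually (gt_mem_nhds hη)))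
  obtain ⟨b, hb⟩ := eventually_atBot.1 ((h.tendsto_bot.norm.eventually
    (gt_mem_nhds (by simpa using hη))).and
    ((tendsto_iff_norm_sub_tendsto_zero.1 h.deriv_bot).eventually (gt_mem_nhds hη)))
  filter_upwards [eventually_ge_atTop (a.natAbs + b.natAbs)] with m hm n
  exact ⟨fun hn => ⟨(ha n (by omega)).1.le, (ha n (by omega)).2.le⟩,
    fun hn => ⟨(hb n (by omega)).1.le, (hb n (by omega)).2.le⟩⟩

end IsTransition


/-- Both corrections `a` and `b` carry the same source `-y`, so any convex combination cancels `y`.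
What is left is the mismatch of each linearization, weighted by the ramp, and the slope of the ramp
times `b' - a'`. -/
theorem norm_ramp_step_le {D₁ D₂ Ds : E →L[ℝ] E} {a b a' b' y : E} {t t' η B : ℝ}
    (ht0 : 0 ≤ t) (ht1 : t ≤ 1) (hB : 0 ≤ B) (hη : 0 ≤ η)
    (ha' : a' = D₁ a + -y) (hb' : b' = D₂ b + -y)
    (ha : ‖a‖ ≤ B) (hb : ‖b‖ ≤ B) (ha'B : ‖a'‖ ≤ B) (hb'B : ‖b'‖ ≤ B)
    (h1 : (1 - t) * ‖D₁ - Ds‖ ≤ η) (h2 : t * ‖D₂ - Ds‖ ≤ η) (h3 : |t' - t| ≤ η) :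
    ‖y + ((1 - t') • a' + t' • b') - Ds ((1 - t) • a + t • b)‖ ≤ 4 * (η * B) := by
  have key : y + ((1 - t') • a' + t' • b') - Ds ((1 - t) • a + t • b)
      = (1 - t) • (D₁ - Ds) a + t • (D₂ - Ds) b + (t' - t) • (b' - a') := by
    have e1 : (t' - t) • (b' - a') = (1 - t') • a' + t' • b' - ((1 - t) • a' + t • b') := by
      module
    rw [e1]
    nth_rewrite 3 [ha']
    nth_rewrite 3 [hb']
    simp only [sub_apply, map_add, map_smul]
    module
  rw [key]
  have e1 : ‖(1 - t) • (D₁ - Ds) a‖ ≤ η * B := by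
    rw [norm_smul, Real.norm_of_nonneg (by linarith)]
    calc (1 - t) * ‖(D₁ - Ds) a‖ ≤ (1 - t) * (‖D₁ - Ds‖ * B) := by
          have := ((D₁ - Ds).le_opNorm a).trans (mul_le_mul_of_nonneg_left ha (norm_nonneg _))
          have : 0 ≤ 1 - t := by linarith
          gcongr
      _ = ((1 - t) * ‖D₁ - Ds‖) * B := by ring
      _ ≤ η * B := by gcongr
  have e2 : ‖t • (D₂ - Ds) b‖ ≤ η * B := by
    rw [norm_smul, Real.norm_of_nonneg ht0]
    calc t * ‖(D₂ - Ds) b‖ ≤ t * (‖D₂ - Ds‖ * B) := by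
          have := ((D₂ - Ds).le_opNorm b).trans (mul_le_mul_of_nonneg_left hb (norm_nonneg _))
          gcongr
      _ = (t * ‖D₂ - Ds‖) * B := by ring
      _ ≤ η * B := by gcongr
  have e3 : ‖(t' - t) • (b' - a')‖ ≤ η * (2 * B) := by
    rw [norm_smul, Real.norm_eq_abs]
    have := norm_sub_le b' a'
    gcongr
    linarith
  have := norm_add₃_le (a := (1 - t) • (D₁ - Ds) a) (b := t • (D₂ - Ds) b)
    (c := (t' - t) • (b' - a'))
  linarith

/-- Where the ramp puts weight on the wrong linearization, the weight is small or the two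
linearizations are close. -/
theorem eventually_ramp_le {P P' P'' : E → E} {A A' A'' : E →L[ℝ] E} {p p' : ℤ → E}
    {G G' : ℤ → E → E} {D D' : ℤ → E →L[ℝ] E}
    (h : IsTransition P A P' A' p G D) (h' : IsTransition P' A' P'' A'' p' G' D')
    {η : ℝ} (hη : 0 < η) :
    ∀ᶠ N : ℕ in atTop, ∀ m : ℕ, m ≤ N →
      (2 * m ≤ N → (m / N : ℝ) * ‖D' (m - N) - D m‖ ≤ η) ∧
      (N < 2 * m → (1 - m / N : ℝ) * ‖D m - D' (m - N)‖ ≤ η) := by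
  obtain ⟨B, hB, hB', hB0⟩ := (h.eventually_norm_deriv_le.and
    (h'.eventually_norm_deriv_le.and (eventually_gt_atTop 0))).exists
  obtain ⟨m₀, h1, h2⟩ := ((h.eventually_near (half_pos hη)).and
    (h'.eventually_near (half_pos hη))).exists
  obtain ⟨M, hM⟩ := exists_nat_ge (2 * B * m₀ / η)
  filter_upwards [eventually_ge_atTop (2 * m₀ + M + 1)] with N hN m hm
  have hN0 : (0 : ℝ) < N := by exact_mod_cast (by omega : 0 < N)
  have hsmall : 2 * B * m₀ ≤ η * N := by
    rw [div_le_iff₀ hη] at hM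
    have : (M : ℝ) ≤ N := by exact_mod_cast (by omega : M ≤ N)
    nlinarith
  have hmN : (m / N : ℝ) ≤ 1 := by
    rw [div_le_one hN0]; exact_mod_cast hm
  have hD : ‖D' (m - N) - D m‖ ≤ 2 * B := by
    have := norm_sub_le (D' (m - N)) (D m)
    linarith [hB m, hB' (m - N)]
  -- Far from both ends of the segment the two linearizations are close to `A'`. Near an end the
  -- weight of the wrong one is at most `m₀ / N`, and the crude bound `2B` suffices.
  have hclose : m₀ ≤ m → m₀ ≤ N - m → ‖D' (m - N) - D m‖ ≤ η := by
    intro ha hb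
    have e1 := ((h1 m).1 (by exact_mod_cast ha)).2
    have e2 := ((h2 (m - N)).2 (by omega)).2
    have := norm_sub_le (D' (m - N) - A') (D m - A')
    rw [sub_sub_sub_cancel_right] at this
    linarith
  refine ⟨fun hmN2 => ?_, fun hmN2 => ?_⟩
  · rcases le_total m₀ m with hm0 | hm0
    · calc (m / N : ℝ) * ‖D' (m - N) - D m‖ ≤ 1 * η := by
            have := hclose hm0 (by omega)
            gcongr
        _ = η := one_mul η
    · calc (m / N : ℝ) * ‖D' (m - N) - D m‖ ≤ (m₀ / N) * (2 * B) := by gcongr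
        _ = 2 * B * m₀ / N := by ring
        _ ≤ η := by rw [div_le_iff₀ hN0]; exact hsmall
  · rw [norm_sub_rev]
    have h0 : (0 : ℝ) ≤ 1 - m / N := by linarith
    rcases le_total m₀ (N - m) with hm0 | hm0
    · calc (1 - m / N : ℝ) * ‖D' (m - N) - D m‖ ≤ 1 * η := by
            have := hclose (by omega) hm0
            have : (0 : ℝ) ≤ m / N := by positivity
            gcongr
            linarith
        _ = η := one_mul η
    · have e1 : (1 - m / N : ℝ) ≤ m₀ / N := by
        rw [one_sub_div hN0.ne']
        gcongr
        have : (N : ℝ) ≤ m₀ + m := by exact_mod_cast (by omega : N ≤ m₀ + m)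
        linarith
      calc (1 - m / N : ℝ) * ‖D' (m - N) - D m‖ ≤ (m₀ / N) * (2 * B) := by gcongr
        _ = 2 * B * m₀ / N := by ring
        _ ≤ η := by rw [div_le_iff₀ hN0]; exact hsmall

/-- Shadowing of chains of transitions: consecutive transitions are joined by orbit segments of
prescribed, sufficiently large lengths. -/
theorem exists_chain_shadow [CompleteSpace E] {V T : Type*} [Finite T] {P : V → E → E}
    {A : V → E →L[ℝ] E} {src tgt : T → V} {p : T → ℤ → E} {G : T → ℤ → E → E}
    {D : T → ℤ → E →L[ℝ] E} (hP : ∀ v, HasStrictFDerivAt (P v) (A v) 0)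
    (hT : ∀ e, IsTransition (P (src e)) (A (src e)) (P (tgt e)) (A (tgt e)) (p e) (G e) (D e))
    {ρ : ℝ} (hρ : 0 < ρ) :
    ∃ M : ℕ, ∀ {J : Type} (next : J ≃ J) (e : J → T) (len : J → ℕ),
      (∀ j, tgt (e j) = src (e (next j))) → (∀ j, M ≤ len j) →
      ∃ x : J → ℕ → E, (∀ j, ∀ m < len j, x j (m + 1) = G (e j) m (x j m)) ∧
        (∀ j, x j (len j) = x (next j) 0) ∧
        (∀ j m, 2 * m ≤ len j → ‖x j m - p (e j) m‖ ≤ ρ) ∧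
        (∀ j, ∀ m ≤ len j, len j < 2 * m → ‖x j m - p (e (next j)) (m - len j)‖ ≤ ρ) := by
  obtain ⟨K, hK, hK0⟩ := ((eventually_all.2 fun e => (hT e).eventually_onto).and
    (eventually_gt_atTop 0)).exists
  -- A Newton step leaves `4cKb` from the blending and `cKb` from the nonlinearity, together `b /
  -- 4`.
  set c : ℝ := 1 / (20 * K) with hcdef
  have hc : 0 < c := by positivity
  have hcK : c * K = 1 / 20 := by rw [hcdef]; field_simp
  obtain ⟨r, ⟨hr, hr0⟩, hrρ⟩ := (((eventually_all.2 fun e =>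
    (hT e).eventually_uniform_approx (hP _) (hP _) hc).and self_mem_nhdsWithin).and
    (Ioo_mem_nhdsGT hρ)).exists
  have hr0 : 0 < r := hr0
  -- The pseudo-orbit has residual at most `2θ`, so the iteration stays within `2K · 2θ = r`, where
  -- the linear approximation is valid.
  set θ : ℝ := r / (4 * K) with hθdef
  have hθ : 0 < θ := by positivity
  obtain ⟨m₀, hm₀⟩ := (eventually_all.2 fun e => (hT e).eventually_near hθ).exists
  have hramp : ∀ᶠ N : ℕ in atTop, ∀ q : T × T, tgt q.1 = src q.2 → ∀ m : ℕ, m ≤ N →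
      (2 * m ≤ N → (m / N : ℝ) * ‖D q.2 (m - N) - D q.1 m‖ ≤ c) ∧
      (N < 2 * m → (1 - m / N : ℝ) * ‖D q.1 m - D q.2 (m - N)‖ ≤ c) := by
    refine eventually_all.2 fun q => ?_
    by_cases hq : tgt q.1 = src q.2
    · have h2 := hT q.2
      rw [← hq] at h2
      filter_upwards [eventually_ramp_le (hT q.1) h2 hc] with N hN _ using hN
    · exact Eventually.of_forall fun N h => absurd h hq
  obtain ⟨M₁, hM₁⟩ := eventually_atTop.1 hramp
  obtain ⟨M₂, hM₂⟩ := exists_nat_ge (1 / c)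
  refine ⟨M₁ + M₂ + 2 * m₀ + 2, fun {J} next e len hcomp hlen => ?_⟩
  have hlen0 : ∀ j, 0 < len j := fun j => by have := hlen j; omega
  have hlenR : ∀ j, (0 : ℝ) < len j := fun j => by exact_mod_cast hlen0 j
  have hinv : ∀ j, 1 / (len j : ℝ) ≤ c := fun j => by
    have h1 : (M₂ : ℝ) ≤ len j := by exact_mod_cast (by have := hlen j; omega : M₂ ≤ len j)
    rw [div_le_iff₀ (hlenR j)]
    rw [div_le_iff₀ hc] at hM₂
    nlinarith
  -- positions, and the pseudo-orbit
  let succ : J × ℕ → J × ℕ := fun i => if i.2 + 1 < len i.1 then (i.1, i.2 + 1) else (next i.1, 0)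
  -- The first half of a segment follows its own transition, the second half the past of the next
  -- one. The only jump is in the middle, where both are close to `0`.
  let ps : J → ℕ → E := fun j m =>
    if 2 * m ≤ len j then p (e j) m else p (e (next j)) (m - len j)
  have hps : ∀ j m, m < len j → ps (succ (j, m)).1 (succ (j, m)).2 = ps j (m + 1) := by
    intro j m hm
    by_cases h : m + 1 < len j
    · simp [succ, h]
    · have h' : m + 1 = len j := by omega
      have h1 := hlen0 j
      have hs : succ (j, m) = (next j, 0) := by simp [succ, h]
      rw [hs]
      simp only [ps]
      rw [if_pos (by simp), h', if_neg (by omega)]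
      simp
  let Ds : J × ℕ → E →L[ℝ] E := fun i =>
    if 2 * i.2 ≤ len i.1 then D (e i.1) i.2 else D (e (next i.1)) (i.2 - len i.1)
  -- In the second half both index ranges are those where the maps equal the return map of the
  -- common cycle.
  have hGnext : ∀ j m, len j < 2 * m → m < len j →
      G (e j) m = G (e (next j)) (m - len j) := by
    intro j m h1 h2
    rw [(hT (e j)).right m (by omega), (hT (e (next j))).left _ (by omega), hcomp]
  have happrox : ∀ j m, m < len j → ∀ x y, ‖x - ps j m‖ ≤ r → ‖y - ps j m‖ ≤ r →
      ‖G (e j) m x - G (e j) m y - Ds (j, m) (x - y)‖ ≤ c * ‖x - y‖ := by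
    intro j m hm x y hx hy
    by_cases h : 2 * m ≤ len j
    · simp only [ps, h, if_true, Ds] at hx hy ⊢
      exact hr _ _ x y hx hy
    · simp only [ps, h, if_false, Ds] at hx hy ⊢
      rw [hGnext j m (by omega) hm]
      exact hr _ _ x y hx hy
  -- Pairs with `m ≥ len j` are not positions of the chain; the residual is `0` there by definition.
  obtain ⟨R, hR, hR0⟩ : ∃ R : (J × ℕ → E) → J × ℕ → E,
      (∀ x j m, m < len j → R x (j, m) = x (succ (j, m)) - G (e j) m (x (j, m))) ∧
      ∀ x j m, ¬ m < len j → R x (j, m) = 0 :=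
    ⟨fun x i => if i.2 < len i.1 then x (succ i) - G (e i.1) i.2 (x i) else 0,
      fun x j m hm => by simp [hm], fun x j m hm => by simp [hm]⟩
  have hres : ∀ i, ‖R (fun i => ps i.1 i.2) i‖ ≤ 2 * θ := by
    rintro ⟨j, m⟩
    by_cases hm : m < len j
    swap
    · rw [hR0 _ _ _ hm, norm_zero]; positivity
    rw [hR _ _ _ hm, hps _ _ hm]
    by_cases h1 : 2 * (m + 1) ≤ len j
    · have h2 : 2 * m ≤ len j := by omega
      simp only [ps, h1, h2, if_true]
      rw [← (hT (e j)).step m]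
      push_cast
      simp only [sub_self, norm_zero]
      positivity
    · by_cases h2 : 2 * m ≤ len j
      · simp only [ps, h1, h2, if_true, if_false]
        rw [← (hT (e j)).step m]
        have := hlen j
        have e1 := ((hm₀ (e j) (m + 1)).1 (by omega)).1
        have e2 := ((hm₀ (e (next j)) ((m + 1 : ℕ) - len j)).2 (by push_cast; omega)).1
        refine (norm_sub_le _ _).trans ?_
        linarith
      · simp only [ps, h1, h2, if_false]
        rw [hGnext j m (by omega) hm, ← (hT (e (next j))).step]
        rw [show ((m + 1 : ℕ) : ℤ) - len j = m - len j + 1 by push_cast; ring]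
        simp only [sub_self, norm_zero]
        positivity
  have hrθ : 2 * K * (2 * θ) = r := by rw [hθdef]; field_simp; ring
  obtain ⟨x, hx, hRx⟩ := exists_zero_of_newton_step R (fun i => ps i.1 i.2) hK0.le
    (by positivity : (0 : ℝ) ≤ 2 * θ) hres (fun x b hb hxb hRb => by
      -- Transition `j` sees the residuals of its own segment for `n ≥ 0` and those of the preceding
      -- segment for `n < 0`. Hence on segment `j` the corrections of `j` and of `next j` are driven
      -- by the same source and can be blended.
      let src' : J → ℤ → E := fun j n =>
        if 0 ≤ n then R x (j, n.toNat) else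
          if 0 ≤ len (next.symm j) + n then R x (next.symm j, (len (next.symm j) + n).toNat) else 0
      have hsrc : ∀ j n, ‖-src' j n‖ ≤ b := by
        intro j n
        rw [norm_neg]
        simp only [src']
        split_ifs
        · exact hRb _
        · exact hRb _
        · simpa using hb
      choose w hw hwe using fun j => hK (e j) (fun n => -src' j n) b (hsrc j)
      -- The ramp runs from `0` to `1` along the segment, so blends on adjacent segments agree at
      -- the common point.
      let ξ : J → ℕ → E := fun j m =>
        (1 - (m / len j : ℝ)) • w j m + (m / len j : ℝ) • w (next j) (m - len j)
      have hξs : ∀ j m, m < len j → ξ (succ (j, m)).1 (succ (j, m)).2 = ξ j (m + 1) := by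
        intro j m hm
        by_cases h : m + 1 < len j
        · simp [succ, h]
        · have h' : m + 1 = len j := by omega
          have h1 := (hlenR j).ne'
          have hs : succ (j, m) = (next j, 0) := by simp [succ, h]
          rw [hs]
          simp only [ξ, h']
          simp [h1]
      have hξb : ∀ j m, m ≤ len j → ‖ξ j m‖ ≤ K * b := by
        intro j m hm
        have h1 : (m / len j : ℝ) ≤ 1 := by
          rw [div_le_one (hlenR j)]; exact_mod_cast hm
        have h2 : (0 : ℝ) ≤ m / len j := by positivity
        refine (norm_add_le _ _).trans ?_
        rw [norm_smul, norm_smul, Real.norm_of_nonneg h2, Real.norm_of_nonneg (by linarith)]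
        have e1 := hw j m
        have e2 := hw (next j) (m - len j)
        nlinarith
      refine ⟨fun i => if i.2 < len i.1 then x i + ξ i.1 i.2 else x i, fun i => ?_, ?_⟩
      · by_cases h : i.2 < len i.1
        · simpa [h] using hξb i.1 i.2 h.le
        · simp only [h, if_false, sub_self, norm_zero]; positivity
      · rintro ⟨j, m⟩
        by_cases hm : m < len j
        swap
        · rw [hR0 _ _ _ hm, norm_zero]; positivity
        have hsm : (succ (j, m)).2 < len (succ (j, m)).1 := by
          by_cases h : m + 1 < len j
          · simp [succ, h]
          · simp [succ, h, hlen0]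
        rw [hR _ _ _ hm]
        simp only [hm, hsm, if_true]
        rw [hξs j m hm]
        have hxr : ‖x (j, m) - ps j m‖ ≤ r := by
          have := hxb (j, m)
          rw [hrθ] at this
          have : 0 ≤ K * b := by positivity
          linarith
        have hxξ : ‖x (j, m) + ξ j m - ps j m‖ ≤ r := by
          have h1 := hxb (j, m)
          rw [hrθ] at h1
          have h2 := norm_add_le (x (j, m) - ps j m) (ξ j m)
          rw [show x (j, m) - ps j m + ξ j m = x (j, m) + ξ j m - ps j m by abel] at h2
          linarith [hξb j m hm.le]
        have h1 := happrox j m hm _ _ hxξ hxr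
        rw [add_sub_cancel_left] at h1
        have ht1 : (m / len j : ℝ) ≤ 1 := by
          rw [div_le_one (hlenR j)]; exact_mod_cast hm.le
        have hy1 : src' j m = R x (j, m) := by simp [src']
        have hy2 : src' (next j) (m - len j) = R x (j, m) := by
          have : ¬ ((len j : ℤ) ≤ m) := by omega
          simp [src', this]
        have hrm := hM₁ (len j) (by have := hlen j; omega) (e j, e (next j)) (hcomp j) m hm.le
        have h2 := norm_ramp_step_le (D₁ := D (e j) m) (D₂ := D (e (next j)) (m - len j))
          (Ds := Ds (j, m)) (a := w j m) (b := w (next j) (m - len j)) (y := R x (j, m))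
          (a' := w j (m + 1)) (b' := w (next j) ((m + 1 : ℕ) - len j))
          (t := m / len j) (t' := (m + 1 : ℕ) / len j) (η := c) (B := K * b) (by positivity) ht1
          (by positivity) hc.le (by rw [hwe, hy1])
          (by rw [show ((m + 1 : ℕ) : ℤ) - len j = m - len j + 1 by push_cast; ring, hwe, hy2])
          (hw _ _) (hw _ _) (hw _ _) (hw _ _)
          (by
            by_cases h : 2 * m ≤ len j
            · simp only [Ds, h, if_true, sub_self, norm_zero, mul_zero]; exact hc.le
            · simp only [Ds, h, if_false]; exact hrm.2 (by omega))
          (by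
            by_cases h : 2 * m ≤ len j
            · simp only [Ds, h, if_true]; exact hrm.1 h
            · simp only [Ds, h, if_false, sub_self, norm_zero, mul_zero]; exact hc.le)
          (by
            rw [← sub_div]; push_cast
            rw [add_sub_cancel_left, abs_of_nonneg (by positivity)]
            exact hinv j)
        have hfin : x (succ (j, m)) + ξ j (m + 1) - G (e j) m (x (j, m) + ξ j m)
            = (R x (j, m) + ((1 - ((m + 1 : ℕ) / len j : ℝ)) • w j (m + 1)
                + ((m + 1 : ℕ) / len j : ℝ) • w (next j) ((m + 1 : ℕ) - len j))
                - Ds (j, m) (ξ j m))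
              - (G (e j) m (x (j, m) + ξ j m) - G (e j) m (x (j, m)) - Ds (j, m) (ξ j m)) := by
          rw [hR _ _ _ hm]
          have : ξ j (m + 1) = (1 - ((m + 1 : ℕ) / len j : ℝ)) • w j (m + 1)
                + ((m + 1 : ℕ) / len j : ℝ) • w (next j) ((m + 1 : ℕ) - len j) := by
            simp only [ξ]; push_cast; rfl
          rw [← this]; abel
        rw [hfin]
        refine (norm_sub_le _ _).trans ?_
        have h3 : c * ‖ξ j m‖ ≤ c * (K * b) := by
          have := hξb j m hm.le
          gcongr
        have h4 : c * (K * b) = b / 20 := by rw [← mul_assoc, hcK]; ring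
        have h2' : _ ≤ 4 * (c * (K * b)) := h2
        linarith)
    (fun y x hyx hyb hxb i => by
      obtain ⟨j, m⟩ := i
      by_cases hm : m < len j
      swap
      · simp only [hR0 _ _ _ hm]; exact tendsto_const_nhds
      simp only [hR _ _ _ hm]
      refine (hyx _).sub ?_
      rw [tendsto_iff_norm_sub_tendsto_zero]
      have h0 := tendsto_iff_norm_sub_tendsto_zero.1 (hyx (j, m))
      refine squeeze_zero (fun _ => norm_nonneg _) (fun k => ?_)
        (by simpa using h0.const_mul (c + ‖Ds (j, m)‖))
      have h1 := happrox j m hm (y k (j, m)) (x (j, m)) ((hyb k _).trans hrθ.le)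
        ((hxb _).trans hrθ.le)
      have h2 := norm_add_le (G (e j) m (y k (j, m)) - G (e j) m (x (j, m))
        - Ds (j, m) (y k (j, m) - x (j, m))) (Ds (j, m) (y k (j, m) - x (j, m)))
      rw [sub_add_cancel] at h2
      have h3 := (Ds (j, m)).le_opNorm (y k (j, m) - x (j, m))
      linarith)
  have hxρ : ∀ i, ‖x i - ps i.1 i.2‖ ≤ ρ := fun i => (hx i).trans (hrθ.le.trans hrρ.2.le)
  refine ⟨fun j m => if m < len j then x (j, m) else x (next j, 0), fun j m hm => ?_, fun j => ?_,
    fun j m hm => ?_, fun j m hm hm2 => ?_⟩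
  · have h1 := hRx (j, m)
    rw [hR _ _ _ hm, sub_eq_zero] at h1
    simp only [hm, if_true]
    rw [← h1]
    by_cases h : m + 1 < len j <;> simp [succ, h]
  · simp [hlen0]
  · have h1 : m < len j := by have := hlen0 j; omega
    simpa [h1, ps, hm] using hxρ (j, m)
  · by_cases h1 : m < len j
    · have h2 : ¬ 2 * m ≤ len j := by omega
      simpa [h1, ps, h2] using hxρ (j, m)
    · have h2 : m = len j := by omega
      subst h2
      simpa [ps] using hxρ (next j, 0)

end ChainShadowing

/-! ### Hyperbolicity of the linearized return map. -/

section ReturnMapSpectrum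

open Polynomial

/-- The factor of the characteristic polynomial that belongs to the nontrivial multipliers. -/
theorem exists_nontrivial_factor {Φ : Phase →L[ℝ] Phase}
    (hcount : open Classical in (complexEigenvalues Φ).count 1 = 2)
    (hcirc : ∀ μ ∈ complexEigenvalues Φ, ‖μ‖ = 1 → μ = 1) :
    ∃ q : ℝ[X], (Φ : Phase →ₗ[ℝ] Phase).charpoly = (X - C 1) ^ 2 * q ∧ q.eval 1 ≠ 0 ∧
      (∀ z : ℂ, aeval z q = 0 → ‖z‖ ≠ 1) ∧
      Module.finrank ℝ (Module.End.maxGenEigenspace (Φ : Phase →ₗ[ℝ] Phase) 1) = 2 := by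
  classical
  set χ := (Φ : Phase →ₗ[ℝ] Phase).charpoly with hχ
  have hχ0 : χ ≠ 0 := (LinearMap.charpoly_monic _).ne_zero
  have hinj : Function.Injective (algebraMap ℝ ℂ) := (algebraMap ℝ ℂ).injective
  have hmult : χ.rootMultiplicity 1 = 2 := by
    rw [eq_rootMultiplicity_map hinj 1, map_one, ← count_roots]
    convert! hcount
  obtain ⟨q, hq, hqd⟩ := exists_eq_pow_rootMultiplicity_mul_and_not_dvd χ hχ0 1
  rw [hmult] at hq
  have hq1 : q.eval 1 ≠ 0 := fun h => hqd (dvd_iff_isRoot.2 h)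
  refine ⟨q, hq, hq1, fun z hz hz1 => ?_, ?_⟩
  · have hz' : z ∈ complexEigenvalues Φ := by
      rw [complexEigenvalues, mem_roots ((Polynomial.map_ne_zero_iff hinj).2 hχ0), IsRoot.def,
        eval_map_algebraMap, hq, map_mul, hz, mul_zero]
    have := hcirc z hz' hz1
    subst this
    apply hq1
    have h2 : ((q.eval 1 : ℝ) : ℂ) = 0 := by
      rw [← hz]
      have := aeval_algebraMap_apply ℂ (1 : ℝ) q
      simpa using this.symm
    exact_mod_cast h2
  · rw [LinearMap.finrank_maxGenEigenspace_eq, hmult]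

/-- On the tangent space of the level set the nontrivial factor maps into the flow direction. -/
theorem aeval_factor_mem_span {Φ : Phase →L[ℝ] Phase} {q : ℝ[X]} {D : Phase →L[ℝ] ℝ} {v₀ : Phase}
    (hq : (Φ : Phase →ₗ[ℝ] Phase).charpoly = (X - C 1) ^ 2 * q) (hq1 : q.eval 1 ≠ 0)
    (hfin : Module.finrank ℝ (Module.End.maxGenEigenspace (Φ : Phase →ₗ[ℝ] Phase) 1) = 2)
    (hD : D ≠ 0) (hDΦ : ∀ v, D (Φ v) = D v) (hv₀ : v₀ ≠ 0) (hΦv₀ : Φ v₀ = v₀) (hDv₀ : D v₀ = 0)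
    {v : Phase} (hv : D v = 0) :
    aeval (Φ : Phase →ₗ[ℝ] Phase) q v ∈ Submodule.span ℝ {v₀} := by
  set L : Phase →ₗ[ℝ] Phase := (Φ : Phase →ₗ[ℝ] Phase) with hL
  have hpow : ∀ (n : ℕ) (u : Phase), D ((L ^ n) u) = D u := by
    intro n
    induction n with
    | zero => simp
    | succ n ih => intro u; rw [pow_succ', Module.End.mul_apply, ← ih u]; exact hDΦ _
  have hDq : ∀ u, D (aeval L q u) = q.eval 1 * D u := by
    intro u
    rw [aeval_eq_sum_range, LinearMap.sum_apply, map_sum, eval_eq_sum_range, Finset.sum_mul]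
    refine Finset.sum_congr rfl fun i _ => ?_
    rw [LinearMap.smul_apply, map_smul, hpow]
    simp
  have hker : ∀ u, aeval L q u ∈ Module.End.maxGenEigenspace L 1 := by
    intro u
    rw [Module.End.mem_maxGenEigenspace]
    refine ⟨2, ?_⟩
    have h := LinearMap.aeval_self_charpoly L
    rw [hq, map_mul] at h
    have h2 := LinearMap.congr_fun h u
    rw [Module.End.mul_apply] at h2
    simpa [Module.algebraMap_end_eq_smul_id, Module.End.one_eq_id] using h2
  have hv₀G : v₀ ∈ Module.End.maxGenEigenspace L 1 := by
    rw [Module.End.mem_maxGenEigenspace]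
    exact ⟨1, by simp [hL, hΦv₀]⟩
  -- Otherwise `v₀` and `q(Φ) v` span the two-dimensional generalized eigenspace of `1`, and `D`
  -- vanishes on both. But this space contains the range of `q(Φ)`, and `D ∘ q(Φ) = q(1) D` with
  -- `q(1) ≠ 0`, which would force `D = 0`.
  by_contra hmem
  have hli : LinearIndependent ℝ ![v₀, aeval L q v] := by
    rw [LinearIndependent.pair_iff' hv₀]
    intro a ha
    exact hmem (Submodule.mem_span_singleton.2 ⟨a, ha⟩)
  have hspan : Submodule.span ℝ (Set.range ![v₀, aeval L q v]) = Module.End.maxGenEigenspace L 1 := by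
    refine Submodule.eq_of_le_of_finrank_eq ?_ ?_
    · rw [Submodule.span_le]
      rintro _ ⟨i, rfl⟩
      fin_cases i
      · exact hv₀G
      · exact hker v
    · rw [finrank_span_eq_card hli, hfin]; simp
  have hGD : ∀ u ∈ Module.End.maxGenEigenspace L 1, D u = 0 := by
    intro u hu
    rw [← hspan] at hu
    have hle : Submodule.span ℝ (Set.range ![v₀, aeval L q v]) ≤ LinearMap.ker (D : Phase →ₗ[ℝ] ℝ) := by
      rw [Submodule.span_le]
      rintro _ ⟨i, rfl⟩
      fin_cases i
      · exact hDv₀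
      · change D (aeval L q v) = 0
        rw [hDq, hv, mul_zero]
    exact hle hu
  apply hD
  ext u
  have h := hGD _ (hker u)
  rw [hDq] at h
  simpa [hq1] using h

/-- A linear map that agrees with the monodromy map modulo the flow direction on the tangent space
of the level set, and contracts transversally to it, is hyperbolic. -/
theorem exists_isGreenKernel_return {Φ A : Phase →L[ℝ] Phase} {D : Phase →L[ℝ] ℝ} {v₀ : Phase} {μ : ℝ}
    (hcount : open Classical in (complexEigenvalues Φ).count 1 = 2)
    (hcirc : ∀ z ∈ complexEigenvalues Φ, ‖z‖ = 1 → z = 1)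
    (hD : D ≠ 0) (hDΦ : ∀ v, D (Φ v) = D v) (hv₀ : v₀ ≠ 0) (hΦv₀ : Φ v₀ = v₀) (hDv₀ : D v₀ = 0)
    (hA : ∀ v, D v = 0 → A v - Φ v ∈ Submodule.span ℝ {v₀}) (hAv₀ : A v₀ = 0)
    (hDA : ∀ v, D (A v) = μ * D v) (hμ : |μ| < 1) : ∃ Γ, IsGreenKernel A Γ := by
  obtain ⟨q, hq, hq1, hqroots, hfin⟩ := exists_nontrivial_factor hcount hcirc
  have hpow : ∀ (n : ℕ) (v : Phase), D v = 0 → D ((Φ ^ n) v) = 0 ∧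
      (A ^ n) v - (Φ ^ n) v ∈ Submodule.span ℝ {v₀} := by
    intro n
    induction n with
    | zero => intro v hv; simp [hv]
    | succ n ih =>
      intro v hv
      obtain ⟨h1, h2⟩ := ih v hv
      rw [pow_succ', pow_succ', mul_apply_eq_comp,
        mul_apply_eq_comp, hDΦ]
      refine ⟨h1, ?_⟩
      obtain ⟨a, ha⟩ := Submodule.mem_span_singleton.1 h2
      have h3 : A ((A ^ n) v) = A ((Φ ^ n) v) := by
        rw [← sub_eq_zero, ← map_sub, ← ha, map_smul, hAv₀, smul_zero]
      rw [h3]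
      exact hA _ h1
  have hpoly : ∀ v, D v = 0 → aeval A q v ∈ Submodule.span ℝ {v₀} := by
    intro v hv
    have h1 := aeval_factor_mem_span hq hq1 hfin hD hDΦ hv₀ hΦv₀ hDv₀ hv
    have h2 : aeval A q v - aeval (Φ : Phase →ₗ[ℝ] Phase) q v ∈ Submodule.span ℝ {v₀} := by
      rw [aeval_eq_sum_range, aeval_eq_sum_range, LinearMap.sum_apply,
        sum_apply, ← Finset.sum_sub_distrib]
      refine Submodule.sum_mem _ fun i _ => ?_
      rw [LinearMap.smul_apply, smul_apply, ← smul_sub]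
      refine Submodule.smul_mem _ _ ?_
      have h3 : ((Φ : Phase →ₗ[ℝ] Phase) ^ i) v = (Φ ^ i) v := by
        rw [← ContinuousLinearMap.toLinearMap_pow]; rfl
      rw [h3]
      exact (hpow i v hv).2
    simpa using Submodule.add_mem _ h2 h1
  -- An annihilating polynomial in three stages: `A - μ` maps into `ker D`, `q(A)` maps `ker D` into
  -- the flow line, and `A` kills the flow line.
  refine exists_isGreenKernel (χ := X * (q * (X - C μ))) ?_ fun z hz => ?_
  · ext1 v
    rw [map_mul, map_mul, mul_apply_eq_comp,
      mul_apply_eq_comp]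
    have h1 : D ((aeval A (X - C μ : ℝ[X])) v) = 0 := by
      simp [hDA, Algebra.algebraMap_eq_smul_one]
    obtain ⟨a, ha⟩ := Submodule.mem_span_singleton.1 (hpoly _ h1)
    rw [← ha, aeval_X, map_smul, hAv₀, smul_zero, zero_apply]
  · rw [map_mul, map_mul, mul_eq_zero, mul_eq_zero, aeval_X] at hz
    rcases hz with rfl | hz | hz
    · simp
    · exact hqroots z hz
    · rw [map_sub, aeval_X, aeval_C, sub_eq_zero] at hz
      rw [hz]
      simpa using hμ.ne

end ReturnMapSpectrum

/-! ### Hitting times of hyperplanes and return maps. -/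

section Sections

variable {E : Type*} [NormedAddCommGroup E] [NormedSpace ℝ E] {f : E → E} {φ : ℝ → E → E}

/-- The implicit function theorem for `ℓ (φ t x) = ℓ c`. The local uniqueness clause later shows
that the return map of the reversed flow inverts the return map on the section. -/
theorem IsFlow.exists_hitting_time [CompleteSpace E] (hφ : IsFlow f φ) {ℓ : E →L[ℝ] ℝ} {x₀ c : E}
    {t₀ : ℝ} (hc : φ t₀ x₀ = c) (hℓ : ℓ (f c) ≠ 0) :
    ∃ θ : E → ℝ, θ x₀ = t₀ ∧ ContDiffAt ℝ 1 θ x₀ ∧ (∀ᶠ x in 𝓝 x₀, ℓ (φ (θ x) x) = ℓ c) ∧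
      ∀ᶠ q in 𝓝 (x₀, t₀), ℓ (φ q.2 q.1) = ℓ c → q.2 = θ q.1 := by
  set g : E × ℝ → ℝ := fun q => ℓ (φ q.2 q.1) with hg
  have hgc : ContDiff ℝ 1 g := ℓ.contDiff.comp hφ.contDiff
  have hga : ContDiffAt ℝ 1 g (x₀, t₀) := hgc.contDiffAt
  have hinv : (fderiv ℝ g (x₀, t₀) ∘L .inr ℝ E ℝ).IsInvertible := by
    refine ⟨ContinuousLinearEquiv.unitsEquivAut ℝ (Units.mk0 _ hℓ), ?_⟩
    ext
    have h1 : HasDerivAt (fun t => (x₀, t)) ((0 : E), (1 : ℝ)) t₀ :=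
      (hasDerivAt_const t₀ x₀).prodMk (hasDerivAt_id t₀)
    have h2 := (hga.differentiableAt one_ne_zero).hasFDerivAt.comp_hasDerivAt t₀ h1
    have h3 : HasDerivAt (fun t => g (x₀, t)) (ℓ (f (φ t₀ x₀))) t₀ :=
      ℓ.hasFDerivAt.comp_hasDerivAt t₀ (hφ.hasDerivAt x₀ t₀)
    have h4 := h2.unique h3
    rw [hc] at h4
    simp [h4]
  refine ⟨hga.implicitFunction one_ne_zero hinv, hga.implicitFunction_apply_self one_ne_zero hinv,
    hga.contDiffAt_implicitFunction one_ne_zero hinv, ?_, ?_⟩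
  · filter_upwards [hga.eventually_apply_implicitFunction one_ne_zero hinv] with x hx
    simpa [hg, hc] using hx
  · filter_upwards [hga.eventually_apply_eq_iff_implicitFunction one_ne_zero hinv] with q hq h
    exact (hq.1 (by simpa [hg, hc] using h)).symm

/-- The derivative of the map to a hitting hyperplane. -/
theorem IsFlow.hasFDerivAt_hitting (hφ : IsFlow f φ) {θ : E → ℝ} {x : E}
    (hθ : ContDiffAt ℝ 1 θ x) :
    ContDiffAt ℝ 1 (fun y => φ (θ y) y) x ∧
    ∀ v, fderiv ℝ (fun y => φ (θ y) y) x v =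
      fderiv ℝ (φ (θ x)) x v + fderiv ℝ θ x v • f (φ (θ x) x) := by
  have hc : ContDiffAt ℝ 1 (fun y => φ (θ y) y) x :=
    ContDiffAt.comp (g := fun q : E × ℝ => φ q.2 q.1) (f := fun y => (y, θ y)) x
      hφ.contDiff.contDiffAt (contDiffAt_id.prodMk hθ)
  refine ⟨hc, fun v => ?_⟩
  set g : E × ℝ → E := fun q => φ q.2 q.1 with hg
  have hgd : HasFDerivAt g (fderiv ℝ g (x, θ x)) (x, θ x) :=
    (hφ.contDiff.differentiable one_ne_zero _).hasFDerivAt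
  have h1 : HasFDerivAt (fun y => g (y, θ y)) _ x :=
    hgd.comp (f := fun y => (y, θ y)) x
      ((hasFDerivAt_id x).prodMk (hθ.differentiableAt one_ne_zero).hasFDerivAt)
  have h2 : fderiv ℝ g (x, θ x) (v, 0) = fderiv ℝ (φ (θ x)) x v := by
    have h3 : HasFDerivAt (fun y => g (y, θ x)) _ x :=
      hgd.comp (f := fun y => (y, θ x)) x ((hasFDerivAt_id x).prodMk (hasFDerivAt_const (θ x) x))
    rw [(hφ.hasFDerivAt_slice (θ x) x).fderiv, (hφ.hasFDerivAt_slice (θ x) x).unique h3]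
    simp
  have h4 : fderiv ℝ g (x, θ x) (0, 1) = f (φ (θ x) x) :=
    (hgd.comp_hasDerivAt (θ x)
      ((hasDerivAt_const (θ x) x).prodMk (hasDerivAt_id (θ x)))).unique (hφ.hasDerivAt x (θ x))
  rw [h1.fderiv]
  have h5 : ((v, fderiv ℝ θ x v) : E × ℝ) = (v, 0) + fderiv ℝ θ x v • (0, 1) := by simp
  simp only [ContinuousLinearMap.comp_apply, ContinuousLinearMap.prod_apply,
    ContinuousLinearMap.id_apply]
  rw [h5, map_add, map_smul, h2, h4]

/-- The map lands in a hyperplane, so its derivative lands in `ker ℓ`. The derivative sends the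
field to a multiple of the field at the image, and by transversality only the zero multiple lies in
`ker ℓ`. -/
theorem IsFlow.fderiv_hitting_field (hφ : IsFlow f φ) {θ : E → ℝ} {x : E} {ℓ : E →L[ℝ] ℝ} {a : ℝ}
    (hθ : ContDiffAt ℝ 1 θ x) (hsec : ∀ᶠ y in 𝓝 x, ℓ (φ (θ y) y) = a)
    (hℓ : ℓ (f (φ (θ x) x)) ≠ 0) :
    (∀ v, ℓ (fderiv ℝ (fun y => φ (θ y) y) x v) = 0) ∧
      fderiv ℝ (fun y => φ (θ y) y) x (f x) = 0 := by
  obtain ⟨hc, hd⟩ := hφ.hasFDerivAt_hitting hθ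
  have h1 : ∀ v, ℓ (fderiv ℝ (fun y => φ (θ y) y) x v) = 0 := by
    intro v
    have h2 : HasFDerivAt (fun y => ℓ (φ (θ y) y)) _ x :=
      ℓ.hasFDerivAt.comp x (hc.differentiableAt one_ne_zero).hasFDerivAt
    have h3 : HasFDerivAt (fun y => ℓ (φ (θ y) y)) (0 : E →L[ℝ] ℝ) x :=
      (hasFDerivAt_const a x).congr_of_eventuallyEq hsec
    simpa using congrArg (fun L : E →L[ℝ] ℝ => L v) (h2.unique h3)
  refine ⟨h1, ?_⟩
  have h2 := h1 (f x)
  rw [hd, hφ.fderiv_apply_field] at h2 ⊢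
  rw [map_add, map_smul, smul_eq_mul] at h2
  have h3 : (1 + fderiv ℝ θ x (f x)) * ℓ (f (φ (θ x) x)) = 0 := by linarith
  have h4 := (mul_eq_zero.1 h3).resolve_right hℓ
  rw [← one_smul ℝ (f (φ (θ x) x)), smul_smul, ← add_smul, mul_one, h4, zero_smul]

/-- `θ` is the time of first return to the hyperplane `ker ℓ` through the point `γ₀` of a periodic
orbit, as a function of the position relative to `γ₀`. -/
structure IsReturnTime (f : E → E) (φ : ℝ → E → E) (γ₀ : E) (T : ℝ) (ℓ : E →L[ℝ] ℝ) (θ : E → ℝ)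
    (r : ℝ) : Prop where
  flow : IsFlow f φ
  period : φ T γ₀ = γ₀
  time_pos : 0 < T
  pos : 0 < r
  value : θ 0 = T
  contDiffAt : ∀ y, ‖y‖ < r → ContDiffAt ℝ 1 θ y
  mem : ∀ y, ‖y‖ < r → ℓ (φ (θ y) (γ₀ + y) - γ₀) = 0
  unique : ∀ y t, ‖y‖ < r → |t - T| < r → ℓ (φ t (γ₀ + y) - γ₀) = 0 → t = θ y
  transverse : ∀ y, ‖y‖ < r → ℓ (f (φ (θ y) (γ₀ + y))) ≠ 0
  time_le : ∃ C, 0 ≤ C ∧ ∀ y, ‖y‖ < r → |θ y - T| ≤ C * ‖y‖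

/-- The return map in the coordinates centred at `γ₀`. -/
def returnMap (φ : ℝ → E → E) (γ₀ : E) (θ : E → ℝ) (y : E) : E := φ (θ y) (γ₀ + y) - γ₀

theorem exists_isReturnTime [CompleteSpace E] (hφ : IsFlow f φ) (hf : Continuous f) {γ₀ : E} {T : ℝ}
    (hper : φ T γ₀ = γ₀) (hT : 0 < T) {ℓ : E →L[ℝ] ℝ} (hℓ : ℓ (f γ₀) ≠ 0) :
    ∃ θ r, IsReturnTime f φ γ₀ T ℓ θ r := by
  obtain ⟨θ, h0, hθ, hsec, huniq⟩ := hφ.exists_hitting_time hper hℓ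
  have hev : ∀ᶠ x in 𝓝 γ₀, ContDiffAt ℝ 1 θ x := hθ.eventually (by simp)
  have htr : ∀ᶠ x in 𝓝 γ₀, ℓ (f (φ (θ x) x)) ≠ 0 := by
    have h1 : ContinuousAt (fun x => φ (θ x) x) γ₀ := (hφ.hasFDerivAt_hitting hθ).1.continuousAt
    have h2 : ContinuousAt (fun x => ℓ (f (φ (θ x) x))) γ₀ :=
      (ℓ.continuous.comp hf).continuousAt.comp h1
    refine h2.eventually_ne ?_
    rw [h0, hper]; exact hℓ
  obtain ⟨C, hC⟩ := ((hθ.differentiableAt one_ne_zero).hasFDerivAt.isBigO_sub).bound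
  obtain ⟨s, hs0, hs⟩ := Metric.eventually_nhds_iff.1 (hev.and (hsec.and (htr.and hC)))
  obtain ⟨s', hs0', hs'⟩ := Metric.eventually_nhds_iff.1 huniq
  have hd : ∀ y : E, dist (γ₀ + y) γ₀ = ‖y‖ := fun y => by simp [dist_eq_norm]
  have hmem : ∀ y : E, ‖y‖ < min s s' → _ := fun y hy =>
    hs (y := γ₀ + y) (by rw [hd]; exact hy.trans_le (min_le_left _ _))
  refine ⟨fun y => θ (γ₀ + y), min s s', hφ, hper, hT, lt_min hs0 hs0', by simpa using h0,
    fun y hy => ?_, fun y hy => ?_, fun y t hy ht h => ?_, fun y hy => (hmem y hy).2.2.1,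
    |C|, abs_nonneg _, fun y hy => ?_⟩
  · exact ContDiffAt.comp (g := θ) (f := fun y => γ₀ + y) y (hmem y hy).1
      (contDiffAt_const.add contDiffAt_id)
  · rw [map_sub, (hmem y hy).2.1, sub_self]
  · refine hs' (y := (γ₀ + y, t)) ?_ (by rwa [map_sub, sub_eq_zero] at h)
    rw [Prod.dist_eq, hd, max_lt_iff, Real.dist_eq]
    exact ⟨hy.trans_le (min_le_right _ _), ht.trans_le (min_le_right _ _)⟩
  · have := (hmem y hy).2.2.2
    simp only [h0, Real.norm_eq_abs, add_sub_cancel_left] at this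
    refine this.trans ?_
    gcongr
    exact le_abs_self C

namespace IsReturnTime

variable {γ₀ : E} {T r : ℝ} {ℓ : E →L[ℝ] ℝ} {θ : E → ℝ}

theorem returnMap_zero (h : IsReturnTime f φ γ₀ T ℓ θ r) : returnMap φ γ₀ θ 0 = 0 := by
  simp [returnMap, h.value, h.period]

theorem contDiffAt_returnMap (h : IsReturnTime f φ γ₀ T ℓ θ r) {y : E} (hy : ‖y‖ < r) :
    ContDiffAt ℝ 1 (returnMap φ γ₀ θ) y := by
  have h1 : ContDiffAt ℝ 1 (fun y => (γ₀ + y, θ y)) y :=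
    (contDiffAt_const.add contDiffAt_id).prodMk (h.contDiffAt y hy)
  exact (ContDiffAt.comp (g := fun q : E × ℝ => φ q.2 q.1) y h.flow.contDiff.contDiffAt h1).sub
    contDiffAt_const

theorem fderiv_returnMap (h : IsReturnTime f φ γ₀ T ℓ θ r) {y : E} (hy : ‖y‖ < r) (v : E) :
    (∃ a : ℝ, fderiv ℝ (returnMap φ γ₀ θ) y v =
      fderiv ℝ (φ (θ y)) (γ₀ + y) v + a • f (φ (θ y) (γ₀ + y))) ∧
    ℓ (fderiv ℝ (returnMap φ γ₀ θ) y v) = 0 ∧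
    fderiv ℝ (returnMap φ γ₀ θ) y (f (γ₀ + y)) = 0 := by
  set θ' : E → ℝ := fun x => θ (x - γ₀) with hθ'
  have e1 : θ' (γ₀ + y) = θ y := by simp [hθ']
  have hθc : ContDiffAt ℝ 1 θ' (γ₀ + y) := by
    refine ContDiffAt.comp (g := θ) (f := fun x => x - γ₀) (γ₀ + y) ?_
      (contDiffAt_id.sub contDiffAt_const)
    simpa using h.contDiffAt y hy
  have hsec : ∀ᶠ x in 𝓝 (γ₀ + y), ℓ (φ (θ' x) x) = ℓ γ₀ := by
    have h1 : ∀ᶠ x in 𝓝 (γ₀ + y), ‖x - γ₀‖ < r := by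
      have hc : ContinuousAt (fun x => ‖x - γ₀‖) (γ₀ + y) := by fun_prop
      refine hc.eventually_lt continuousAt_const ?_
      simpa using hy
    filter_upwards [h1] with x hx
    have := h.mem _ hx
    rwa [add_sub_cancel, map_sub, sub_eq_zero] at this
  have heq : fderiv ℝ (returnMap φ γ₀ θ) y = fderiv ℝ (fun x => φ (θ' x) x) (γ₀ + y) := by
    have h1 : returnMap φ γ₀ θ = fun y => (fun x => φ (θ' x) x) (γ₀ + y) - γ₀ := by
      ext1 z; simp [returnMap, hθ']
    rw [h1, fderiv_sub_const]
    exact fderiv_comp_add_left (f := fun x => φ (θ' x) x) γ₀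
  have h2 := h.flow.fderiv_hitting_field hθc hsec (by rw [e1]; exact h.transverse y hy)
  rw [heq]
  refine ⟨⟨fderiv ℝ θ' (γ₀ + y) v, ?_⟩, h2.1 v, h2.2⟩
  rw [(h.flow.hasFDerivAt_hitting hθc).2, e1]

end IsReturnTime

end Sections

/-! ### Orbits near a cycle and their successive returns. -/

section SectionReturns

variable {E : Type*} [NormedAddCommGroup E] [NormedSpace ℝ E] {f : E → E} {φ : ℝ → E → E}
  {γ₀ : E} {T r : ℝ} {ℓ : E →L[ℝ] ℝ} {θ : E → ℝ}

/-- The orbit of a point under a flow. -/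
def flowOrbit {E : Type*} (φ : ℝ → E → E) (x : E) : Set E := range fun t => φ t x

theorem IsFlow.apply_add_nat_mul (hφ : IsFlow f φ) (hper : φ T γ₀ = γ₀) (n : ℕ) (t : ℝ) :
    φ (n * T + t) γ₀ = φ t γ₀ := by
  induction n with
  | zero => simp
  | succ n ih =>
    rw [show ((n + 1 : ℕ) : ℝ) * T + t = (n * T + t) + T by push_cast; ring, hφ.add, hper, ih]

theorem IsFlow.apply_periodic (hφ : IsFlow f φ) (hper : φ T γ₀ = γ₀) :
    Function.Periodic (fun t => φ t γ₀) T := fun t => by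
  simp only [hφ.add, hper]

theorem IsFlow.exists_mem_Ico_of_mem_flowOrbit (hφ : IsFlow f φ) (hT : 0 < T) (hper : φ T γ₀ = γ₀)
    {x : E} (hx : x ∈ flowOrbit φ γ₀) : ∃ s ∈ Ico 0 T, φ s γ₀ = x := by
  obtain ⟨t, rfl⟩ := hx
  obtain ⟨s, hs, h⟩ := (hφ.apply_periodic hper).exists_mem_Ico₀ hT t
  exact ⟨s, hs, h.symm⟩

theorem IsFlow.isCompact_flowOrbit (hφ : IsFlow f φ) (hT : 0 < T) (hper : φ T γ₀ = γ₀) :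
    IsCompact (flowOrbit φ γ₀) := by
  have h : flowOrbit φ γ₀ = (fun t => φ t γ₀) '' Icc 0 T := by
    refine Subset.antisymm (fun x hx => ?_) (image_subset_range _ _)
    obtain ⟨s, hs, rfl⟩ := hφ.exists_mem_Ico_of_mem_flowOrbit hT hper hx
    exact ⟨s, ⟨hs.1, hs.2.le⟩, rfl⟩
  rw [h]
  exact isCompact_Icc.image (hφ.continuous.comp (continuous_const.prodMk continuous_id))

theorem flowOrbit_nonempty {E : Type*} (φ : ℝ → E → E) (x : E) : (flowOrbit φ x).Nonempty := range_nonempty _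

/-- For times close to `0` or `T` transversality excludes a second crossing of the hyperplane; for
the times in between minimality of the period and compactness keep the orbit away from `γ₀`. -/
theorem IsReturnTime.isFixedPt_unique (h : IsReturnTime f φ γ₀ T ℓ θ r) (hℓ : ℓ (f γ₀) ≠ 0)
    (hmin : ∀ s ∈ Ioo 0 T, φ s γ₀ ≠ γ₀) :
    ∃ δ > 0, ∀ x ∈ flowOrbit φ γ₀, ℓ (x - γ₀) = 0 → ‖x - γ₀‖ ≤ δ → x = γ₀ := by
  have hd : HasDerivAt (fun s => ℓ (φ s γ₀)) (ℓ (f γ₀)) 0 := by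
    have := ℓ.hasFDerivAt.comp_hasDerivAt (0 : ℝ) (h.flow.hasDerivAt γ₀ 0)
    rwa [h.flow.zero] at this
  have hne := hd.eventually_ne (c := ℓ γ₀) hℓ
  rw [eventually_nhdsWithin_iff, Metric.eventually_nhds_iff] at hne
  obtain ⟨η, hη, hne⟩ := hne
  have hcont : Continuous fun s => φ s γ₀ := h.flow.continuous.comp
    (continuous_const.prodMk continuous_id)
  obtain ⟨δ, hδ, hδ'⟩ : ∃ δ > 0, ∀ s ∈ Icc (η / 2) (T - η / 2), δ < ‖φ s γ₀ - γ₀‖ := by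
    rcases (Icc (η / 2) (T - η / 2)).eq_empty_or_nonempty with he | he
    · exact ⟨1, one_pos, by simp [he]⟩
    · obtain ⟨s, hs, hsm⟩ := isCompact_Icc.exists_isMinOn he
        ((hcont.sub continuous_const).norm.continuousOn (f := fun s => ‖φ s γ₀ - γ₀‖))
      have hpos : 0 < ‖φ s γ₀ - γ₀‖ :=
        norm_pos_iff.2 (sub_ne_zero.2 (hmin s ⟨by linarith [hs.1], by linarith [hs.2]⟩))
      exact ⟨_, half_pos hpos, fun t ht => (half_lt_self hpos).trans_le (hsm ht)⟩
  refine ⟨δ, hδ, fun x hx hsec hn => ?_⟩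
  obtain ⟨s, hs, rfl⟩ := h.flow.exists_mem_Ico_of_mem_flowOrbit h.time_pos h.period hx
  rw [map_sub, sub_eq_zero] at hsec
  by_cases h1 : s < η / 2
  · by_contra hx
    refine hne (y := s) ?_ (fun h0 => hx ?_) hsec
    · rw [Real.dist_eq, sub_zero, abs_of_nonneg hs.1]; linarith
    · rw [mem_singleton_iff.1 h0, h.flow.zero]
  by_cases h2 : T - η / 2 < s
  · refine absurd ?_ (hne (y := s - T) ?_ ?_)
    · have hp := h.flow.apply_periodic h.period (s - T)
      simp only [sub_add_cancel] at hp
      rw [← hp, hsec]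
    · rw [Real.dist_eq, sub_zero, abs_sub_lt_iff]
      constructor <;> linarith [hs.2]
    · simp only [mem_compl_iff, mem_singleton_iff]
      intro h0; linarith [hs.2]
  · exact absurd hn (not_le.2 (hδ' s ⟨not_lt.1 h1, not_lt.1 h2⟩))

/-- Near `γ₀`, a point of the section that is close to the orbit of `γ₀` is close to `γ₀`. -/
theorem IsReturnTime.exists_norm_lt_of_infDist_le [ProperSpace E] (h : IsReturnTime f φ γ₀ T ℓ θ r)
    (hℓ : ℓ (f γ₀) ≠ 0) (hmin : ∀ s ∈ Ioo 0 T, φ s γ₀ ≠ γ₀) :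
    ∃ δ₀ > 0, ∀ ε > 0, ∃ δ > 0, ∀ y, ℓ y = 0 → ‖y‖ ≤ δ₀ →
      Metric.infDist (γ₀ + y) (flowOrbit φ γ₀) ≤ δ → ‖y‖ < ε := by
  obtain ⟨δ₀, hδ₀, hu⟩ := h.isFixedPt_unique hℓ hmin
  refine ⟨δ₀, hδ₀, fun ε hε => ?_⟩
  set S : Set E := Metric.closedBall 0 δ₀ ∩ {y | ℓ y = 0 ∧ ε ≤ ‖y‖} with hS
  have hSc : IsCompact S := (isCompact_closedBall 0 δ₀).inter_right
    ((isClosed_eq ℓ.continuous continuous_const).inter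
      (isClosed_le continuous_const continuous_norm))
  have hcyc := h.flow.isCompact_flowOrbit h.time_pos h.period
  have hcont : Continuous fun y => Metric.infDist (γ₀ + y) (flowOrbit φ γ₀) :=
    (Metric.continuous_infDist_pt _).comp (continuous_const.add continuous_id)
  have hpos : ∀ y ∈ S, 0 < Metric.infDist (γ₀ + y) (flowOrbit φ γ₀) := by
    rintro y ⟨hy1, hy2, hy3⟩
    refine (hcyc.isClosed.notMem_iff_infDist_pos (flowOrbit_nonempty _ _)).1 fun hy => ?_
    have := hu _ hy (by simpa using hy2) (by simpa using hy1)
    rw [add_eq_left] at this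
    rw [this, norm_zero] at hy3
    linarith
  rcases S.eq_empty_or_nonempty with he | he
  · refine ⟨1, one_pos, fun y h1 h2 _ => ?_⟩
    by_contra hlt
    have : y ∈ S := ⟨by simpa using h2, h1, not_lt.1 hlt⟩
    rw [he] at this; exact this
  · obtain ⟨z, hz, hzm⟩ := hSc.exists_isMinOn he hcont.continuousOn
    refine ⟨_, half_pos (hpos z hz), fun y h1 h2 h3 => ?_⟩
    by_contra hlt
    have h4 : y ∈ S := ⟨by simpa using h2, h1, not_lt.1 hlt⟩
    have := hzm h4
    simp only [mem_ofPred_eq] at this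
    linarith [hpos z hz]

/-- Times of the successive returns of the orbit of `y`. -/
noncomputable def returnTimeSum (φ : ℝ → E → E) (γ₀ : E) (θ : E → ℝ) (y : E) (n : ℕ) : ℝ :=
  ∑ i ∈ Finset.range n, θ ((returnMap φ γ₀ θ)^[i] y)

theorem IsFlow.apply_returnTimeSum (hφ : IsFlow f φ) (y : E) (n : ℕ) :
    φ (returnTimeSum φ γ₀ θ y n) (γ₀ + y) = γ₀ + (returnMap φ γ₀ θ)^[n] y := by
  induction n with
  | zero => simp [returnTimeSum, hφ.zero]
  | succ n ih =>
    rw [returnTimeSum, Finset.sum_range_succ, add_comm, hφ.add]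
    rw [returnTimeSum] at ih
    rw [ih, Function.iterate_succ_apply', returnMap, add_sub_cancel]

theorem returnTimeSum_ge {E : Type*} [NormedAddCommGroup E] {φ : ℝ → E → E} {γ₀ : E} {T : ℝ}
    {θ : E → ℝ} {δ : ℝ}
    (hδ : ∀ y, ‖y‖ ≤ δ → T / 2 ≤ θ y) {y : E} {n : ℕ}
    (hy : ∀ i < n, ‖(returnMap φ γ₀ θ)^[i] y‖ ≤ δ) : n * (T / 2) ≤ returnTimeSum φ γ₀ θ y n := by
  have := Finset.card_nsmul_le_sum (Finset.range n) (fun i => θ ((returnMap φ γ₀ θ)^[i] y)) (T / 2)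
    fun i hi => hδ _ (hy i (Finset.mem_range.1 hi))
  simpa [returnTimeSum] using this

namespace IsReturnTime

theorem continuousAt_returnMap (h : IsReturnTime f φ γ₀ T ℓ θ r) :
    Tendsto (returnMap φ γ₀ θ) (𝓝 0) (𝓝 0) := by
  have := (h.contDiffAt_returnMap (y := 0) (by simpa using h.pos)).continuousAt.tendsto
  rwa [h.returnMap_zero] at this

theorem tendsto_time (h : IsReturnTime f φ γ₀ T ℓ θ r) : Tendsto θ (𝓝 0) (𝓝 T) := by
  have := (h.contDiffAt 0 (by simpa using h.pos)).continuousAt.tendsto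
  rwa [h.value] at this

theorem exists_time_ge (h : IsReturnTime f φ γ₀ T ℓ θ r) :
    ∃ δ > 0, δ < r ∧ ∀ y, ‖y‖ ≤ δ → T / 2 ≤ θ y := by
  obtain ⟨δ, hδ, hδ'⟩ := Metric.eventually_nhds_iff.1
    (h.tendsto_time.eventually (lt_mem_nhds (half_lt_self h.time_pos)))
  refine ⟨min δ r / 2, by have := h.pos; positivity, ?_, fun y hy => (hδ' ?_).le⟩
  · have := lt_min hδ h.pos
    linarith [min_le_right δ r]
  · rw [dist_zero_right]
    have := lt_min hδ h.pos
    linarith [min_le_left δ r]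

/-- If an orbit that starts in the section stays close to the periodic orbit for all positive times,
then its returns to the section stay close to `γ₀`; they converge to `γ₀` if the orbit converges to
the periodic orbit. -/
theorem exists_returns_small [ProperSpace E] (h : IsReturnTime f φ γ₀ T ℓ θ r)
    (hℓ : ℓ (f γ₀) ≠ 0) (hmin : ∀ s ∈ Ioo 0 T, φ s γ₀ ≠ γ₀) :
    ∃ δ₀ > 0, δ₀ < r ∧ ∀ ε > 0, ∃ δ > 0, ∀ y, ℓ y = 0 → ‖y‖ ≤ δ₀ →
      (∀ t, 0 ≤ t → Metric.infDist (φ t (γ₀ + y)) (flowOrbit φ γ₀) ≤ δ) →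
      (∀ n, ‖(returnMap φ γ₀ θ)^[n] y‖ < ε) ∧
      (Tendsto (fun t => Metric.infDist (φ t (γ₀ + y)) (flowOrbit φ γ₀)) atTop (𝓝 0) →
        Tendsto (fun n => (returnMap φ γ₀ θ)^[n] y) atTop (𝓝 0)) := by
  obtain ⟨δa, hδa, hnear⟩ := h.exists_norm_lt_of_infDist_le hℓ hmin
  obtain ⟨δb, hδb, hδbr, hθ⟩ := h.exists_time_ge
  set δ₀ := min δa δb with hδ₀
  have hδ₀pos : 0 < δ₀ := lt_min hδa hδb
  obtain ⟨δc, hδc, hP⟩ := Metric.eventually_nhds_iff.1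
    (h.continuousAt_returnMap.eventually (Metric.closedBall_mem_nhds (0 : E) hδ₀pos))
  refine ⟨δ₀, hδ₀pos, (min_le_right _ _).trans_lt hδbr, fun ε hε => ?_⟩
  obtain ⟨δ, hδ, hδ'⟩ := hnear (min (min ε δc) δb) (by positivity)
  refine ⟨δ, hδ, fun y hy0 hy1 hy2 => ?_⟩
  -- Bootstrap: if one return is small, continuity puts the next within `δ₀`, where closeness to the
  -- cycle forces closeness to `γ₀`. The lower bound on the times shows that each return happens at
  -- a nonnegative time.
  have key : ∀ n, ‖(returnMap φ γ₀ θ)^[n] y‖ ≤ δ₀ ∧ ℓ ((returnMap φ γ₀ θ)^[n] y) = 0 ∧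
      ‖(returnMap φ γ₀ θ)^[n] y‖ < min (min ε δc) δb ∧ n * (T / 2) ≤ returnTimeSum φ γ₀ θ y n := by
    intro n
    induction n using Nat.strong_induction_on with
    | _ n ih =>
      have hts : n * (T / 2) ≤ returnTimeSum φ γ₀ θ y n :=
        returnTimeSum_ge hθ fun i hi => (ih i hi).1.trans (min_le_right _ _)
      have h1 : ‖(returnMap φ γ₀ θ)^[n] y‖ ≤ δ₀ ∧ ℓ ((returnMap φ γ₀ θ)^[n] y) = 0 := by
        cases n with
        | zero => exact ⟨hy1, hy0⟩
        | succ n =>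
          obtain ⟨-, -, h2, -⟩ := ih n (Nat.lt_succ_self n)
          rw [Function.iterate_succ_apply']
          refine ⟨?_, h.mem _ ((h2.trans_le (min_le_right _ _)).trans hδbr)⟩
          have := hP (y := (returnMap φ γ₀ θ)^[n] y)
            (by rw [dist_zero_right]; exact h2.trans_le ((min_le_left _ _).trans (min_le_right _ _)))
          simpa using this
      refine ⟨h1.1, h1.2, hδ' _ h1.2 (h1.1.trans (min_le_left _ _)) ?_, hts⟩
      rw [← h.flow.apply_returnTimeSum]
      have hT := h.time_pos
      exact hy2 _ (le_trans (by positivity) hts)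
  refine ⟨fun n => (key n).2.2.1.trans_le ((min_le_left _ _).trans (min_le_left _ _)),
    fun hlim => ?_⟩
  have htop : Tendsto (fun n => returnTimeSum φ γ₀ θ y n) atTop atTop :=
    tendsto_atTop_mono (fun n => (key n).2.2.2)
      (tendsto_natCast_atTop_atTop.atTop_mul_const (half_pos h.time_pos))
  have h2 := hlim.comp htop
  simp only [Function.comp_def, h.flow.apply_returnTimeSum] at h2
  rw [Metric.tendsto_atTop]
  intro ε' hε'
  obtain ⟨δ', hδ'0, hδ''⟩ := hnear ε' hε'
  obtain ⟨N, hN⟩ := eventually_atTop.1 (h2.eventually (ge_mem_nhds hδ'0))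
  refine ⟨N, fun n hn => ?_⟩
  rw [dist_zero_right]
  exact hδ'' _ (key n).2.1 ((key n).1.trans (min_le_left _ _)) (hN n hn)

/-- A point near `φ s γ₀` is carried near `γ₀` in time `T - s`, though not onto the section; one
application of the return map puts it there. -/
theorem exists_time_mem_section (h : IsReturnTime f φ γ₀ T ℓ θ r) {δ : ℝ} (hδ : 0 < δ) :
    ∃ η > 0, ∀ x, Metric.infDist x (flowOrbit φ γ₀) < η →
      ∃ t, 0 ≤ t ∧ ∃ y, φ t x = γ₀ + y ∧ ℓ y = 0 ∧ ‖y‖ < δ := by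
  obtain ⟨δb, hδb, hδbr, hθ⟩ := h.exists_time_ge
  obtain ⟨δc, hδc, hP⟩ := Metric.eventually_nhds_iff.1
    (h.continuousAt_returnMap.eventually (Metric.ball_mem_nhds (0 : E) hδ))
  obtain ⟨K, hK, hKd⟩ := h.flow.exists_dist_le
  have hT := h.time_pos
  refine ⟨min δb δc / Real.exp (K * T), by positivity, fun x hx => ?_⟩
  obtain ⟨z, hz, hxz⟩ := (Metric.infDist_lt_iff (flowOrbit_nonempty _ _)).1 hx
  obtain ⟨s, hs, rfl⟩ := h.flow.exists_mem_Ico_of_mem_flowOrbit hT h.period hz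
  set y := φ (T - s) x - γ₀ with hy
  have hyn : ‖y‖ < min δb δc := by
    have h1 : φ (T - s) (φ s γ₀) = γ₀ := by rw [← h.flow.add, sub_add_cancel, h.period]
    have h2 := hKd (T - s) x (φ s γ₀)
    rw [h1, dist_eq_norm, ← hy] at h2
    refine h2.trans_lt ?_
    rw [lt_div_iff₀' (Real.exp_pos _)] at hxz
    refine lt_of_le_of_lt ?_ hxz
    gcongr
    rw [abs_of_nonneg (by linarith [hs.2])]; linarith [hs.1]
  refine ⟨θ y + (T - s), ?_, returnMap φ γ₀ θ y, ?_, ?_, ?_⟩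
  · have := hθ y (hyn.trans_le (min_le_left _ _)).le
    linarith [hs.2]
  · rw [h.flow.add, returnMap, add_sub_cancel, hy, add_sub_cancel]
  · exact h.mem _ ((hyn.trans_le (min_le_left _ _)).trans hδbr)
  · have := hP (y := y) (by rw [dist_zero_right]; exact hyn.trans_le (min_le_right _ _))
    simpa using this

theorem exists_section_orbit [ProperSpace E] (h : IsReturnTime f φ γ₀ T ℓ θ r)
    (hℓ : ℓ (f γ₀) ≠ 0) (hmin : ∀ s ∈ Ioo 0 T, φ s γ₀ ≠ γ₀) {x : E}
    (hx : Tendsto (fun t => Metric.infDist (φ t x) (flowOrbit φ γ₀)) atTop (𝓝 0))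
    {δ : ℝ} (hδ : 0 < δ) (t₀ : ℝ) :
    ∃ t ≥ t₀, ∃ y, φ t x = γ₀ + y ∧ ℓ y = 0 ∧ (∀ n, ‖(returnMap φ γ₀ θ)^[n] y‖ < δ) ∧
      Tendsto (fun n => (returnMap φ γ₀ θ)^[n] y) atTop (𝓝 0) := by
  obtain ⟨δ₀, hδ₀, -, hsmall⟩ := h.exists_returns_small hℓ hmin
  obtain ⟨δ', hδ', hsmall⟩ := hsmall δ hδ
  obtain ⟨η, hη, hsec⟩ := h.exists_time_mem_section hδ₀
  obtain ⟨t₁, ht₁⟩ := eventually_atTop.1 (hx.eventually (gt_mem_nhds (lt_min hη hδ')))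
  obtain ⟨t, ht, y, hy1, hy2, hy3⟩ := hsec _
    ((ht₁ (max t₀ t₁) (le_max_right _ _)).trans_le (min_le_left _ _))
  rw [← h.flow.add] at hy1
  have hy4 : ∀ s, φ s (γ₀ + y) = φ (s + (t + max t₀ t₁)) x := fun s => by rw [← hy1, ← h.flow.add]
  obtain ⟨h5, h6⟩ := hsmall y hy2 hy3.le fun s hs => by
    rw [hy4]
    exact ((ht₁ _ (by linarith [le_max_right t₀ t₁])).trans_le (min_le_right _ _)).le
  refine ⟨t + max t₀ t₁, by linarith [le_max_left t₀ t₁], y, hy1, hy2, h5, h6 ?_⟩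
  simp only [hy4]
  exact hx.comp (tendsto_atTop_add_const_right _ _ tendsto_id)

/-- The return map of the reversed flow inverts the return map. -/
theorem eventually_reverse (h : IsReturnTime f φ γ₀ T ℓ θ r) {θ' : E → ℝ} {r' : ℝ}
    (h' : IsReturnTime (fun x => -f x) (fun t => φ (-t)) γ₀ T ℓ θ' r') :
    ∀ᶠ y in 𝓝 0, ℓ y = 0 → θ (returnMap (fun t => φ (-t)) γ₀ θ' y) = θ' y ∧
      returnMap φ γ₀ θ (returnMap (fun t => φ (-t)) γ₀ θ' y) = y := by
  have h1 := h'.continuousAt_returnMap.eventually (Metric.ball_mem_nhds (0 : E) h.pos)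
  have h2 := h'.tendsto_time.eventually (Metric.ball_mem_nhds T h.pos)
  filter_upwards [h1, h2] with y h1 h2 hy
  set z := returnMap (fun t => φ (-t)) γ₀ θ' y with hz
  have h3 : φ (θ' y) (γ₀ + z) = γ₀ + y := by
    rw [hz, returnMap, add_sub_cancel, h.flow.apply_neg]
  have h4 : θ' y = θ z := h.unique z (θ' y) (by simpa using h1) (by simpa [Real.dist_eq] using h2)
    (by rw [h3, add_sub_cancel_left, hy])
  exact ⟨h4.symm, by rw [returnMap, ← h4, h3, add_sub_cancel_left]⟩

end IsReturnTime

end SectionReturns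

/-! ### The summability estimate for returns, and its effect on the phase. -/

section HyperbolicReturns

variable {E : Type*} [NormedAddCommGroup E] [NormedSpace ℝ E] {f : E → E} {φ : ℝ → E → E}
  {γ₀ : E} {T r : ℝ} {ℓ : E →L[ℝ] ℝ} {θ : E → ℝ}

/-- Two orbits of `P` in `ker ℓ` that stay small are summably close, with a bound by the distances
at the two ends. -/
def HasReturnSumBound (P : E → E) (ℓ : E →L[ℝ] ℝ) (δ C : ℝ) : Prop :=
  ∀ y z, ℓ y = 0 → ℓ z = 0 → ∀ N : ℕ, (∀ n ≤ N, ‖P^[n] y‖ ≤ δ) → (∀ n ≤ N, ‖P^[n] z‖ ≤ δ) →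
    ∑ n ∈ Finset.range (N + 1), ‖P^[n] y - P^[n] z‖ ≤ C * (‖y - z‖ + ‖P^[N] y - P^[N] z‖)

/-- The difference of two small orbits of `P` is an approximate orbit of `A`, so the linear `ℓ¹`
estimate applies. -/
theorem IsGreenKernel.exists_sum_dist_le {P : E → E} {A : E →L[ℝ] E} {Γ : ℤ → E →L[ℝ] E}
    (hΓ : IsGreenKernel A Γ) (hP : HasStrictFDerivAt P A 0) :
    ∃ δ > 0, ∃ C, 0 ≤ C ∧ ∀ (y z : ℕ → E) (N : ℕ), (∀ n < N, y (n + 1) = P (y n)) →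
      (∀ n < N, z (n + 1) = P (z n)) → (∀ n < N, ‖y n‖ ≤ δ) → (∀ n < N, ‖z n‖ ≤ δ) →
      ∑ n ∈ Finset.range (N + 1), ‖y n - z n‖ ≤ C * (‖y 0 - z 0‖ + ‖y N - z N‖) := by
  obtain ⟨η, hη, C, hC, h⟩ := hΓ.exists_sum_norm_le
  obtain ⟨δ, hδ0, hδ⟩ := ((eventually_linear_approx hP hη).and self_mem_nhdsWithin).exists
  refine ⟨δ, hδ, C, hC, fun y z N hy hz hyδ hzδ => h (fun n => y n - z n) N fun n hn => ?_⟩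
  simp only [hy n hn, hz n hn]
  exact hδ0 _ _ (by simpa using hyδ n hn) (by simpa using hzδ n hn)

namespace IsReturnTime

theorem hasStrictFDerivAt_returnMap (h : IsReturnTime f φ γ₀ T ℓ θ r) {y : E} (hy : ‖y‖ < r) :
    HasStrictFDerivAt (returnMap φ γ₀ θ) (fderiv ℝ (returnMap φ γ₀ θ) y) y :=
  (h.contDiffAt_returnMap hy).hasStrictFDerivAt one_ne_zero

theorem iterate_mem (h : IsReturnTime f φ γ₀ T ℓ θ r) {y : E} (hy : ℓ y = 0) (n : ℕ)
    (hn : ∀ m < n, ‖(returnMap φ γ₀ θ)^[m] y‖ < r) : ℓ ((returnMap φ γ₀ θ)^[n] y) = 0 := by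
  cases n with
  | zero => exact hy
  | succ n =>
    rw [Function.iterate_succ_apply']
    exact h.mem _ (hn n (Nat.lt_succ_self n))

theorem tendsto_fderiv_returnMap (h : IsReturnTime f φ γ₀ T ℓ θ r) :
    Tendsto (fderiv ℝ (returnMap φ γ₀ θ)) (𝓝 0) (𝓝 (fderiv ℝ (returnMap φ γ₀ θ) 0)) :=
  (h.contDiffAt_returnMap (y := 0) (by simpa using h.pos)).continuousAt_fderiv one_ne_zero

theorem exists_hasReturnSumBound (h : IsReturnTime f φ γ₀ T ℓ θ r) {Γ : ℤ → E →L[ℝ] E}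
    (hΓ : IsGreenKernel (fderiv ℝ (returnMap φ γ₀ θ) 0) Γ) :
    ∃ δ > 0, ∃ C, 0 ≤ C ∧ HasReturnSumBound (returnMap φ γ₀ θ) ℓ δ C := by
  obtain ⟨δ, hδ, C, hC, hs⟩ := hΓ.exists_sum_dist_le
    (h.hasStrictFDerivAt_returnMap (y := 0) (by simpa using h.pos))
  exact ⟨δ, hδ, C, hC, fun y z _ _ N hy hz => hs (fun n => (returnMap φ γ₀ θ)^[n] y)
    (fun n => (returnMap φ γ₀ θ)^[n] z) N (fun n _ => Function.iterate_succ_apply' _ _ _)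
    (fun n _ => Function.iterate_succ_apply' _ _ _) (fun n hn => hy n hn.le)
    (fun n hn => hz n hn.le)⟩

/-- The linearized return map kills the flow direction and cannot be inverted. Instead, a finite
backward orbit in the section, read in reverse order, is a forward orbit, and the `ℓ¹` estimate is
symmetric in the two ends. -/
theorem exists_hasReturnSumBound_reverse (h : IsReturnTime f φ γ₀ T ℓ θ r) {Γ : ℤ → E →L[ℝ] E}
    (hΓ : IsGreenKernel (fderiv ℝ (returnMap φ γ₀ θ) 0) Γ) {θ' : E → ℝ} {r' : ℝ}
    (h' : IsReturnTime (fun x => -f x) (fun t => φ (-t)) γ₀ T ℓ θ' r') :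
    ∃ δ > 0, ∃ C, 0 ≤ C ∧ HasReturnSumBound (returnMap (fun t => φ (-t)) γ₀ θ') ℓ δ C := by
  obtain ⟨δ, hδ, C, hC, hs⟩ := hΓ.exists_sum_dist_le
    (h.hasStrictFDerivAt_returnMap (y := 0) (by simpa using h.pos))
  obtain ⟨δ₁, hδ₁, hrev⟩ := Metric.eventually_nhds_iff.1 (h.eventually_reverse h')
  have hr' := h'.pos
  set δ₂ := min δ (min δ₁ r') / 2 with hδ₂
  have hlt : δ₂ < min δ (min δ₁ r') := half_lt_self (by positivity)
  have hlt1 : δ₂ < δ₁ := hlt.trans_le ((min_le_right _ _).trans (min_le_left _ _))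
  have hlt2 : δ₂ < r' := hlt.trans_le ((min_le_right _ _).trans (min_le_right _ _))
  have hstep : ∀ y, ℓ y = 0 → ∀ N, (∀ n ≤ N, ‖(returnMap (fun t => φ (-t)) γ₀ θ')^[n] y‖ ≤ δ₂) →
      ∀ n < N, (returnMap (fun t => φ (-t)) γ₀ θ')^[N - (n + 1)] y =
        returnMap φ γ₀ θ ((returnMap (fun t => φ (-t)) γ₀ θ')^[N - n] y) := by
    intro y hy N hN n hn
    obtain ⟨m, rfl⟩ := Nat.exists_eq_add_of_lt hn
    rw [show n + m + 1 - (n + 1) = m by omega, show n + m + 1 - n = m + 1 by omega,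
      Function.iterate_succ_apply']
    exact ((hrev (by rw [dist_zero_right]; exact (hN m (by omega)).trans_lt hlt1)
      (h'.iterate_mem hy m fun i hi => (hN i (by omega)).trans_lt hlt2)).2).symm
  refine ⟨δ₂, by positivity, C, hC, fun y z hy hz N hyN hzN => ?_⟩
  have := hs (fun n => (returnMap (fun t => φ (-t)) γ₀ θ')^[N - n] y)
    (fun n => (returnMap (fun t => φ (-t)) γ₀ θ')^[N - n] z) N (hstep y hy N hyN) (hstep z hz N hzN)
    (fun n _ => (hyN _ (Nat.sub_le _ _)).trans (hlt.le.trans (min_le_left _ _)))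
    (fun n _ => (hzN _ (Nat.sub_le _ _)).trans (hlt.le.trans (min_le_left _ _)))
  rw [← Finset.sum_range_reflect]
  rw [add_comm ‖y - z‖]
  simpa using this

/-- While the returns stay small and summable, the orbit stays close to the periodic orbit, in
phase with it. -/
theorem exists_dist_wind_le (h : IsReturnTime f φ γ₀ T ℓ θ r) :
    ∃ C, 0 ≤ C ∧ ∀ (y : E) (N : ℕ) (η S : ℝ), η < r → (∀ n ≤ N, ‖(returnMap φ γ₀ θ)^[n] y‖ ≤ η) →
      ∑ n ∈ Finset.range N, ‖(returnMap φ γ₀ θ)^[n] y‖ ≤ S →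
      |returnTimeSum φ γ₀ θ y N - N * T| ≤ C * S ∧
      ∀ s ∈ Icc 0 (N * T), ∀ t, dist (φ t (γ₀ + y)) (φ s γ₀) ≤ C * (η + S + |t - s|) := by
  obtain ⟨Cθ, hCθ, hθ⟩ := h.time_le
  obtain ⟨K, hK, hKd⟩ := h.flow.exists_dist_le
  obtain ⟨L, hL, hLd⟩ := h.flow.exists_dist_time_le
  have hT := h.time_pos
  refine ⟨Cθ + L * Cθ + L + Real.exp (K * T), by positivity, fun y N η S hη hy hS => ?_⟩
  have hsum : ∀ n ≤ N, |returnTimeSum φ γ₀ θ y n - n * T| ≤ Cθ * S := by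
    intro n hn
    have h1 : returnTimeSum φ γ₀ θ y n - n * T =
        ∑ i ∈ Finset.range n, (θ ((returnMap φ γ₀ θ)^[i] y) - T) := by
      simp [returnTimeSum]
    rw [h1]
    refine (Finset.abs_sum_le_sum_abs _ _).trans ?_
    have h2 : ∑ i ∈ Finset.range n, |θ ((returnMap φ γ₀ θ)^[i] y) - T| ≤
        ∑ i ∈ Finset.range n, Cθ * ‖(returnMap φ γ₀ θ)^[i] y‖ :=
      Finset.sum_le_sum fun i hi =>
        hθ _ ((hy i ((Finset.mem_range.1 hi).le.trans hn)).trans_lt hη)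
    refine h2.trans ?_
    rw [← Finset.mul_sum]
    gcongr
    refine le_trans ?_ hS
    exact Finset.sum_le_sum_of_subset_of_nonneg (Finset.range_mono hn) fun _ _ _ => norm_nonneg _
  have hS0 : 0 ≤ S := (Finset.sum_nonneg fun _ _ => norm_nonneg _).trans hS
  have hη0 : 0 ≤ η := (norm_nonneg _).trans (hy 0 (Nat.zero_le _))
  refine ⟨(hsum N le_rfl).trans ?_, fun s hs t => ?_⟩
  · gcongr
    have : 0 ≤ L * Cθ + L + Real.exp (K * T) := by positivity
    linarith
  -- Compare from the start of the turn that contains `s`: there the clock is off by at most `Cθ *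
  -- S`, and within one turn the flow expands distances by at most `exp (K * T)`.
  · set n := ⌊s / T⌋₊ with hn
    have hn1 : (n : ℝ) ≤ s / T := Nat.floor_le (div_nonneg hs.1 hT.le)
    have hn2 : s / T < n + 1 := Nat.lt_floor_add_one _
    rw [le_div_iff₀ hT] at hn1
    rw [div_lt_iff₀ hT] at hn2
    have hnN : n ≤ N := by
      have h3 : (n : ℝ) ≤ N := le_of_mul_le_mul_right (hn1.trans hs.2) hT
      exact_mod_cast h3
    set s' := s - n * T with hs'
    have h1 : φ s γ₀ = φ s' γ₀ := by
      rw [← h.flow.apply_add_nat_mul h.period n s', hs', add_sub_cancel]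
    have h2 : φ (s' + returnTimeSum φ γ₀ θ y n) (γ₀ + y) =
        φ s' (γ₀ + (returnMap φ γ₀ θ)^[n] y) := by
      rw [h.flow.add, h.flow.apply_returnTimeSum]
    have h3 := hLd t (s' + returnTimeSum φ γ₀ θ y n) (γ₀ + y)
    have h4 := hKd s' (γ₀ + (returnMap φ γ₀ θ)^[n] y) γ₀
    rw [h2] at h3
    rw [h1]
    refine (dist_triangle _ _ _).trans ((add_le_add h3 h4).trans ?_)
    have h5 : |t - (s' + returnTimeSum φ γ₀ θ y n)| ≤ |t - s| + Cθ * S := by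
      have : t - (s' + returnTimeSum φ γ₀ θ y n) =
          (t - s) - (returnTimeSum φ γ₀ θ y n - n * T) := by rw [hs']; ring
      rw [this]
      exact (abs_sub _ _).trans (add_le_add le_rfl (hsum n hnN))
    have h6 : Real.exp (K * |s'|) ≤ Real.exp (K * T) := by
      gcongr
      rw [abs_of_nonneg (by linarith)]; linarith
    have h7 : dist (γ₀ + (returnMap φ γ₀ θ)^[n] y) γ₀ ≤ η := by
      simpa [dist_eq_norm] using hy n hnN
    calc L * |t - (s' + returnTimeSum φ γ₀ θ y n)| + Real.exp (K * |s'|) *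
          dist (γ₀ + (returnMap φ γ₀ θ)^[n] y) γ₀
        ≤ L * (|t - s| + Cθ * S) + Real.exp (K * T) * η := by gcongr
      _ ≤ (Cθ + L * Cθ + L + Real.exp (K * T)) * (η + S + |t - s|) := by
        have e1 : 0 ≤ (Cθ + L * Cθ + L) * η := by positivity
        have e2 : 0 ≤ (Cθ + L + Real.exp (K * T)) * S := by positivity
        have e3 : 0 ≤ (Cθ + L * Cθ + Real.exp (K * T)) * |t - s| := by positivity
        nlinarith

/-- If the returns converge to `γ₀`, the orbit converges to the periodic orbit. -/
theorem tendsto_infDist (h : IsReturnTime f φ γ₀ T ℓ θ r) :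
    ∃ δ > 0, ∀ y, (∀ n, ‖(returnMap φ γ₀ θ)^[n] y‖ ≤ δ) →
      Tendsto (fun n => (returnMap φ γ₀ θ)^[n] y) atTop (𝓝 0) →
      Tendsto (fun t => Metric.infDist (φ t (γ₀ + y)) (flowOrbit φ γ₀)) atTop (𝓝 0) := by
  obtain ⟨δ₁, hδ₁, hδ₁r, hge⟩ := h.exists_time_ge
  obtain ⟨Cθ, hCθ, hθ⟩ := h.time_le
  obtain ⟨K, hK, hKd⟩ := h.flow.exists_dist_le
  have hT := h.time_pos
  refine ⟨δ₁, hδ₁, fun y hy hlim => ?_⟩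
  rw [Metric.tendsto_atTop]
  intro ε hε
  set B := Real.exp (K * (T + Cθ * r)) with hB
  have hBpos : 0 < B := Real.exp_pos _
  obtain ⟨N, hN⟩ := Metric.tendsto_atTop.1 hlim (ε / B) (by positivity)
  refine ⟨returnTimeSum φ γ₀ θ y N, fun t ht => ?_⟩
  have hex : ∃ n, t < returnTimeSum φ γ₀ θ y (n + 1) := by
    obtain ⟨n, hn⟩ := exists_nat_gt (t / (T / 2))
    refine ⟨n, ?_⟩
    rw [div_lt_iff₀ (half_pos hT)] at hn
    have := returnTimeSum_ge hge (y := y) (n := n + 1) fun i _ => hy i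
    push_cast at this
    nlinarith
  classical
  set n := Nat.find hex with hn
  have hn1 : t < returnTimeSum φ γ₀ θ y (n + 1) := Nat.find_spec hex
  have hsucc : ∀ m, returnTimeSum φ γ₀ θ y (m + 1) = returnTimeSum φ γ₀ θ y m +
      θ ((returnMap φ γ₀ θ)^[m] y) := fun m => by rw [returnTimeSum, Finset.sum_range_succ]; rfl
  have hmono : Monotone (returnTimeSum φ γ₀ θ y) := monotone_nat_of_le_succ fun m => by
    rw [hsucc]; linarith [hge _ (hy m)]
  have hNn : N ≤ n := by
    by_contra hlt
    have := hmono (show n + 1 ≤ N by omega)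
    linarith
  have hn2 : returnTimeSum φ γ₀ θ y n ≤ t := by
    rcases Nat.eq_zero_or_pos n with h0 | h0
    · rw [show n = N by omega]; exact ht
    · have := Nat.find_min hex (m := n - 1) (by omega)
      rw [Nat.sub_add_cancel h0] at this
      exact not_lt.1 this
  rw [Real.dist_eq, sub_zero, abs_of_nonneg Metric.infDist_nonneg]
  set s := t - returnTimeSum φ γ₀ θ y n with hs
  have h1 : φ t (γ₀ + y) = φ s (γ₀ + (returnMap φ γ₀ θ)^[n] y) := by
    rw [← h.flow.apply_returnTimeSum, ← h.flow.add, hs, sub_add_cancel]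
  have h2 : |s| ≤ T + Cθ * r := by
    rw [abs_of_nonneg (by linarith)]
    have h3 := (abs_le.1 (hθ _ ((hy n).trans_lt hδ₁r))).2
    have h4 : Cθ * ‖(returnMap φ γ₀ θ)^[n] y‖ ≤ Cθ * r := by
      have := (hy n).trans hδ₁r.le
      gcongr
    rw [hsucc] at hn1
    linarith
  rw [h1]
  refine (Metric.infDist_le_dist_of_mem (mem_range_self s : φ s γ₀ ∈ flowOrbit φ γ₀)).trans_lt ?_
  refine (hKd s _ _).trans_lt ?_
  have h3 := hN n hNn
  rw [dist_zero_right, lt_div_iff₀' hBpos] at h3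
  refine lt_of_le_of_lt ?_ h3
  rw [dist_eq_norm, add_sub_cancel_left, hB]
  gcongr

end IsReturnTime

end HyperbolicReturns

/-! ### From tangent vectors of stable manifolds to bounded linear orbits. -/

section StableDirections

variable {E : Type*} [NormedAddCommGroup E] [NormedSpace ℝ E] {f : E → E} {φ : ℝ → E → E}
  {γ₀ : E} {T r : ℝ} {ℓ : E →L[ℝ] ℝ} {θ : E → ℝ}

/-- `v` is the velocity at `x` of a curve of points that converge to `S` under the flow, uniformly
near `x`. -/
def IsStableDirection (φ : ℝ → E → E) (S : Set E) (x v : E) : Prop :=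
  ∃ c : ℝ → E, c 0 = x ∧ HasDerivAt c v 0 ∧ ∃ U ∈ 𝓝 (0 : ℝ),
    TendstoUniformlyOn (fun t s => Metric.infDist (φ t (c s)) S) (fun _ => 0) atTop U

theorem IsFlow.continuous_field (hφ : IsFlow f φ) : Continuous f := by
  obtain ⟨K, hK⟩ := hφ.lipschitz
  exact hK.continuous

/-- A stable direction gives rise to a curve in the section whose iterated images under the return
map stay in a small neighbourhood of `γ₀` and have bounded velocities. -/
theorem IsReturnTime.exists_bounded_variation [ProperSpace E] (h : IsReturnTime f φ γ₀ T ℓ θ r)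
    (hℓ : ℓ (f γ₀) ≠ 0) (hmin : ∀ s ∈ Ioo 0 T, φ s γ₀ ≠ γ₀) {δ C : ℝ} (hδ : 0 < δ) (hC : 0 ≤ C)
    (hsum : HasReturnSumBound (returnMap φ γ₀ θ) ℓ δ C) {ε₁ : ℝ} (hε₁ : 0 < ε₁) :
    ∃ ε > 0, ∀ y, ℓ y = 0 → ‖y‖ ≤ ε →
      (∀ t, 0 ≤ t → Metric.infDist (φ t (γ₀ + y)) (flowOrbit φ γ₀) ≤ ε) →
      ∀ v, IsStableDirection φ (flowOrbit φ γ₀) (γ₀ + y) v →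
      ∃ (Y : ℝ → E) (a b : ℝ) (w : ℕ → E), Y 0 = y ∧ w 0 = v + a • f (γ₀ + y) ∧
        (∀ n, ‖w n‖ ≤ b) ∧
        (∀ n, HasDerivAt (fun s => (returnMap φ γ₀ θ)^[n] (Y s)) (w n) 0) ∧
        ∀ᶠ s in 𝓝 0, ∀ n, ‖(returnMap φ γ₀ θ)^[n] (Y s)‖ < ε₁ ∧
          ℓ ((returnMap φ γ₀ θ)^[n] (Y s)) = 0 := by
  obtain ⟨δ₀, hδ₀, -, hsmall⟩ := h.exists_returns_small hℓ hmin
  have hr := h.pos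
  set ε₂ := min δ (min ε₁ r) with hε₂
  have hε₂pos : 0 < ε₂ := by positivity
  obtain ⟨δ', hδ', hsmall⟩ := hsmall ε₂ hε₂pos
  have hne : ∀ᶠ y in 𝓝 (0 : E), ℓ (f (γ₀ + y)) ≠ 0 := by
    have hc : Continuous fun y => ℓ (f (γ₀ + y)) :=
      ℓ.continuous.comp (h.flow.continuous_field.comp (continuous_const.add continuous_id))
    exact hc.continuousAt.eventually_ne (by simpa using hℓ)
  obtain ⟨δ₃, hδ₃, hne⟩ := Metric.eventually_nhds_iff.1 hne
  obtain ⟨K, hK, hKd⟩ := h.flow.exists_dist_le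
  refine ⟨min (δ₃ / 2) (min (δ₀ / 2) (δ' / 2)), by positivity, ?_⟩
  rintro y hy hyε hyt v ⟨c, hc0, hcd, U, hU, hunif⟩
  obtain ⟨κ, hκ0, hκ, hκs, -⟩ := h.flow.exists_hitting_time (x₀ := γ₀ + y) (t₀ := 0) (c := γ₀ + y)
    (h.flow.zero _) (hne (by
      rw [dist_zero_right]
      exact (hyε.trans (min_le_left _ _)).trans_lt (half_lt_self hδ₃)))
  obtain ⟨hRc, hRd⟩ := h.flow.hasFDerivAt_hitting hκ
  -- The curve is slid along the flow into the section, which changes its velocity by a multiple of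
  -- the field.
  set Y : ℝ → E := fun s => φ (κ (c s)) (c s) - γ₀ with hY
  have hY0 : Y 0 = y := by simp [hY, hc0, hκ0, h.flow.zero]
  have hYd : HasDerivAt Y (v + fderiv ℝ κ (γ₀ + y) v • f (γ₀ + y)) 0 := by
    have h1 := (hRc.differentiableAt one_ne_zero).hasFDerivAt
    rw [← hc0] at h1
    have h2 := (h1.comp_hasDerivAt (0 : ℝ) hcd).sub_const γ₀
    rw [hc0, hRd, hκ0, h.flow.fderiv_zero_time, h.flow.zero] at h2
    exact h2
  have hYc : Tendsto Y (𝓝 0) (𝓝 y) := by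
    have := hYd.continuousAt.tendsto; rwa [hY0] at this
  have hcc : Tendsto c (𝓝 0) (𝓝 (γ₀ + y)) := by
    have := hcd.continuousAt.tendsto; rwa [hc0] at this
  rw [Metric.tendstoUniformlyOn_iff] at hunif
  obtain ⟨t₁, ht₁⟩ := eventually_atTop.1 (hunif δ' hδ')
  have hκc : Tendsto (fun s => κ (c s)) (𝓝 0) (𝓝 0) := by
    have := hκ.continuousAt.tendsto.comp hcc; rwa [hκ0] at this
  have hgood : ∀ᶠ s in 𝓝 (0 : ℝ), (∀ n, ‖(returnMap φ γ₀ θ)^[n] (Y s)‖ < ε₂) ∧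
      Tendsto (fun n => (returnMap φ γ₀ θ)^[n] (Y s)) atTop (𝓝 0) ∧ ℓ (Y s) = 0 := by
    have e1 : ∀ᶠ s in 𝓝 (0 : ℝ), dist (Y s) y <
        min (δ₀ / 2) (δ' / 2 / Real.exp (K * (|t₁| + 1))) :=
      hYc.eventually (Metric.ball_mem_nhds y (by positivity))
    have e2 : ∀ᶠ s in 𝓝 (0 : ℝ), |κ (c s)| < 1 := by
      filter_upwards [hκc.eventually (Metric.ball_mem_nhds (0 : ℝ) one_pos)] with s hs
      simpa [Real.dist_eq] using hs
    filter_upwards [e1, e2, hcc.eventually hκs, hU] with s h1 h2 h3 h4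
    have h5 : ℓ (Y s) = 0 := by rw [hY]; simp only [map_sub]; rw [h3, map_add, hy]; ring
    have h6 : ‖Y s‖ ≤ δ₀ := by
      have h7 : ‖Y s‖ ≤ ‖y‖ + dist (Y s) y := by
        rw [dist_eq_norm]; exact norm_le_insert' _ _
      have h8 : ‖y‖ ≤ δ₀ / 2 := hyε.trans ((min_le_right _ _).trans (min_le_left _ _))
      linarith [h1.trans_le (min_le_left _ _)]
    have h7 : ∀ t, φ t (γ₀ + Y s) = φ (t + κ (c s)) (c s) := fun t => by
      rw [h.flow.add, hY, add_sub_cancel]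
    -- Late times are controlled by the uniform convergence along the curve, early times by
    -- comparison with the orbit of `y`.
    obtain ⟨h8, h9⟩ := hsmall (Y s) h5 h6 fun t ht => by
      rcases le_total (t₁ + 1) t with h10 | h10
      · rw [h7]
        have := ht₁ (t + κ (c s)) (by linarith [(abs_lt.1 h2).1]) s h4
        rw [dist_comm, Real.dist_eq, sub_zero] at this
        exact (le_abs_self _).trans this.le
      · have h11 := hKd t (γ₀ + Y s) (γ₀ + y)
        have h12 : Metric.infDist (φ t (γ₀ + Y s)) (flowOrbit φ γ₀) ≤
            Metric.infDist (φ t (γ₀ + y)) (flowOrbit φ γ₀) +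
              dist (φ t (γ₀ + Y s)) (φ t (γ₀ + y)) := Metric.infDist_le_infDist_add_dist
        have h13 := (hyt t ht).trans ((min_le_right _ _).trans (min_le_right _ _))
        have h14 : Real.exp (K * |t|) * dist (γ₀ + Y s) (γ₀ + y) ≤ δ' / 2 := by
          rw [dist_add_left]
          have h15 := h1.trans_le (min_le_right _ _)
          rw [lt_div_iff₀' (Real.exp_pos _)] at h15
          refine le_trans ?_ h15.le
          gcongr
          rw [abs_of_nonneg ht]
          linarith [le_abs_self t₁]
        linarith
    refine ⟨h8, h9 ?_, h5⟩
    simp only [h7]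
    have h10 : Tendsto (fun t => Metric.infDist (φ t (c s)) (flowOrbit φ γ₀)) atTop (𝓝 0) := by
      rw [Metric.tendsto_atTop]
      intro e he
      obtain ⟨t₂, ht₂⟩ := eventually_atTop.1 (hunif e he)
      exact ⟨t₂, fun t ht => by rw [dist_comm]; exact ht₂ t ht s h4⟩
    exact h10.comp (tendsto_atTop_add_const_right _ _ tendsto_id)
  obtain ⟨hg1, hg2, -⟩ := hgood.self_of_nhds
  rw [hY0] at hg1 hg2
  have hlt : ε₂ ≤ r := (min_le_right _ _).trans (min_le_right _ _)
  have hder : ∀ n, ∃ w, HasDerivAt (fun s => (returnMap φ γ₀ θ)^[n] (Y s)) w 0 := by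
    intro n
    induction n with
    | zero => exact ⟨_, hYd⟩
    | succ n ih =>
      obtain ⟨w, hw⟩ := ih
      have h1 := (h.hasStrictFDerivAt_returnMap ((hg1 n).trans_le hlt)).hasFDerivAt
      rw [← hY0] at h1
      have h2 := h1.comp_hasDerivAt (0 : ℝ) hw
      refine ⟨_, h2.congr_of_eventuallyEq (Eventually.of_forall fun s => ?_)⟩
      simp only [Function.iterate_succ_apply', Function.comp_apply]
  choose w hw using hder
  obtain ⟨C₁, hC₁⟩ := hYd.differentiableAt.hasFDerivAt.isBigO_sub.bound
  refine ⟨Y, fderiv ℝ κ (γ₀ + y) v, C * |C₁|, w, hY0, (hw 0).unique hYd, fun n => ?_, hw, ?_⟩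
  · refine (hw n).le_of_lip' (by positivity) ?_
    filter_upwards [hgood, hC₁] with s hs hs'
    rw [hY0] at hs' ⊢
    -- As `N → ∞` the distance at the far end vanishes and the sum bound becomes a Lipschitz bound
    -- `C ‖Y s - y‖`, uniform in `n`; it passes to the velocities.
    have h1 : ∀ N ≥ n, ‖(returnMap φ γ₀ θ)^[n] (Y s) - (returnMap φ γ₀ θ)^[n] y‖ ≤
        C * (‖Y s - y‖ + ‖(returnMap φ γ₀ θ)^[N] (Y s) - (returnMap φ γ₀ θ)^[N] y‖) := by
      intro N hN
      refine le_trans ?_ (hsum (Y s) y hs.2.2 hy N (fun m _ => (hs.1 m).le.trans (min_le_left _ _))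
        (fun m _ => (hg1 m).le.trans (min_le_left _ _)))
      exact Finset.single_le_sum
        (f := fun m => ‖(returnMap φ γ₀ θ)^[m] (Y s) - (returnMap φ γ₀ θ)^[m] y‖)
        (fun _ _ => norm_nonneg _) (Finset.mem_range.2 (by omega))
    have h2 : Tendsto (fun N => C * (‖Y s - y‖ + ‖(returnMap φ γ₀ θ)^[N] (Y s) -
        (returnMap φ γ₀ θ)^[N] y‖)) atTop (𝓝 (C * (‖Y s - y‖ + ‖(0 : E) - 0‖))) :=
      ((hs.2.1.sub hg2).norm.const_add _).const_mul _
    have h3 := ge_of_tendsto h2 (eventually_atTop.2 ⟨n, h1⟩)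
    rw [sub_zero, norm_zero, add_zero] at h3
    refine h3.trans ?_
    rw [mul_assoc]
    gcongr
    refine hs'.trans ?_
    gcongr
    exact le_abs_self _
  · filter_upwards [hgood] with s hs n
    exact ⟨(hs.1 n).trans_le ((min_le_right _ _).trans (min_le_left _ _)),
      h.iterate_mem hs.2.2 n fun m _ => (hs.1 m).trans_le hlt⟩

/-- Along a sequence of maps close to `A` there is a bounded orbit that starts transversally to the
kernel of a contracted functional. -/
theorem IsGreenKernel.exists_bounded_transverse [CompleteSpace E] {A : E →L[ℝ] E}
    {Γ : ℤ → E →L[ℝ] E} (hΓ : IsGreenKernel A Γ) {D : E →L[ℝ] ℝ} {μ : ℝ}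
    (hD : ∀ v, D (A v) = μ * D v) (hμ : |μ| < 1) {e : E} (he : D e = 1) :
    ∃ η > 0, ∃ K, 0 ≤ K ∧ ∀ B : ℕ → E →L[ℝ] E, (∀ n, ‖B n - A‖ ≤ η) →
      ∃ w : ℕ → E, (∀ n, ‖w n‖ ≤ K) ∧ (∀ n, w (n + 1) = B n (w n)) ∧ D (w 0) = 1 := by
  obtain ⟨η, hη, K, hK, h⟩ := hΓ.exists_bounded_solution_perturbed
  refine ⟨η, hη, K * ‖e‖, by positivity, fun B hB => ?_⟩
  -- The maps `B` act after time `0` and `A` up to it, with a single source `e` at time `0`.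
  obtain ⟨w, hw1, hw2⟩ := h (fun n => if 0 < n then B (n - 1).toNat else A)
    (fun n => by
      split_ifs
      · exact hB _
      · simpa using hη.le)
    (fun n => if n = 0 then e else 0) ‖e‖ (fun n => by split_ifs <;> simp)
  have hpow : ∀ n : ℕ, D (w 0) = μ ^ n * D (w (-n)) := by
    intro n
    induction n with
    | zero => simp
    | succ n ih =>
      have h1 := hw2 (-((n + 1 : ℕ) : ℤ))
      rw [if_neg (by omega), if_neg (by omega), add_zero,
        show (-((n + 1 : ℕ) : ℤ)) + 1 = -(n : ℤ) by push_cast; ring] at h1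
      rw [ih, h1, hD, pow_succ]
      ring
  -- Running backwards under `A` divides `D` by `μ`; a bounded solution must therefore have `D (w 0)
  -- = 0`, and the source makes `D (w 1) = 1`.
  have h0 : D (w 0) = 0 := by
    have h1 : Tendsto (fun n : ℕ => |μ| ^ n * (‖D‖ * (K * ‖e‖))) atTop (𝓝 (0 * (‖D‖ * (K * ‖e‖)))) :=
      (tendsto_pow_atTop_nhds_zero_of_lt_one (abs_nonneg μ) hμ).mul_const _
    rw [zero_mul] at h1
    have h2 : |D (w 0)| ≤ 0 := ge_of_tendsto' h1 fun n => by
      rw [hpow n, abs_mul, abs_pow]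
      gcongr
      exact (D.le_opNorm _).trans (by gcongr; exact hw1 _)
    exact abs_eq_zero.1 (le_antisymm h2 (abs_nonneg _))
  refine ⟨fun n => w (n + 1), fun n => hw1 _, fun n => ?_, ?_⟩
  · have h1 := hw2 ((n : ℤ) + 1)
    rw [if_pos (by omega), if_neg (by omega), add_zero] at h1
    push_cast
    rw [h1]
    simp
  · have h1 := hw2 0
    simp only [lt_irrefl, if_false, if_true] at h1
    simp only [Nat.cast_zero]
    rw [h1, map_add, hD, h0, mul_zero, zero_add, he]

/-- Dichotomies on the two half-lines glue if bounded orbits from the left and from the right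
together span the space. -/
theorem exists_onto_of_span [CompleteSpace E] {A A' : E →L[ℝ] E} {Γ Γ' : ℤ → E →L[ℝ] E}
    (hΓ : IsGreenKernel A Γ) (hΓ' : IsGreenKernel A' Γ') :
    ∃ η > 0, ∀ D : ℤ → E →L[ℝ] E, (∀ n < 0, ‖D n - A‖ ≤ η) → (∀ n > 0, ‖D n - A'‖ ≤ η) →
      (∀ m : E, ∃ (u v : ℕ → E) (c : ℝ), (∀ n, ‖u n‖ ≤ c) ∧ (∀ n, ‖v n‖ ≤ c) ∧
        (∀ n : ℕ, u (n + 1) = D (n + 1) (u n)) ∧ (∀ n : ℕ, D (-(n + 1)) (v (n + 1)) = v n) ∧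
        D 0 (v 0) + u 0 = m) →
      ∀ (g : ℤ → E) (b : ℝ), (∀ n, ‖g n‖ ≤ b) →
        ∃ (w : ℤ → E) (c : ℝ), (∀ n, ‖w n‖ ≤ c) ∧ ∀ n, w (n + 1) = D n (w n) + g n := by
  obtain ⟨η, hη, K, hK, h⟩ := hΓ.exists_bounded_solution_perturbed
  obtain ⟨η', hη', K', hK', h'⟩ := hΓ'.exists_bounded_solution_perturbed
  refine ⟨min η η', lt_min hη hη', fun D hD hD' hspan g b hg => ?_⟩
  obtain ⟨w, hw1, hw2⟩ := h (fun n => if n < 0 then D n else A) (fun n => by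
      split_ifs with hn
      · exact (hD n hn).trans (min_le_left _ _)
      · simpa using hη.le) g b hg
  obtain ⟨w', hw1', hw2'⟩ := h' (fun n => if 0 < n then D n else A') (fun n => by
      split_ifs with hn
      · exact (hD' n hn).trans (min_le_right _ _)
      · simpa using hη'.le) g b hg
  -- Solve on each half-line, with constant maps on the other one; the mismatch at the step from `0`
  -- to `1` is split into homogeneous bounded orbits from the left and from the right.
  obtain ⟨u, v, c, hu, hv, hu2, hv2, hm⟩ := hspan (w' 1 - D 0 (w 0) - g 0)
  refine ⟨fun n => if 0 < n then w' n - u (n - 1).toNat else w n + v (-n).toNat,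
    max (K * b) (K' * b) + c, fun n => ?_, fun n => ?_⟩
  · dsimp only
    split_ifs
    · exact (norm_sub_le _ _).trans (add_le_add ((hw1' _).trans (le_max_right _ _)) (hu _))
    · exact (norm_add_le _ _).trans (add_le_add ((hw1 _).trans (le_max_left _ _)) (hv _))
  · dsimp only
    rcases lt_trichotomy n 0 with hn | rfl | hn
    · obtain ⟨m, rfl⟩ : ∃ m : ℕ, n = -((m : ℤ) + 1) := ⟨(-n - 1).toNat, by omega⟩
      have h1 := hw2 (-((m : ℤ) + 1))
      rw [if_pos hn] at h1
      rw [if_neg (by omega), if_neg (by omega), h1, map_add,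
        show (-(-((m : ℤ) + 1) + 1)).toNat = m by omega, show (-(-((m : ℤ) + 1))).toNat = m + 1 by omega,
        hv2]
      abel
    · have h2 : w' 1 = D 0 (v 0) + u 0 + (D 0 (w 0) + g 0) := by rw [hm]; abel
      simp [h2]
      abel
    · obtain ⟨m, rfl⟩ : ∃ m : ℕ, n = (m : ℤ) + 1 := ⟨(n - 1).toNat, by omega⟩
      have h1 := hw2' ((m : ℤ) + 1)
      rw [if_pos hn] at h1
      rw [if_pos (by omega), if_pos hn, h1, map_sub,
        show ((m : ℤ) + 1 + 1 - 1).toNat = m + 1 by omega, show ((m : ℤ) + 1 - 1).toNat = m by omega,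
        hu2]
      abel

end StableDirections

/-! ### Connecting orbits as transverse transitions between cycles. -/

section Crossings

variable {E : Type*} [NormedAddCommGroup E] [NormedSpace ℝ E] {f : E → E} {φ : ℝ → E → E}

theorem IsStableDirection.push (hφ : IsFlow f φ) {S : Set E} {x v : E}
    (h : IsStableDirection φ S x v) (s : ℝ) :
    IsStableDirection φ S (φ s x) (fderiv ℝ (φ s) x v) := by
  obtain ⟨c, hc0, hcd, U, hU, hunif⟩ := h
  refine ⟨fun r => φ s (c r), by simp only [hc0], ?_, U, hU, ?_⟩
  · have h1 := hφ.hasFDerivAt_slice s (c 0)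
    rw [← hc0]
    exact h1.comp_hasDerivAt (0 : ℝ) hcd
  · rw [Metric.tendstoUniformlyOn_iff] at hunif ⊢
    intro ε hε
    have h1 : Tendsto (fun t => t + s) atTop atTop := tendsto_atTop_add_const_right _ _ tendsto_id
    filter_upwards [h1.eventually (hunif ε hε)] with t ht r hr
    rw [← hφ.add]
    exact ht r hr

/-- A periodic orbit of a flow, with a section, the times of first return to it in both time
directions, and hyperbolicity of the linearized return map. -/
structure HyperbolicCycle (f : E → E) (φ : ℝ → E → E) where
  base : E
  period : ℝ
  func : E →L[ℝ] ℝ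
  time : E → ℝ
  radius : ℝ
  timeRev : E → ℝ
  radiusRev : ℝ
  kernel : ℤ → E →L[ℝ] E
  isReturnTime : IsReturnTime f φ base period func time radius
  isReturnTime_rev : IsReturnTime (fun x => -f x) (fun t => φ (-t)) base period func timeRev radiusRev
  transverse : func (f base) ≠ 0
  minimal : ∀ s ∈ Ioo 0 period, φ s base ≠ base
  isGreenKernel : IsGreenKernel (fderiv ℝ (returnMap φ base time) 0) kernel

namespace HyperbolicCycle

variable (c : HyperbolicCycle f φ)

/-- The return map. -/
def map : E → E := returnMap φ c.base c.time

/-- The return map of the reversed flow. -/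
def mapRev : E → E := returnMap (fun t => φ (-t)) c.base c.timeRev

/-- The linearized return map. -/
noncomputable def lin : E →L[ℝ] E := fderiv ℝ c.map 0

/-- The points of the cycle. -/
def orbit : Set E := flowOrbit φ c.base

theorem orbit_rev : flowOrbit (fun t => φ (-t)) c.base = c.orbit := by
  ext x
  constructor
  · rintro ⟨t, rfl⟩
    exact ⟨-t, rfl⟩
  · rintro ⟨t, rfl⟩
    exact ⟨-t, by simp⟩

theorem map_zero : c.map 0 = 0 := c.isReturnTime.returnMap_zero

theorem transverse_rev : c.func (-f c.base) ≠ 0 := by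
  rw [map_neg]; exact neg_ne_zero.2 c.transverse

theorem minimal_rev : ∀ s ∈ Ioo 0 c.period, φ (-s) c.base ≠ c.base := by
  intro s hs h
  refine c.minimal s hs ?_
  nth_rw 1 [← h]
  exact c.isReturnTime.flow.apply_neg s _

theorem eventually_map_mapRev : ∀ᶠ y in 𝓝 0, c.func y = 0 → c.map (c.mapRev y) = y :=
  (c.isReturnTime.eventually_reverse c.isReturnTime_rev).mono fun _ hy h => (hy h).2

theorem eventually_mapRev_map : ∀ᶠ y in 𝓝 0, c.func y = 0 → c.mapRev (c.map y) = y := by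
  have h := c.isReturnTime_rev.eventually_reverse (θ' := c.time) (r' := c.radius)
    (by simpa using c.isReturnTime)
  simp only [neg_neg] at h
  exact h.mono fun _ hy h => (hy h).2

end HyperbolicCycle

/-- Initial values of bounded forward orbits of a sequence of linear maps. -/
def boundedForward (D : ℕ → E →L[ℝ] E) : Submodule ℝ E where
  carrier := {x | ∃ (u : ℕ → E) (c : ℝ), u 0 = x ∧ (∀ n, ‖u n‖ ≤ c) ∧ ∀ n, u (n + 1) = D n (u n)}
  zero_mem' := ⟨fun _ => 0, 0, rfl, by simp, by simp⟩
  add_mem' := by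
    rintro _ _ ⟨u, c, rfl, h1, h2⟩ ⟨u', c', rfl, h1', h2'⟩
    exact ⟨fun n => u n + u' n, c + c', rfl, fun n => norm_add_le_of_le (h1 n) (h1' n),
      fun n => by simp only [h2, h2', map_add]⟩
  smul_mem' := by
    rintro a _ ⟨u, c, rfl, h1, h2⟩
    exact ⟨fun n => a • u n, |a| * c, rfl, fun n => by
      rw [norm_smul, Real.norm_eq_abs]; gcongr; exact h1 n, fun n => by simp only [h2, map_smul]⟩

/-- Final values of bounded backward orbits of a sequence of linear maps. -/
def boundedBackward (D : ℕ → E →L[ℝ] E) : Submodule ℝ E where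
  carrier := {x | ∃ (u : ℕ → E) (c : ℝ), u 0 = x ∧ (∀ n, ‖u n‖ ≤ c) ∧ ∀ n, D n (u (n + 1)) = u n}
  zero_mem' := ⟨fun _ => 0, 0, rfl, by simp, by simp⟩
  add_mem' := by
    rintro _ _ ⟨u, c, rfl, h1, h2⟩ ⟨u', c', rfl, h1', h2'⟩
    exact ⟨fun n => u n + u' n, c + c', rfl, fun n => norm_add_le_of_le (h1 n) (h1' n),
      fun n => by simp only [map_add, h2, h2']⟩
  smul_mem' := by
    rintro a _ ⟨u, c, rfl, h1, h2⟩
    exact ⟨fun n => a • u n, |a| * c, rfl, fun n => by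
      rw [norm_smul, Real.norm_eq_abs]; gcongr; exact h1 n, fun n => by simp only [map_smul, h2]⟩

/-- The orbit of `x` connects two cycles; it is cut at its crossings of their sections into an orbit
of the return maps, extended by the transit map from one section to the other. -/
structure Crossing (c c' : HyperbolicCycle f φ) (x : E) (δ : ℝ) where
  depart : ℝ
  arrive : ℝ
  p : ℤ → E
  G : ℤ → E → E
  D : ℤ → E →L[ℝ] E
  transitTime : E → ℝ
  lt : depart < arrive
  isTransition : IsTransition c.map c.lin c'.map c'.lin p G D
  transit : ∀ y, G 0 y = φ (transitTime y) (c.base + y) - c'.base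
  continuousAt : ContinuousAt transitTime (p 0)
  transitTime_eq : transitTime (p 0) = arrive - depart
  depart_eq : φ depart x = c.base + p 0
  arrive_eq : φ arrive x = c'.base + p 1
  depart_mem : c.func (p 0) = 0
  arrive_mem : ∀ᶠ y in 𝓝 (p 0), c'.func (G 0 y) = 0
  norm_lt : ∀ n, ‖p n‖ < δ
  forward : ∀ n : ℕ, p (n + 1) = c'.map^[n] (p 1)
  backward : ∀ n : ℕ, p (-n) = c.mapRev^[n] (p 0)

namespace HyperbolicCycle

/-- By the chain rule the bounded velocities of the iterated curve form an orbit of the linearized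
return maps. The multiple of the field comes from sliding the curve into the section. -/
theorem mem_boundedForward_of_isStableDirection [ProperSpace E] (c : HyperbolicCycle f φ) :
    ∃ ε > 0, ∀ y, c.func y = 0 → ‖y‖ ≤ ε →
      (∀ t, 0 ≤ t → Metric.infDist (φ t (c.base + y)) c.orbit ≤ ε) →
      ∀ v, IsStableDirection φ c.orbit (c.base + y) v →
      ∃ a : ℝ, v + a • f (c.base + y) ∈
        boundedForward fun n => fderiv ℝ c.map (c.map^[n] y) := by
  obtain ⟨δ, hδ, C, hC, hsum⟩ := c.isReturnTime.exists_hasReturnSumBound c.isGreenKernel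
  obtain ⟨ε, hε, h⟩ := c.isReturnTime.exists_bounded_variation c.transverse c.minimal hδ hC hsum
    c.isReturnTime.pos
  refine ⟨ε, hε, fun y hy1 hy2 hy3 v hv => ?_⟩
  obtain ⟨Y, a, b, w, hY0, hw0, hwb, hwd, hY⟩ := h y hy1 hy2 hy3 v hv
  refine ⟨a, w, b, hw0, hwb, fun n => ?_⟩
  have h1 := (c.isReturnTime.hasStrictFDerivAt_returnMap (hY.self_of_nhds n).1).hasFDerivAt
  have h2 := h1.comp_hasDerivAt (0 : ℝ) (hwd n)
  rw [hY0] at h2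
  refine (hwd (n + 1)).unique (h2.congr_of_eventuallyEq (Eventually.of_forall fun s => ?_))
  simp only [Function.iterate_succ_apply', Function.comp_apply]

/-- The bounded velocities are those of the reversed returns; differentiating `map (mapRev y) = y`
along curves in the section shows that `Dmap` carries each one to its predecessor. -/
theorem mem_boundedBackward_of_isStableDirection [ProperSpace E] (c : HyperbolicCycle f φ) :
    ∃ ε > 0, ∀ y, c.func y = 0 → ‖y‖ ≤ ε →
      (∀ t, 0 ≤ t → Metric.infDist (φ (-t) (c.base + y)) c.orbit ≤ ε) →
      ∀ v, IsStableDirection (fun t => φ (-t)) c.orbit (c.base + y) v →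
      ∃ a : ℝ, v + a • f (c.base + y) ∈
        boundedBackward fun n => fderiv ℝ c.map (c.mapRev^[n + 1] y) := by
  obtain ⟨δ, hδ, C, hC, hsum⟩ := c.isReturnTime.exists_hasReturnSumBound_reverse c.isGreenKernel
    c.isReturnTime_rev
  obtain ⟨ε₁, hε₁, hrev⟩ := Metric.eventually_nhds_iff.1 c.eventually_map_mapRev
  have hr := c.isReturnTime.pos
  obtain ⟨ε, hε, h⟩ := c.isReturnTime_rev.exists_bounded_variation c.transverse_rev c.minimal_rev
    hδ hC hsum (lt_min hε₁ hr)
  rw [orbit_rev] at h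
  refine ⟨ε, hε, fun y hy1 hy2 hy3 v hv => ?_⟩
  obtain ⟨Y, a, b, w, hY0, hw0, hwb, hwd, hY⟩ := h y hy1 hy2 hy3 v hv
  refine ⟨-a, w, b, by rw [hw0]; simp, hwb, fun n => ?_⟩
  have h1 := (c.isReturnTime.hasStrictFDerivAt_returnMap
    ((hY.self_of_nhds (n + 1)).1.trans_le (min_le_right _ _))).hasFDerivAt
  have h2 := h1.comp_hasDerivAt (0 : ℝ) (hwd (n + 1))
  rw [hY0] at h2
  refine h2.unique ((hwd n).congr_of_eventuallyEq ?_)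
  filter_upwards [hY] with s hs
  simp only [Function.iterate_succ_apply', Function.comp_apply]
  exact hrev (by rw [dist_zero_right]; exact (hs n).1.trans_le (min_le_left _ _)) (hs n).2

theorem eventually_lin_close (c : HyperbolicCycle f φ) {η : ℝ} (hη : 0 < η) :
    ∃ δ > 0, ∀ y, ‖y‖ < δ → ‖fderiv ℝ c.map y - c.lin‖ ≤ η := by
  have h := c.isReturnTime.tendsto_fderiv_returnMap
  obtain ⟨δ, hδ, hδ'⟩ := Metric.eventually_nhds_iff.1
    (h.eventually (Metric.closedBall_mem_nhds _ hη))
  exact ⟨δ, hδ, fun y hy => by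
    have := hδ' (y := y) (by rwa [dist_zero_right])
    rwa [dist_eq_norm] at this⟩

/-- The orbit is cut where all earlier, respectively later, returns are already small. Bounded
backward orbits pushed through the transit map, together with bounded forward orbits, contain `ker
dH` by transversality. The missing direction is a bounded forward orbit transverse to the level set,
which exists because the return map contracts `dH`. Gluing then gives surjectivity. -/
theorem exists_crossing [ProperSpace E] (c c' : HyperbolicCycle f φ) {x : E}
    (hbot : Tendsto (fun t => Metric.infDist (φ t x) c.orbit) atBot (𝓝 0))
    (htop : Tendsto (fun t => Metric.infDist (φ t x) c'.orbit) atTop (𝓝 0))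
    {dH : E → E →L[ℝ] ℝ} (hdH : ContinuousAt dH c'.base) {μ : ℝ}
    (hlin : ∀ v, dH c'.base (c'.lin v) = μ * dH c'.base v) (hμ : |μ| < 1) (hne : dH c'.base ≠ 0)
    (htrans : ∀ t v, dH (φ t x) v = 0 → ∃ v₁ v₂,
      IsStableDirection (fun t => φ (-t)) c.orbit (φ t x) v₁ ∧
      IsStableDirection φ c'.orbit (φ t x) v₂ ∧ v₁ + v₂ = v)
    {δ : ℝ} (hδ : 0 < δ) : Nonempty (Crossing c c' x δ) := by
  have hφ := c.isReturnTime.flow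
  obtain ⟨e, he⟩ : ∃ e, dH c'.base e = 1 := by
    obtain ⟨e, he⟩ := DFunLike.ne_iff.1 hne
    refine ⟨(dH c'.base e)⁻¹ • e, ?_⟩
    rw [map_smul, smul_eq_mul, inv_mul_cancel₀ (by simpa using he)]
  obtain ⟨η₁, hη₁, K, hK, htrv⟩ := c'.isGreenKernel.exists_bounded_transverse hlin hμ he
  obtain ⟨η₂, hη₂, honto⟩ := exists_onto_of_span c.isGreenKernel c'.isGreenKernel
  obtain ⟨ε₁, hε₁, hfwd⟩ := c'.mem_boundedForward_of_isStableDirection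
  obtain ⟨ε₂, hε₂, hbwd⟩ := c.mem_boundedBackward_of_isStableDirection
  obtain ⟨δ₁, hδ₁, hcl'⟩ := c'.eventually_lin_close (lt_min hη₁ hη₂)
  obtain ⟨δ₂, hδ₂, hcl⟩ := c.eventually_lin_close hη₂
  -- A vector of norm at most `K` on which `dH` at the base point is `1` is not annihilated by a
  -- functional closer than `1 / (K + 1)` to it.
  obtain ⟨δ₃, hδ₃, hdH3⟩ := Metric.eventually_nhds_iff.1
    (hdH.eventually (Metric.ball_mem_nhds _ (show 0 < 1 / (K + 1) by positivity)))
  obtain ⟨δ₄, hδ₄, hrev⟩ := Metric.eventually_nhds_iff.1 c.eventually_map_mapRev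
  obtain ⟨δ₅, hδ₅, htr⟩ : ∃ δ > 0, ∀ y, ‖y‖ < δ → c'.func (f (c'.base + y)) ≠ 0 := by
    have hc : Continuous fun y => c'.func (f (c'.base + y)) :=
      c'.func.continuous.comp (hφ.continuous_field.comp (continuous_const.add continuous_id))
    obtain ⟨δ, hδ, h⟩ := Metric.eventually_nhds_iff.1
      (hc.continuousAt.eventually_ne (x := 0) (by simpa using c'.transverse))
    exact ⟨δ, hδ, fun y hy => h (by rwa [dist_zero_right])⟩
  have hr := c.isReturnTime.pos
  have hr' := c'.isReturnTime.pos
  have hrr := c.isReturnTime_rev.pos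
  -- the point of arrival
  obtain ⟨s₁, hs₁⟩ := eventually_atTop.1 (htop.eventually (gt_mem_nhds hε₁))
  set δ' := min (min δ ε₁) (min (min δ₁ δ₃) (min δ₅ c'.radius)) with hδ'
  obtain ⟨t₁, ht₁, y₁, hxy₁, hy₁, hsm₁, hlim₁⟩ := c'.isReturnTime.exists_section_orbit c'.transverse
    c'.minimal htop (show 0 < δ' by positivity) s₁
  -- the point of departure
  obtain ⟨s₀, hs₀⟩ := eventually_atBot.1 (hbot.eventually (gt_mem_nhds hε₂))
  set δ'' := min (min δ ε₂) (min (min δ₂ δ₄) (min c.radius c.radiusRev)) with hδ''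
  have hbot' : Tendsto (fun t => Metric.infDist (φ (-t) x)
      (flowOrbit (fun t => φ (-t)) c.base)) atTop (𝓝 0) := by
    rw [orbit_rev]; exact hbot.comp tendsto_neg_atTop_atBot
  -- The bound `-t₁ + 1` puts the departure before the arrival.
  obtain ⟨t₀, ht₀, y₀, hxy₀, hy₀, hsm₀, hlim₀⟩ := c.isReturnTime_rev.exists_section_orbit
    c.transverse_rev c.minimal_rev hbot' (show 0 < δ'' by positivity) (max (-s₀) (-t₁ + 1))
  have hs₀' : -t₀ ≤ s₀ := by linarith [(le_max_left _ _).trans ht₀]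
  have htt : -t₀ < t₁ := by linarith [(le_max_right _ _).trans ht₀]
  have hsm₀' : ∀ n, ‖c.mapRev^[n] y₀‖ < δ'' := hsm₀
  have hsm₁' : ∀ n, ‖c'.map^[n] y₁‖ < δ' := hsm₁
  have hmem₀ : ∀ n, c.func (c.mapRev^[n] y₀) = 0 := fun n =>
    c.isReturnTime_rev.iterate_mem hy₀ n fun m _ => (hsm₀' m).trans_le
      ((min_le_right _ _).trans ((min_le_right _ _).trans (min_le_right _ _)))
  have hy₁δ : ‖y₁‖ < δ' := hsm₁' 0
  have hy₀δ : ‖y₀‖ < δ'' := hsm₀' 0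
  have htr₁ : c'.func (f (c'.base + y₁)) ≠ 0 := htr _ (hy₁δ.trans_le
    ((min_le_right _ _).trans ((min_le_right _ _).trans (min_le_left _ _))))
  -- the transit map
  set τ := t₁ - -t₀ with hτ
  have hxx : φ τ (c.base + y₀) = c'.base + y₁ := by
    rw [← hxy₀, ← hxy₁, hτ, ← hφ.add, sub_add_cancel]
  obtain ⟨ζ, hζ0, hζ, hζs, -⟩ := hφ.exists_hitting_time hxx htr₁
  obtain ⟨hQc, hQd⟩ := hφ.hasFDerivAt_hitting hζ
  obtain ⟨-, hQf⟩ := hφ.fderiv_hitting_field hζ hζs (by rw [hζ0, hxx]; exact htr₁)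
  set Q : E → E := fun y => φ (ζ (c.base + y)) (c.base + y) - c'.base with hQ
  have hQ0 : Q y₀ = y₁ := by simp only [hQ, hζ0, hxx, add_sub_cancel_left]
  have hQs : HasStrictFDerivAt Q (fderiv ℝ (fun x => φ (ζ x) x) (c.base + y₀)) y₀ := by
    have h1 := hQc.hasStrictFDerivAt one_ne_zero
    have h2 : HasStrictFDerivAt (fun y => c.base + y) (ContinuousLinearMap.id ℝ E) y₀ :=
      (hasStrictFDerivAt_id y₀).const_add c.base
    exact (h1.comp y₀ h2).sub_const c'.base
  set DQ := fderiv ℝ (fun x => φ (ζ x) x) (c.base + y₀) with hDQ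
  set p : ℤ → E := fun n => if 0 < n then c'.map^[(n - 1).toNat] y₁ else c.mapRev^[(-n).toNat] y₀
    with hp
  have hp1 : ∀ n : ℕ, p (n + 1) = c'.map^[n] y₁ := fun n => by
    simp only [hp]; rw [if_pos (by omega)]; simp
  have hp0 : ∀ n : ℕ, p (-n) = c.mapRev^[n] y₀ := fun n => by
    simp only [hp]; rw [if_neg (by omega)]; simp
  have hpz : p 0 = y₀ := by simpa using hp0 0
  have hpo : p 1 = y₁ := by simpa using hp1 0
  set G : ℤ → E → E := fun n => if n < 0 then c.map else if n = 0 then Q else c'.map with hG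
  set D : ℤ → E →L[ℝ] E := fun n => if n < 0 then fderiv ℝ c.map (p n) else
    if n = 0 then DQ else fderiv ℝ c'.map (p n) with hD
  have hpn : ∀ n : ℤ, (∃ m : ℕ, n = -(m + 1 : ℕ)) ∨ n = 0 ∨ ∃ m : ℕ, n = m + 1 := by
    intro n
    rcases lt_trichotomy n 0 with h | h | h
    · exact Or.inl ⟨(-n - 1).toNat, by omega⟩
    · exact Or.inr (Or.inl h)
    · exact Or.inr (Or.inr ⟨(n - 1).toNat, by omega⟩)
  have hDneg : ∀ m : ℕ, D (-(m + 1 : ℕ)) = fderiv ℝ c.map (c.mapRev^[m + 1] y₀) := fun m => by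
    simp only [hD]; rw [if_pos (by omega), hp0]
  have hDpos : ∀ m : ℕ, D (m + 1) = fderiv ℝ c'.map (c'.map^[m] y₁) := fun m => by
    simp only [hD]; rw [if_neg (by omega), if_neg (by omega), hp1]
  have hDzero : D 0 = DQ := by simp [hD]
  have hGneg : ∀ n < 0, G n = c.map := fun n hn => by simp only [hG]; rw [if_pos hn]
  have hGpos : ∀ n > 0, G n = c'.map := fun n hn => by
    simp only [hG]; rw [if_neg (by omega), if_neg (by omega)]
  have hGzero : G 0 = Q := by simp [hG]
  have hlim1 : Tendsto p atTop (𝓝 0) := by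
    have h1 : Tendsto (fun n : ℤ => (n - 1).toNat) atTop atTop := by
      refine tendsto_atTop.2 fun b => ?_
      filter_upwards [eventually_ge_atTop ((b : ℤ) + 1)] with n hn
      omega
    refine (hlim₁.comp h1).congr' ?_
    filter_upwards [eventually_gt_atTop (0 : ℤ)] with n hn
    simp only [hp, if_pos hn]; rfl
  have hlim0 : Tendsto p atBot (𝓝 0) := by
    have h1 : Tendsto (fun n : ℤ => (-n).toNat) atBot atTop := by
      refine tendsto_atTop.2 fun b => ?_
      filter_upwards [eventually_le_atBot (-(b : ℤ))] with n hn
      omega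
    refine (hlim₀.comp h1).congr' ?_
    filter_upwards [eventually_le_atBot (0 : ℤ)] with n hn
    simp only [hp, if_neg (not_lt.2 hn)]; rfl
  refine ⟨⟨-t₀, t₁, p, G, D, fun y => ζ (c.base + y), htt, ⟨hGneg, hGpos, fun n => ?_, fun n => ?_,
    hlim0, hlim1, ?_, ?_, ?_⟩, fun y => by rw [hGzero], ?_, ?_, ?_, ?_, ?_, ?_, fun n => ?_, ?_, ?_⟩⟩
  · -- step
    rcases hpn n with ⟨m, rfl⟩ | rfl | ⟨m, rfl⟩
    · have h1 : (-((m + 1 : ℕ) : ℤ)) + 1 = -(m : ℤ) := by push_cast; ring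
      rw [hGneg _ (by omega), hp0, h1, hp0, Function.iterate_succ_apply']
      have h2 : dist (c.mapRev^[m] y₀) 0 < δ₄ := by
        rw [dist_zero_right]
        exact (hsm₀' m).trans_le
          ((min_le_right _ _).trans ((min_le_left _ _).trans (min_le_right _ _)))
      exact (hrev h2 (hmem₀ m)).symm
    · rw [hGzero, hpz, hQ0, zero_add, hpo]
    · have h2 := hp1 (m + 1)
      push_cast at h2
      rw [hGpos _ (by omega), h2, hp1, Function.iterate_succ_apply']
  · -- derivative
    rcases hpn n with ⟨m, rfl⟩ | rfl | ⟨m, rfl⟩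
    · rw [hGneg _ (by omega), hp0, hDneg]
      exact c.isReturnTime.hasStrictFDerivAt_returnMap ((hsm₀' _).trans_le
        ((min_le_right _ _).trans ((min_le_right _ _).trans (min_le_left _ _))))
    · rw [hGzero, hpz, hDzero]
      exact hQs
    · rw [hGpos _ (by omega), hp1, hDpos]
      exact c'.isReturnTime.hasStrictFDerivAt_returnMap ((hsm₁' _).trans_le
        ((min_le_right _ _).trans ((min_le_right _ _).trans (min_le_right _ _))))
  · refine (c.isReturnTime.tendsto_fderiv_returnMap.comp hlim0).congr' ?_
    filter_upwards [eventually_lt_atBot (0 : ℤ)] with n hn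
    simp only [hD, if_pos hn]; rfl
  · refine (c'.isReturnTime.tendsto_fderiv_returnMap.comp hlim1).congr' ?_
    filter_upwards [eventually_gt_atTop (0 : ℤ)] with n hn
    simp only [hD]; rw [if_neg (by omega), if_neg (by omega)]; rfl
  · -- onto
    have hclp : ∀ m : ℕ, ‖fderiv ℝ c'.map (c'.map^[m] y₁) - c'.lin‖ ≤ min η₁ η₂ := fun m =>
      hcl' _ ((hsm₁' m).trans_le
        ((min_le_right _ _).trans ((min_le_left _ _).trans (min_le_left _ _))))
    refine honto D (fun n hn => ?_) (fun n hn => ?_) fun m => ?_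
    · obtain ⟨m, rfl⟩ | rfl | ⟨m, rfl⟩ := hpn n
      · rw [hDneg]
        exact hcl _ ((hsm₀' _).trans_le
          ((min_le_right _ _).trans ((min_le_left _ _).trans (min_le_left _ _))))
      · omega
      · omega
    · obtain ⟨m, rfl⟩ | rfl | ⟨m, rfl⟩ := hpn n
      · omega
      · omega
      · rw [hDpos]
        exact (hclp m).trans (min_le_right _ _)
    · set F₁ := boundedForward fun n => fderiv ℝ c'.map (c'.map^[n] y₁) with hF₁
      set F₀ := boundedBackward fun n => fderiv ℝ c.map (c.mapRev^[n + 1] y₀) with hF₀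
      set x₁ := c'.base + y₁ with hx₁
      -- The first return kills the field, so the field starts a bounded forward orbit; this absorbs
      -- the multiples of it produced by sliding.
      have hfx : f x₁ ∈ F₁ := by
        refine ⟨fun n => if n = 0 then f x₁ else 0, ‖f x₁‖, if_pos rfl, fun n => ?_, fun n => ?_⟩
        · dsimp only
          split_ifs <;> simp
        · dsimp only
          rcases Nat.eq_zero_or_pos n with rfl | hn
          · rw [if_neg (by omega), if_pos rfl]
            exact (c'.isReturnTime.fderiv_returnMap (hy₁δ.trans_le ((min_le_right _ _).trans
              ((min_le_right _ _).trans (min_le_right _ _)))) (f x₁)).2.2.symm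
          · rw [if_neg (by omega), if_neg (by omega), _root_.map_zero]
      set W : Submodule ℝ E := F₀.map (DQ : E →ₗ[ℝ] E) ⊔ F₁ with hW
      have hWf : ∀ v (a : ℝ), v + a • f x₁ ∈ W → v ∈ W := fun v a h => by
        have h1 : a • f x₁ ∈ W := Submodule.smul_mem _ _ (Submodule.mem_sup_right hfx)
        simpa using W.sub_mem h h1
      have hs : ∀ v, IsStableDirection φ c'.orbit x₁ v → v ∈ W := by
        intro v hv
        obtain ⟨a, ha⟩ := hfwd y₁ hy₁ (hy₁δ.le.trans ((min_le_left _ _).trans (min_le_right _ _)))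
          (fun t ht => by
            rw [← hx₁, ← hxy₁, ← hφ.add]
            exact (hs₁ _ (by linarith)).le) v hv
        exact hWf v a (Submodule.mem_sup_right ha)
      have hu : ∀ v, IsStableDirection (fun t => φ (-t)) c.orbit x₁ v → v ∈ W := by
        intro v hv
        -- The direction is carried back to the departure point. `DQ` brings it forward again up to
        -- a multiple of the field, and annihilates the field at the departure point.
        have h1 := hv.push hφ.reverse τ
        have h2 : φ (-τ) x₁ = c.base + y₀ := by rw [← hxx, hφ.neg_apply]
        simp only [h2] at h1
        obtain ⟨a, ha⟩ := hbwd y₀ hy₀ (hy₀δ.le.trans ((min_le_left _ _).trans (min_le_right _ _)))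
          (fun t ht => by
            rw [← hxy₀, ← hφ.add]
            exact (hs₀ _ (by linarith)).le) _ h1
        have h3 : DQ (fderiv ℝ (φ (-τ)) x₁ v + a • f (c.base + y₀)) ∈ W :=
          Submodule.mem_sup_left (Submodule.mem_map_of_mem ha)
        rw [map_add, map_smul, hQf, smul_zero, add_zero, hDQ, hQd, hζ0, hxx] at h3
        have h4 : fderiv ℝ (φ τ) (c.base + y₀) (fderiv ℝ (φ (-τ)) x₁ v) = v := by
          have h5 := (hφ.hasFDerivAt_slice τ (φ (-τ) x₁)).comp x₁ (hφ.hasFDerivAt_slice (-τ) x₁)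
          have h6 : φ τ ∘ φ (-τ) = id := funext fun z => hφ.apply_neg τ z
          rw [h6, h2] at h5
          exact congrArg (fun L : E →L[ℝ] E => L v) (h5.unique (hasFDerivAt_id x₁))
        rw [h4] at h3
        exact hWf _ _ h3
      have hker : ∀ v, dH x₁ v = 0 → v ∈ W := by
        intro v hv
        have h := htrans t₁ v
        rw [hxy₁] at h
        obtain ⟨v₁, v₂, h1, h2, rfl⟩ := h hv
        exact W.add_mem (hu _ h1) (hs _ h2)
      obtain ⟨w, hw1, hw2, hw3⟩ := htrv (fun n => fderiv ℝ c'.map (c'.map^[n] y₁))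
        fun n => (hclp n).trans (min_le_left _ _)
      have hwW : w 0 ∈ W := Submodule.mem_sup_right ⟨w, K, rfl, hw1, hw2⟩
      have hdw : dH x₁ (w 0) ≠ 0 := by
        intro h0
        have h1 := hdH3 (y := x₁) (by
          rw [hx₁, dist_eq_norm, add_sub_cancel_left]
          exact hy₁δ.trans_le ((min_le_right _ _).trans ((min_le_left _ _).trans (min_le_right _ _))))
        rw [dist_eq_norm] at h1
        have h2 : (dH x₁ - dH c'.base) (w 0) = -1 := by
          rw [sub_apply, h0, hw3, zero_sub]
        have h3 := (dH x₁ - dH c'.base).le_opNorm (w 0)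
        rw [h2, norm_neg, norm_one] at h3
        have h4 : ‖dH x₁ - dH c'.base‖ * ‖w 0‖ ≤ 1 / (K + 1) * K := by
          gcongr
          exact hw1 0
        have h5 : 1 / (K + 1) * K < 1 := by rw [one_div_mul_eq_div, div_lt_one (by positivity)]; linarith
        linarith
      have hm : m ∈ W := by
        have h1 := hker (m - (dH x₁ m / dH x₁ (w 0)) • w 0) (by
          rw [map_sub, map_smul, smul_eq_mul, div_mul_cancel₀ _ hdw, sub_self])
        simpa using W.add_mem h1 (W.smul_mem (dH x₁ m / dH x₁ (w 0)) hwW)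
      obtain ⟨_, ⟨z, ⟨v, cv, rfl, hv1, hv2⟩, rfl⟩, _, ⟨u, cu, rfl, hu1, hu2⟩, rfl⟩ :=
        Submodule.mem_sup.1 hm
      refine ⟨u, v, max cu cv, fun n => (hu1 n).trans (le_max_left _ _),
        fun n => (hv1 n).trans (le_max_right _ _), fun n => ?_, fun n => ?_, ?_⟩
      · rw [hDpos]; exact hu2 n
      · have := hDneg n
        push_cast at this
        rw [this]; exact hv2 n
      · rw [hDzero]; rfl
  · rw [hpz]
    exact ContinuousAt.comp (g := ζ) (f := fun y => c.base + y) hζ.continuousAt (by fun_prop)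
  · simp only [hpz, hζ0, hτ]
  · rw [hpz]; exact hxy₀
  · rw [hpo]; exact hxy₁
  · rw [hpz]; exact hy₀
  · rw [hpz, hGzero]
    have h1 : Tendsto (fun y => c.base + y) (𝓝 y₀) (𝓝 (c.base + y₀)) :=
      (continuous_const.add continuous_id).tendsto y₀
    filter_upwards [h1.eventually hζs] with y hy
    simp only [hQ, map_sub]
    rw [hy, map_add, hy₁]; ring
  · rcases hpn n with ⟨m, rfl⟩ | rfl | ⟨m, rfl⟩
    · rw [hp0]; exact (hsm₀' _).trans_le ((min_le_left _ _).trans (min_le_left _ _))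
    · rw [hpz]; exact hy₀δ.trans_le ((min_le_left _ _).trans (min_le_left _ _))
    · rw [hp1]; exact (hsm₁' _).trans_le ((min_le_left _ _).trans (min_le_left _ _))
  · rw [hpo]; exact hp1
  · rw [hpz]; exact hp0

end HyperbolicCycle

end Crossings

/-! ### Timing of orbits that follow several crossings. -/

section Itineraries

variable {E : Type*} [NormedAddCommGroup E] [NormedSpace ℝ E] {f : E → E} {φ : ℝ → E → E}

namespace IsReturnTime

variable {γ₀ : E} {T r : ℝ} {ℓ : E →L[ℝ] ℝ} {θ : E → ℝ}

/-- Comparison with the fixed point `0` bounds `∑ ‖P^[n] y‖` by `2Cη` for every number of turns.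
Return times deviate from `T` at most linearly in `‖P^[n] y‖`, so the total drift is small uniformly
in `N`; for infinitely many turns summability gives convergence. -/
theorem exists_shadow (h : IsReturnTime f φ γ₀ T ℓ θ r) {δ C : ℝ} (hδ : 0 < δ) (hC : 0 ≤ C)
    (hsum : HasReturnSumBound (returnMap φ γ₀ θ) ℓ δ C) {ε : ℝ} (hε : 0 < ε) :
    ∃ η > 0, ∀ y, ℓ y = 0 →
      (∀ N : ℕ, (∀ n ≤ N, ‖(returnMap φ γ₀ θ)^[n] y‖ ≤ η) →
        |returnTimeSum φ γ₀ θ y N - N * T| ≤ ε ∧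
        ∀ s ∈ Icc 0 (N * T), ∀ t, |t - s| ≤ η → dist (φ t (γ₀ + y)) (φ s γ₀) < ε) ∧
      ((∀ n, ‖(returnMap φ γ₀ θ)^[n] y‖ ≤ η) →
        Tendsto (fun t => Metric.infDist (φ t (γ₀ + y)) (flowOrbit φ γ₀)) atTop (𝓝 0)) := by
  obtain ⟨C', hC', hw⟩ := h.exists_dist_wind_le
  obtain ⟨δ', hδ', hlim⟩ := h.tendsto_infDist
  have hr := h.pos
  set η := min (min (δ / 2) δ') (min (r / 2) (ε / (2 * ((C' + 1) * (2 + 2 * C))))) with hη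
  have hη0 : 0 < η := by positivity
  have hηδ : η ≤ δ := ((min_le_left _ _).trans (min_le_left _ _)).trans (half_le_self hδ.le)
  have hηr : η < r := ((min_le_right _ _).trans (min_le_left _ _)).trans_lt (half_lt_self hr)
  have hηε : (C' + 1) * (2 + 2 * C) * η < ε := by
    have h1 : η ≤ ε / (2 * ((C' + 1) * (2 + 2 * C))) := (min_le_right _ _).trans (min_le_right _ _)
    rw [le_div_iff₀ (by positivity)] at h1
    nlinarith
  have hz : ∀ n, (returnMap φ γ₀ θ)^[n] 0 = 0 := fun n =>
    Function.iterate_fixed h.returnMap_zero n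
  have hS : ∀ y, ℓ y = 0 → ∀ N : ℕ, (∀ n ≤ N, ‖(returnMap φ γ₀ θ)^[n] y‖ ≤ η) →
      ∑ n ∈ Finset.range (N + 1), ‖(returnMap φ γ₀ θ)^[n] y‖ ≤ C * (2 * η) := by
    intro y hy N hN
    have := hsum y 0 hy (map_zero _) N (fun n hn => (hN n hn).trans hηδ)
      (fun n _ => by rw [hz, norm_zero]; exact hδ.le)
    simp only [hz, sub_zero] at this
    refine this.trans ?_
    have h1 : ‖y‖ ≤ η := hN 0 (Nat.zero_le _)
    have h2 := hN N le_rfl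
    gcongr
    linarith
  refine ⟨η, hη0, fun y hy => ⟨fun N hN => ?_, fun hN => ?_⟩⟩
  · have hS' : ∑ n ∈ Finset.range N, ‖(returnMap φ γ₀ θ)^[n] y‖ ≤ C * (2 * η) := by
      refine le_trans ?_ (hS y hy N hN)
      rw [Finset.sum_range_succ]
      linarith [norm_nonneg ((returnMap φ γ₀ θ)^[N] y)]
    obtain ⟨h1, h2⟩ := hw y N η _ hηr hN hS'
    refine ⟨h1.trans ?_, fun s hs t ht => (h2 s hs t).trans_lt ?_⟩
    · refine le_trans ?_ hηε.le
      have e1 : 0 ≤ C' * η := by positivity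
      have e2 : 0 ≤ C * η := by positivity
      nlinarith
    · have e2 : 0 ≤ C * η := by positivity
      have e3 : C' * (η + C * (2 * η) + |t - s|) ≤ C' * (η + C * (2 * η) + η) := by gcongr
      nlinarith
  · refine hlim y (fun n => (hN n).trans ((min_le_left _ _).trans (min_le_right _ _))) ?_
    have hsm : Summable fun n => ‖(returnMap φ γ₀ θ)^[n] y‖ := by
      refine summable_of_sum_range_le (c := C * (2 * η)) (fun _ => norm_nonneg _) fun N => ?_
      refine le_trans ?_ (hS y hy N fun n _ => hN n)
      rw [Finset.sum_range_succ]
      linarith [norm_nonneg ((returnMap φ γ₀ θ)^[N] y)]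
    exact tendsto_zero_iff_norm_tendsto_zero.2 hsm.tendsto_atTop_zero

end IsReturnTime

namespace HyperbolicCycle

theorem exists_shadow_forward (c : HyperbolicCycle f φ) {ε : ℝ} (hε : 0 < ε) :
    ∃ η > 0, ∀ y, c.func y = 0 →
      (∀ N : ℕ, (∀ n ≤ N, ‖c.map^[n] y‖ ≤ η) →
        |returnTimeSum φ c.base c.time y N - N * c.period| ≤ ε ∧
        ∀ s ∈ Icc 0 (N * c.period), ∀ t, |t - s| ≤ η →
          dist (φ t (c.base + y)) (φ s c.base) < ε) ∧
      ((∀ n, ‖c.map^[n] y‖ ≤ η) →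
        (∀ s ≥ 0, ∀ t, |t - s| ≤ η → dist (φ t (c.base + y)) (φ s c.base) < ε) ∧
        Tendsto (fun t => Metric.infDist (φ t (c.base + y)) c.orbit) atTop (𝓝 0)) := by
  obtain ⟨δ, hδ, C, hC, hsum⟩ := c.isReturnTime.exists_hasReturnSumBound c.isGreenKernel
  obtain ⟨η, hη, h⟩ := c.isReturnTime.exists_shadow hδ hC hsum hε
  refine ⟨η, hη, fun y hy => ⟨(h y hy).1, fun hn => ⟨fun s hs => ?_, (h y hy).2 hn⟩⟩⟩
  obtain ⟨N, hN⟩ := exists_nat_gt (s / c.period)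
  rw [div_lt_iff₀ c.isReturnTime.time_pos] at hN
  exact ((h y hy).1 N fun n _ => hn n).2 s ⟨hs, hN.le⟩

theorem exists_shadow_backward (c : HyperbolicCycle f φ) {ε : ℝ} (hε : 0 < ε) :
    ∃ η > 0, ∀ y, c.func y = 0 → (∀ n, ‖c.mapRev^[n] y‖ ≤ η) →
        (∀ s ≤ 0, dist (φ s (c.base + y)) (φ s c.base) < ε) ∧
        Tendsto (fun t => Metric.infDist (φ t (c.base + y)) c.orbit) atBot (𝓝 0) := by
  obtain ⟨δ, hδ, C, hC, hsum⟩ := c.isReturnTime.exists_hasReturnSumBound_reverse c.isGreenKernel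
    c.isReturnTime_rev
  obtain ⟨η, hη, h⟩ := c.isReturnTime_rev.exists_shadow hδ hC hsum hε
  rw [orbit_rev] at h
  refine ⟨η, hη, fun y hy hn => ⟨fun s hs => ?_, ?_⟩⟩
  · obtain ⟨N, hN⟩ := exists_nat_gt (-s / c.period)
    rw [div_lt_iff₀ c.isReturnTime.time_pos] at hN
    have := ((h y hy).1 N fun n _ => hn n).2 (-s) ⟨by linarith, hN.le⟩ (-s) (by simpa using hη.le)
    simpa using this
  · have := ((h y hy).2 hn).comp tendsto_neg_atBot_atTop
    simpa [Function.comp_def] using this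

end HyperbolicCycle

namespace Crossing

variable {c c' : HyperbolicCycle f φ} {x : E} {δ : ℝ}

theorem map_p_zero (cr : Crossing c c' x δ) : cr.G 0 (cr.p 0) = cr.p 1 := by
  rw [← cr.isTransition.step 0, zero_add]

theorem arrive_mem_one (cr : Crossing c c' x δ) : c'.func (cr.p 1) = 0 := by
  rw [← cr.map_p_zero]; exact cr.arrive_mem.self_of_nhds

end Crossing

/-- The cut-out part of a crossing that lies before the departure and after the arrival shadows the
two cycles. -/
theorem HyperbolicCycle.exists_window (c c' : HyperbolicCycle f φ) {ε : ℝ} (hε : 0 < ε) :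
    ∃ δ > 0, ∀ (x : E) (δ' : ℝ) (cr : Crossing c c' x δ'), δ' ≤ δ →
      (∀ s ≤ 0, dist (φ (cr.depart + s) x) (φ s c.base) < ε) ∧
      (∀ s ≥ 0, dist (φ (cr.arrive + s) x) (φ s c'.base) < ε) := by
  obtain ⟨η, hη, hb⟩ := c.exists_shadow_backward hε
  obtain ⟨η', hη', hf⟩ := c'.exists_shadow_forward hε
  refine ⟨min η η', lt_min hη hη', fun x δ' cr hδ => ⟨fun s hs => ?_, fun s hs => ?_⟩⟩
  · have := (hb (cr.p 0) cr.depart_mem fun n => by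
      rw [← cr.backward]
      exact (cr.norm_lt _).le.trans (hδ.trans (min_le_left _ _))).1 s hs
    rwa [← cr.depart_eq, ← c.isReturnTime.flow.add, add_comm] at this
  · have := ((hf (cr.p 1) cr.arrive_mem_one).2 fun n => by
      rw [← cr.forward]
      exact (cr.norm_lt _).le.trans (hδ.trans (min_le_right _ _))).1 s hs s (by simpa using hη'.le)
    rwa [← cr.arrive_eq, ← c.isReturnTime.flow.add, add_comm] at this

theorem Crossing.eventually_transit {c c' : HyperbolicCycle f φ} {x : E} {δ : ℝ}
    (cr : Crossing c c' x δ) {d ε : ℝ} (hd : 0 < d) (hε : 0 < ε) :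
    ∀ᶠ ρ in 𝓝[>] (0 : ℝ), ∀ y, ‖y - cr.p 0‖ ≤ ρ →
      |cr.transitTime y - (cr.arrive - cr.depart)| ≤ d ∧ c'.func (cr.G 0 y) = 0 ∧
      ∀ s ∈ Icc 0 (cr.arrive - cr.depart),
        dist (φ s (c.base + y)) (φ (cr.depart + s) x) < ε := by
  obtain ⟨K, hK, hKd⟩ := c.isReturnTime.flow.exists_dist_le
  have h1 : ∀ᶠ y in 𝓝 (cr.p 0), |cr.transitTime y - (cr.arrive - cr.depart)| ≤ d := by
    have := cr.continuousAt.eventually (Metric.closedBall_mem_nhds _ hd)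
    filter_upwards [this] with y hy
    rwa [Real.dist_eq, cr.transitTime_eq] at hy
  obtain ⟨r, hr, hr'⟩ := Metric.eventually_nhds_iff.1 (h1.and cr.arrive_mem)
  have hB := Real.exp_pos (K * (cr.arrive - cr.depart))
  filter_upwards [Ioo_mem_nhdsGT (show 0 < min r (ε / Real.exp (K * (cr.arrive - cr.depart))) by
    positivity)] with ρ hρ y hy
  obtain ⟨h2, h3⟩ := hr' (y := y) (by
    rw [dist_eq_norm]; exact hy.trans_lt (hρ.2.trans_le (min_le_left _ _)))
  refine ⟨h2, h3, fun s hs => ?_⟩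
  rw [add_comm cr.depart, c.isReturnTime.flow.add, cr.depart_eq]
  refine (hKd s _ _).trans_lt ?_
  rw [dist_add_left, dist_eq_norm]
  have h4 := hρ.2.trans_le (min_le_right _ _)
  rw [lt_div_iff₀' hB] at h4
  refine lt_of_le_of_lt ?_ h4
  gcongr
  rw [abs_of_nonneg hs.1]; exact hs.2

theorem exists_fin_partialSum {k : ℕ} (D : Fin k → ℝ) :
    ∃ S : Fin (k + 1) → ℝ, S 0 = 0 ∧ ∀ j : Fin k, S j.succ = S j.castSucc + D j := by
  refine ⟨fun i => ∑ m ∈ Finset.range i, if h : m < k then D ⟨m, h⟩ else 0, by simp, fun j => ?_⟩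
  simp [Finset.sum_range_succ]

/-- An orbit that runs through a finite sequence of crossings, separated by small loops around the
cycles. -/
structure IsItinerary {I : Type*} (cyc : I → HyperbolicCycle f φ) {k : ℕ} {V : Fin (k + 1) → I}
    {x : Fin k → E} {δ : ℝ}
    (cr : ∀ j : Fin k, Crossing (cyc (V j.castSucc)) (cyc (V j.succ)) (x j) δ) (ρ η : ℝ)
    (n : Fin k → ℕ) (y : Fin (k + 1) → E) : Prop where
  near : ∀ j : Fin k, ‖y j.castSucc - (cr j).p 0‖ ≤ ρ
  step : ∀ j : Fin k, (cyc (V j.succ)).map^[n j] ((cr j).G 0 (y j.castSucc)) = y j.succ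
  small : ∀ j : Fin k, ∀ m ≤ n j, ‖(cyc (V j.succ)).map^[m] ((cr j).G 0 (y j.castSucc))‖ ≤ η

/-- `S` records the actual times at the sections, `B` the nominal clock of prescribed windows and
whole periods. Each leg adds a bounded error, however many turns it contains, so the two clocks
differ by at most `β` throughout. -/
theorem exists_itinerary_times {I : Type*} [Finite I] (cyc : I → HyperbolicCycle f φ)
    (hφ : IsFlow f φ) {k : ℕ} (V : Fin (k + 1) → I) {ε : ℝ} (hε : 0 < ε) :
    ∃ η > 0, ∃ β > 0, β ≤ ε ∧ ∀ (x : Fin k → E) (δ : ℝ)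
      (cr : ∀ j : Fin k, Crossing (cyc (V j.castSucc)) (cyc (V j.succ)) (x j) δ),
      ∀ᶠ ρ in 𝓝[>] (0 : ℝ), ∀ (n : Fin k → ℕ) (y : Fin (k + 1) → E), IsItinerary cyc cr ρ η n y →
        ∃ S B : Fin (k + 1) → ℝ, S 0 = 0 ∧ B 0 = 0 ∧
          (∀ j : Fin k, B j.succ = B j.castSucc + ((cr j).arrive - (cr j).depart) +
            n j * (cyc (V j.succ)).period) ∧
          (∀ j, |S j - B j| ≤ β) ∧
          (∀ j, φ (S j) ((cyc (V 0)).base + y 0) = (cyc (V j)).base + y j) ∧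
          (∀ j : Fin k, S j.castSucc < S j.succ) ∧
          (∀ j : Fin k, ∀ s ∈ Icc 0 ((cr j).arrive - (cr j).depart),
            dist (φ (B j.castSucc + s) ((cyc (V 0)).base + y 0)) (φ ((cr j).depart + s) (x j)) < ε) ∧
          (∀ j : Fin k, ∀ s ∈ Icc 0 (n j * (cyc (V j.succ)).period), ∀ t,
            |t - (B j.castSucc + ((cr j).arrive - (cr j).depart) + s)| ≤ β →
            dist (φ t ((cyc (V 0)).base + y 0)) (φ s (cyc (V j.succ)).base) < ε) := by
  obtain ⟨L, hL, hLd⟩ := hφ.exists_dist_time_le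
  choose η₁ hη₁ h₁ using fun i => (cyc i).exists_shadow_forward hε
  obtain ⟨η, hη, hηle⟩ : ∃ η > 0, ∀ i, η ≤ η₁ i := by
    rcases isEmpty_or_nonempty I with h | h
    · exact ⟨1, one_pos, fun i => h.elim i⟩
    · obtain ⟨i, hi⟩ := Finite.exists_min η₁
      exact ⟨η₁ i, hη₁ i, hi⟩
  set β := min (min (ε / 2) (η / 3)) (ε / (2 * (L + 1))) with hβ
  have hβ0 : 0 < β := by positivity
  -- Each leg may drift by `2d`, half in transit and half while winding; `k` legs and one more
  -- transit stay below `β`.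
  set d := β / (2 * (k + 1)) with hd
  have hd0 : 0 < d := by positivity
  have hkd : ∀ j : ℕ, j ≤ k → j * (2 * d) + d ≤ β := by
    intro j hj
    have h1 : (j : ℝ) ≤ k := by exact_mod_cast hj
    have h2 : β = (k + 1) * (2 * d) := by rw [hd]; field_simp
    rw [h2]; nlinarith
  choose η₂ hη₂ h₂ using fun i => (cyc i).exists_shadow_forward hd0
  obtain ⟨η', hη', hηle'⟩ : ∃ η > 0, ∀ i, η ≤ η₂ i := by
    rcases isEmpty_or_nonempty I with h | h
    · exact ⟨1, one_pos, fun i => h.elim i⟩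
    · obtain ⟨i, hi⟩ := Finite.exists_min η₂
      exact ⟨η₂ i, hη₂ i, hi⟩
  choose η₃ hη₃ _hr₃ h₃ using fun i => (cyc i).isReturnTime.exists_time_ge
  obtain ⟨η'', hη'', hηle''⟩ : ∃ η > 0, ∀ i, η ≤ η₃ i := by
    rcases isEmpty_or_nonempty I with h | h
    · exact ⟨1, one_pos, fun i => h.elim i⟩
    · obtain ⟨i, hi⟩ := Finite.exists_min η₃
      exact ⟨η₃ i, hη₃ i, hi⟩
  refine ⟨min (min η η') η'', lt_min (lt_min hη hη') hη'', β, hβ0,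
    ((min_le_left _ _).trans (min_le_left _ _)).trans (half_le_self hε.le), fun x δ cr => ?_⟩
  have hτ : ∀ j, 0 < (cr j).arrive - (cr j).depart := fun j => sub_pos.2 (cr j).lt
  -- The second entry of the minimum keeps the perturbed transit time positive.
  have hd' : ∀ j, 0 < min d ((cr j).arrive - (cr j).depart) / 2 := fun j =>
    half_pos (lt_min hd0 (hτ j))
  filter_upwards [eventually_all.2 fun j =>
    (cr j).eventually_transit (hd' j) (half_pos hε)] with ρ hρ n y hy
  set z := (cyc (V 0)).base + y 0 with hz
  set g : Fin k → E := fun j => (cr j).G 0 (y j.castSucc) with hg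
  set dur : Fin k → ℝ := fun j => (cr j).transitTime (y j.castSucc) +
    returnTimeSum φ (cyc (V j.succ)).base (cyc (V j.succ)).time (g j) (n j) with hdur
  obtain ⟨S, hS0, hS⟩ := exists_fin_partialSum dur
  obtain ⟨B, hB0, hB⟩ := exists_fin_partialSum fun j : Fin k =>
    ((cr j).arrive - (cr j).depart) + n j * (cyc (V j.succ)).period
  have htr := fun j => hρ j _ (hy.near j)
  have hsh₁ := fun j => (h₁ _ (g j) (htr j).2.1).1 (n j) fun m hm =>
    (hy.small j m hm).trans (((min_le_left _ _).trans (min_le_left _ _)).trans (hηle _))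
  have hsh₂ := fun j => (h₂ _ (g j) (htr j).2.1).1 (n j) fun m hm =>
    (hy.small j m hm).trans (((min_le_left _ _).trans (min_le_right _ _)).trans (hηle' _))
  have hzd : ∀ j, |(cr j).transitTime (y j.castSucc) - ((cr j).arrive - (cr j).depart)| ≤ d :=
    fun j => (htr j).1.trans (by linarith [min_le_left d ((cr j).arrive - (cr j).depart), hd' j])
  have hdurd : ∀ j, |dur j - (((cr j).arrive - (cr j).depart) +
      n j * (cyc (V j.succ)).period)| ≤ 2 * d := by
    intro j
    have e : dur j - (((cr j).arrive - (cr j).depart) + n j * (cyc (V j.succ)).period) =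
      ((cr j).transitTime (y j.castSucc) - ((cr j).arrive - (cr j).depart)) +
      (returnTimeSum φ (cyc (V j.succ)).base (cyc (V j.succ)).time (g j) (n j) -
        n j * (cyc (V j.succ)).period) := by rw [hdur]; ring
    rw [e]
    refine (abs_add_le _ _).trans ?_
    linarith [hzd j, (hsh₂ j).1]
  have hSB : ∀ j : Fin (k + 1), |S j - B j| ≤ j * (2 * d) := by
    intro j
    induction j using Fin.induction with
    | zero => simp [hS0, hB0]
    | succ j ih =>
      rw [hS, hB, add_sub_add_comm]
      refine (abs_add_le _ _).trans ?_
      have := hdurd j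
      simp only [Fin.val_castSucc] at ih
      simp only [Fin.val_succ]
      push_cast
      linarith
  have hSBβ : ∀ j : Fin (k + 1), |S j - B j| + d ≤ β := fun j =>
    (add_le_add_left (hSB j) d).trans (hkd j (Nat.lt_succ_iff.1 j.2))
  have hgt : ∀ j : Fin k, φ ((cr j).transitTime (y j.castSucc)) ((cyc (V j.castSucc)).base +
      y j.castSucc) = (cyc (V j.succ)).base + g j := by
    intro j
    rw [hg]
    simp only [(cr j).transit, add_sub_cancel]
  have hpos : ∀ j, φ (S j) z = (cyc (V j)).base + y j := by
    intro j
    induction j using Fin.induction with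
    | zero => rw [hS0, hφ.zero]
    | succ j ih =>
      rw [hS, add_comm, hφ.add, ih, hdur]
      simp only
      rw [add_comm, hφ.add, hgt, hφ.apply_returnTimeSum]
      exact congrArg _ (hy.step j)
  refine ⟨S, B, hS0, hB0, fun j => by rw [hB, add_assoc], fun j => ?_, hpos, fun j => ?_,
    fun j s hs => ?_, fun j s hs t ht => ?_⟩
  · linarith [hSBβ j]
  · rw [hS]
    have h1 := (abs_le.1 (htr j).1).1
    have h2 := returnTimeSum_ge (h₃ (V j.succ)) (y := g j) (n := n j) fun m hm =>
      (hy.small j m hm.le).trans ((min_le_right _ _).trans (hηle'' _))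
    have h3 : 0 ≤ n j * ((cyc (V j.succ)).period / 2) := by
      have := (cyc (V j.succ)).isReturnTime.time_pos
      positivity
    have h4 := min_le_right d ((cr j).arrive - (cr j).depart)
    linarith [hτ j]
  · have h1 : φ (B j.castSucc + s) z =
        φ (s + (B j.castSucc - S j.castSucc)) ((cyc (V j.castSucc)).base + y j.castSucc) := by
      rw [← hpos, ← hφ.add]; congr 1; ring
    have h2 := (htr j).2.2 s hs
    have h3 := hLd (s + (B j.castSucc - S j.castSucc)) s
      ((cyc (V j.castSucc)).base + y j.castSucc)
    rw [h1]
    have h4 : L * |s + (B j.castSucc - S j.castSucc) - s| < ε / 2 := by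
      rw [add_sub_cancel_left, abs_sub_comm]
      have h5 := hSBβ j.castSucc
      have h6 : β ≤ ε / (2 * (L + 1)) := min_le_right _ _
      rw [le_div_iff₀ (by positivity)] at h6
      have h7 : L * |S j.castSucc - B j.castSucc| ≤ L * β := by gcongr; linarith
      nlinarith
    linarith [dist_triangle (φ (s + (B j.castSucc - S j.castSucc))
      ((cyc (V j.castSucc)).base + y j.castSucc)) (φ s ((cyc (V j.castSucc)).base + y j.castSucc))
      (φ ((cr j).depart + s) (x j))]
  · have h1 : φ t z = φ (t - S j.castSucc - (cr j).transitTime (y j.castSucc))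
        ((cyc (V j.succ)).base + g j) := by
      rw [← hgt, ← hφ.add, ← hpos, ← hφ.add]; congr 1; ring
    rw [h1]
    refine (hsh₁ j).2 s hs _ (le_trans ?_ (hηle _))
    have h2 : t - S j.castSucc - (cr j).transitTime (y j.castSucc) - s =
        (t - (B j.castSucc + ((cr j).arrive - (cr j).depart) + s)) -
        (S j.castSucc - B j.castSucc) -
        ((cr j).transitTime (y j.castSucc) - ((cr j).arrive - (cr j).depart)) := by ring
    rw [h2]
    have h3 : β ≤ η / 3 := (min_le_left _ _).trans (min_le_right _ _)
    refine (abs_sub _ _).trans ?_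
    have h4 := abs_sub (t - (B j.castSucc + ((cr j).arrive - (cr j).depart) + s))
      (S j.castSucc - B j.castSucc)
    linarith [hSBβ j.castSucc, hzd j]

end Itineraries

/-! ### Cyclic and two-sided chains. -/

section Realization

variable {E : Type*} [NormedAddCommGroup E] [NormedSpace ℝ E] {f : E → E} {φ : ℝ → E → E}

namespace HyperbolicCycle

theorem hasStrictFDerivAt_map (c : HyperbolicCycle f φ) : HasStrictFDerivAt c.map c.lin 0 :=
  c.isReturnTime.hasStrictFDerivAt_returnMap (by simpa using c.isReturnTime.pos)

/-- The constant transition at the fixed point; it fills the two infinite ends of the chain of a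
connecting orbit. -/
theorem isTransition [CompleteSpace E] (c : HyperbolicCycle f φ) :
    IsTransition c.map c.lin c.map c.lin (fun _ => 0) (fun _ => c.map) (fun _ => c.lin) where
  left := fun _ _ => rfl
  right := fun _ _ => rfl
  step := fun _ => c.map_zero.symm
  deriv := fun _ => c.hasStrictFDerivAt_map
  tendsto_bot := tendsto_const_nhds
  tendsto_top := tendsto_const_nhds
  deriv_bot := tendsto_const_nhds
  deriv_top := tendsto_const_nhds
  onto := fun g b hb => by
    obtain ⟨η, hη, K, -, h⟩ := c.isGreenKernel.exists_bounded_solution_perturbed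
    obtain ⟨w, h1, h2⟩ := h (fun _ => c.lin) (fun _ => by
      rw [show c.lin = fderiv ℝ (returnMap φ c.base c.time) 0 from rfl, sub_self, norm_zero]
      exact hη.le) g b hb
    exact ⟨w, K * b, h1, h2⟩

end HyperbolicCycle

theorem iterate_eq_of_step {E : Type*} {P : E → E} {G : ℤ → E → E} {x : ℕ → E} {N : ℕ}
    (hG : ∀ n > 0, G n = P) (hx : ∀ m < N, x (m + 1) = G m (x m)) :
    ∀ m < N, P^[m] (G 0 (x 0)) = x (m + 1) := by
  intro m
  induction m with
  | zero => intro h; simpa using (hx 0 h).symm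
  | succ m ih =>
    intro h
    rw [Function.iterate_succ_apply', ih (by omega), hx (m + 1) h, hG _ (by omega)]

/-- The chain is indexed by `Fin (k + 1)` with rotation as successor. A segment has `N (j + 1) + 1`
steps: the transit along edge `j`, then the turns at its end vertex. -/
theorem exists_periodic_itinerary [CompleteSpace E] {I : Type*} (cyc : I → HyperbolicCycle f φ)
    {k : ℕ} {V : Fin (k + 1 + 1) → I} (hV : V (Fin.last (k + 1)) = V 0) {x : Fin (k + 1) → E} {δ : ℝ}
    (cr : ∀ j : Fin (k + 1), Crossing (cyc (V j.castSucc)) (cyc (V j.succ)) (x j) δ)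
    {ρ : ℝ} (hρ : 0 < ρ) :
    ∃ M : ℕ, ∀ N : Fin (k + 1) → ℕ, (∀ j, M ≤ N j) → ∃ y : Fin (k + 1 + 1) → E,
      y (Fin.last (k + 1)) = y 0 ∧ IsItinerary cyc cr ρ (ρ + δ) (fun j => N (j + 1)) y := by
  obtain ⟨M, hM⟩ := exists_chain_shadow (V := I) (T := Fin (k + 1)) (P := fun i => (cyc i).map)
    (A := fun i => (cyc i).lin) (src := fun j => V j.castSucc) (tgt := fun j => V j.succ)
    (p := fun j => (cr j).p) (G := fun j => (cr j).G) (D := fun j => (cr j).D)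
    (fun i => (cyc i).hasStrictFDerivAt_map) (fun j => (cr j).isTransition) hρ
  refine ⟨M, fun N hN => ?_⟩
  obtain ⟨z, hz1, hz2, hz3, hz4⟩ := hM (J := Fin (k + 1)) (finRotate (k + 1)) id
    (fun j => N (j + 1) + 1) (fun j => by
      simp only [id, finRotate_apply]
      induction j using Fin.lastCases with
      | last => rw [Fin.last_add_one, Fin.succ_last, hV]; rfl
      | cast j => rw [Fin.succ_castSucc, Fin.coeSucc_eq_succ]) (fun j => (hN _).trans (Nat.le_succ _))
  have hit := fun j => iterate_eq_of_step (cr j).isTransition.right (hz1 j)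
  have hsucc : ∀ j : Fin (k + 1), (Fin.snoc (α := fun _ => E) (fun j => z j 0) (z 0 0) :
      Fin (k + 1 + 1) → E) j.succ = z (j + 1) 0 := by
    intro j
    induction j using Fin.lastCases with
    | last => rw [Fin.succ_last, Fin.snoc_last, Fin.last_add_one]
    | cast j => rw [Fin.succ_castSucc, Fin.snoc_castSucc, Fin.coeSucc_eq_succ]
  refine ⟨Fin.snoc (α := fun _ => E) (fun j => z j 0) (z 0 0), ?_, fun j => ?_, fun j => ?_,
    fun j m hm => ?_⟩
  · rw [Fin.snoc_last]
    exact (Fin.snoc_castSucc (α := fun _ => E) (z 0 0) (fun j => z j 0) 0).symm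
  · rw [Fin.snoc_castSucc]
    have := hz3 j 0 (Nat.zero_le _)
    simpa using this
  · rw [Fin.snoc_castSucc, hsucc, hit j _ (Nat.lt_succ_self _), hz2, finRotate_apply]
  · rw [Fin.snoc_castSucc, hit j _ (Nat.lt_succ_of_le hm)]
    rcases le_or_gt (2 * (m + 1)) (N (j + 1) + 1) with h | h
    · have h1 := hz3 j (m + 1) h
      have h2 := (cr j).norm_lt (m + 1 : ℕ)
      simp only [id] at h1
      linarith [norm_le_norm_add_norm_sub' (z j (m + 1)) ((cr j).p (m + 1 : ℕ))]
    · have h1 := hz4 j (m + 1) (Nat.succ_le_succ hm) h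
      simp only [id] at h1
      linarith [norm_le_norm_add_norm_sub' (z j (m + 1)) ((cr (finRotate (k + 1) j)).p
        ((m + 1 : ℕ) - (N (j + 1) + 1 : ℕ))), (cr (finRotate (k + 1) j)).norm_lt
        ((m + 1 : ℕ) - (N (j + 1) + 1 : ℕ))]

/-- The chain is indexed by `ℤ`: the crossings occupy `0, …, k`, and constant transitions at the
first and the last vertex fill the rest. The points before and after the crossings form the backward
and the forward ray. -/
theorem exists_connecting_itinerary [CompleteSpace E] {I : Type*} [Finite I]
    (cyc : I → HyperbolicCycle f φ)
    {k : ℕ} {V : Fin (k + 1 + 1) → I} {x : Fin (k + 1) → E} {δ : ℝ}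
    (cr : ∀ j : Fin (k + 1), Crossing (cyc (V j.castSucc)) (cyc (V j.succ)) (x j) δ)
    {ρ : ℝ} (hρ : 0 < ρ) (hδ : 0 < δ) (hr : ρ + δ < (cyc (V 0)).radius) :
    ∃ M : ℕ, ∀ N : Fin (k + 1) → ℕ, (∀ j : Fin (k + 1), 0 < (j : ℕ) → M ≤ N j) →
      ∃ y : Fin (k + 1 + 1) → E,
      IsItinerary cyc cr ρ (ρ + δ) (Fin.snoc (α := fun _ => ℕ) (fun i : Fin k => N i.succ) 0) y ∧
      (∃ q : ℕ → E, q 0 = y 0 ∧ ∀ n, (cyc (V 0)).map (q (n + 1)) = q n ∧ ‖q n‖ ≤ ρ + δ ∧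
        (cyc (V 0)).func (q n) = 0) ∧
      ∀ m, ‖(cyc (V (Fin.last (k + 1)))).map^[m] (y (Fin.last (k + 1)))‖ ≤ ρ + δ := by
  obtain ⟨M, hM⟩ := exists_chain_shadow (V := I) (T := Fin (k + 1) ⊕ I)
    (P := fun i => (cyc i).map) (A := fun i => (cyc i).lin)
    (src := Sum.elim (fun j => V j.castSucc) id) (tgt := Sum.elim (fun j => V j.succ) id)
    (p := Sum.elim (fun j => (cr j).p) fun _ _ => 0)
    (G := Sum.elim (fun j => (cr j).G) fun i _ => (cyc i).map)
    (D := Sum.elim (fun j => (cr j).D) fun i _ => (cyc i).lin)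
    (fun i => (cyc i).hasStrictFDerivAt_map)
    (fun e => match e with
      | Sum.inl j => (cr j).isTransition
      | Sum.inr i => (cyc i).isTransition) hρ
  refine ⟨max M 2, fun N hN => ?_⟩
  set e : ℤ → Fin (k + 1) ⊕ I := fun j => if h : 0 ≤ j ∧ j < k + 1 then Sum.inl ⟨j.toNat, by omega⟩
    else if j < 0 then Sum.inr (V 0) else Sum.inr (V (Fin.last (k + 1))) with he
  have he_in : ∀ j : Fin (k + 1), e j = Sum.inl j := fun j => by
    simp only [he]
    rw [dif_pos ⟨by omega, by have := j.2; omega⟩]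
    congr 1
  have he_neg : ∀ j < 0, e j = Sum.inr (V 0) := fun j hj => by
    simp only [he]
    rw [dif_neg (by omega), if_pos hj]
  have he_pos : ∀ j : ℤ, k + 1 ≤ j → e j = Sum.inr (V (Fin.last (k + 1))) := fun j hj => by
    simp only [he]
    rw [dif_neg (by omega), if_neg (by omega)]
  set len : ℤ → ℕ := fun j => if h : 0 ≤ j ∧ j < k then N ⟨j.toNat + 1, by omega⟩ + 1 else max M 2
    with hlen
  have hlen_in : ∀ j : Fin k, len j = N j.succ + 1 := fun j => by
    simp only [hlen]
    rw [dif_pos ⟨by omega, by have := j.2; omega⟩]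
    congr 1
  have hlenM : ∀ j, max M 2 ≤ len j := fun j => by
    simp only [hlen]
    split_ifs with h
    · exact (hN _ (Nat.succ_pos _)).trans (Nat.le_succ _)
    · exact le_rfl
  obtain ⟨z, hz1, hz2, hz3, hz4⟩ := hM (J := ℤ) (Equiv.addRight 1) e len (fun j => by
      simp only [Equiv.coe_addRight]
      rcases lt_trichotomy j (-1) with h | rfl | h
      · rw [he_neg _ (by omega), he_neg _ (by omega)]; rfl
      · have := he_in 0
        simp only [Fin.val_zero, Nat.cast_zero] at this
        rw [he_neg _ (by omega), neg_add_cancel, this]; rfl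
      · rcases lt_trichotomy j k with h' | rfl | h'
        · have h1 := he_in ⟨j.toNat, by omega⟩
          have h2 := he_in ⟨j.toNat + 1, by omega⟩
          simp only [Nat.cast_add, Nat.cast_one] at h1 h2
          rw [Int.toNat_of_nonneg (by omega)] at h1 h2
          rw [h1, h2]; rfl
        · have h1 := he_in (Fin.last k)
          simp only [Fin.val_last] at h1
          rw [h1, he_pos _ (by omega)]; rfl
        · rw [he_pos _ (by omega), he_pos _ (by omega)]; rfl)
    (fun j => (le_max_left _ _).trans (hlenM j))
  simp only [Equiv.coe_addRight] at hz2 hz4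
  have hp : ∀ (e : Fin (k + 1) ⊕ I) (n : ℤ), ‖(Sum.elim (fun j => (cr j).p) fun _ _ => 0 :
      Fin (k + 1) ⊕ I → ℤ → E) e n‖ < δ := by
    rintro (j | i) n
    · exact (cr j).norm_lt n
    · simpa using hδ
  have hsmall : ∀ j, ∀ m ≤ len j, ‖z j m‖ ≤ ρ + δ := by
    intro j m hm
    rcases le_or_gt (2 * m) (len j) with h | h
    · linarith [hz3 j m h, hp (e j) m, norm_le_norm_add_norm_sub' (z j m)
        ((Sum.elim (fun j => (cr j).p) fun _ _ => 0 : Fin (k + 1) ⊕ I → ℤ → E) (e j) m)]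
    · linarith [hz4 j m hm h, hp (e (j + 1)) (m - len j), norm_le_norm_add_norm_sub' (z j m)
        ((Sum.elim (fun j => (cr j).p) fun _ _ => 0 : Fin (k + 1) ⊕ I → ℤ → E) (e (j + 1))
          (m - len j))]
  have hstep_in : ∀ j : Fin (k + 1), ∀ m < len j, z j (m + 1) = (cr j).G m (z j m) := by
    intro j m hm
    rw [hz1 j m hm, he_in]; rfl
  have hit := fun j : Fin (k + 1) => iterate_eq_of_step (cr j).isTransition.right (hstep_in j)
  have hlen2 : ∀ j, 2 ≤ len j := fun j => (le_max_right _ _).trans (hlenM j)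
  -- The last point is taken right after the last transit, one step into segment `k`; accordingly
  -- the last number of turns is `0`.
  set y : Fin (k + 1 + 1) → E := Fin.snoc (α := fun _ => E) (fun j => z j 0) (z k 1) with hy
  have hyc : ∀ j : Fin (k + 1), y j.castSucc = z j 0 := fun j => by rw [hy, Fin.snoc_castSucc]
  have hylast : y (Fin.last (k + 1)) = z k 1 := by rw [hy, Fin.snoc_last]
  have hlt : ∀ j : Fin (k + 1), (Fin.snoc (α := fun _ => ℕ) (fun i : Fin k => N i.succ) 0 :
      Fin (k + 1) → ℕ) j < len j := by
    intro j
    induction j using Fin.lastCases with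
    | last => rw [Fin.snoc_last]; have := hlen2 (Fin.last k : Fin (k + 1)); omega
    | cast j => rw [Fin.snoc_castSucc, Fin.val_castSucc, hlen_in]; omega
  refine ⟨y, ⟨fun j => ?_, fun j => ?_, fun j m hm => ?_⟩, ?_, fun m => ?_⟩
  · rw [hyc]
    have := hz3 j 0 (Nat.zero_le _)
    rw [he_in] at this
    simpa using this
  · rw [hyc, hit j _ (hlt j)]
    induction j using Fin.lastCases with
    | last => rw [Fin.snoc_last, Fin.succ_last, hylast]; rfl
    | cast j =>
      have := hz2 j
      rw [hlen_in] at this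
      rw [Fin.snoc_castSucc, Fin.succ_castSucc, hyc, Fin.val_castSucc, this]
      simp
  · rw [hyc, hit j _ (hm.trans_lt (hlt j))]
    exact hsmall _ _ (hm.trans_lt (hlt j))
  · -- the backward ray
    set S : Set E := {w | ∃ (j : ℤ) (m : ℕ), j ≤ 0 ∧ (j = 0 → m = 0) ∧ m ≤ len j ∧ w = z j m} with hS
    have hSn : ∀ w ∈ S, ‖w‖ ≤ ρ + δ := by
      rintro _ ⟨j, m, -, -, hm, rfl⟩
      exact hsmall j m hm
    -- Stepping back within a segment, or into the end of the preceding one, stays in `S`; choosing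
    -- such preimages gives a backward orbit without inverting the map.
    have hpre : ∀ w : S, ∃ w' : S, (cyc (V 0)).map w' = w := by
      rintro ⟨_, j, m, hj, hj0, hm, rfl⟩
      rcases Nat.eq_zero_or_pos m with rfl | hm0
      · have h1 := hz2 (j - 1)
        rw [sub_add_cancel] at h1
        have h2 := hlen2 (j - 1)
        refine ⟨⟨z (j - 1) (len (j - 1) - 1), j - 1, len (j - 1) - 1, by omega, by omega, by omega,
          rfl⟩, ?_⟩
        have h3 := hz1 (j - 1) (len (j - 1) - 1) (by omega)
        rw [he_neg _ (by omega), Nat.sub_add_cancel (by omega), h1] at h3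
        exact h3.symm
      · have hj' : j < 0 := by omega
        refine ⟨⟨z j (m - 1), j, m - 1, hj, by omega, by omega, rfl⟩, ?_⟩
        have h3 := hz1 j (m - 1) (by omega)
        rw [he_neg _ hj', Nat.sub_add_cancel hm0] at h3
        exact h3.symm
    choose g hg using hpre
    have h0 : y 0 ∈ S := ⟨0, 0, le_rfl, fun _ => rfl, Nat.zero_le _, hyc 0⟩
    refine ⟨fun n => (g^[n] ⟨y 0, h0⟩ : S), rfl, fun n => ?_⟩
    have h1 : (cyc (V 0)).map (g^[n + 1] ⟨y 0, h0⟩ : S) = (g^[n] ⟨y 0, h0⟩ : S) := by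
      rw [Function.iterate_succ_apply']; exact hg _
    refine ⟨h1, hSn _ (Subtype.mem _), ?_⟩
    simp only
    rw [← h1]
    exact (cyc (V 0)).isReturnTime.mem _ ((hSn _ (Subtype.mem _)).trans_lt hr)
  · -- the forward ray
    have key : ∀ m, ∃ (j : ℤ) (m' : ℕ), k ≤ j ∧ (j = k → 1 ≤ m') ∧ m' ≤ len j ∧
        (cyc (V (Fin.last (k + 1)))).map^[m] (y (Fin.last (k + 1))) = z j m' := by
      intro m
      induction m with
      | zero => exact ⟨k, 1, le_rfl, fun _ => le_rfl, by have := hlen2 k; omega, hylast⟩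
      | succ m ih =>
        obtain ⟨j, m', hj, hj0, hm, h1⟩ := ih
        rw [Function.iterate_succ_apply', h1]
        rcases hm.eq_or_lt with rfl | hm
        · refine ⟨j + 1, 1, by omega, by omega, by have := hlen2 (j + 1); omega, ?_⟩
          rw [hz2, hz1 (j + 1) 0 (by have := hlen2 (j + 1); omega), he_pos _ (by omega)]
          rfl
        · refine ⟨j, m' + 1, hj, by omega, hm, ?_⟩
          rcases hj.eq_or_lt with rfl | hj
          · have h2 := hstep_in (Fin.last k) m' hm
            rw [(cr (Fin.last k)).isTransition.right _ (by have := hj0 rfl; omega)] at h2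
            exact h2.symm
          · rw [hz1 j m' hm, he_pos _ (by omega)]
            rfl
    obtain ⟨j, m', -, -, hm, h⟩ := key m
    rw [h]
    exact hsmall j m' hm

end Realization

/-! ### Orbits with prescribed itineraries. -/

section ShadowingOrbits

variable {E : Type*} [NormedAddCommGroup E] [NormedSpace ℝ E] {f : E → E} {φ : ℝ → E → E}

theorem IsItinerary.mono {I : Type*} {cyc : I → HyperbolicCycle f φ} {k : ℕ} {V : Fin (k + 1) → I}
    {x : Fin k → E} {δ : ℝ}
    {cr : ∀ j : Fin k, Crossing (cyc (V j.castSucc)) (cyc (V j.succ)) (x j) δ} {ρ η η' : ℝ}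
    {n : Fin k → ℕ} {y : Fin (k + 1) → E} (h : IsItinerary cyc cr ρ η n y) (hη : η ≤ η') :
    IsItinerary cyc cr ρ η' n y :=
  ⟨h.near, h.step, fun j m hm => (h.small j m hm).trans hη⟩

/-- On the section the reversed return map undoes the return map, so a small backward orbit in the
section is the orbit of its end point under `mapRev`. -/
theorem HyperbolicCycle.iterate_mapRev_eq (c : HyperbolicCycle f φ) :
    ∃ η > 0, ∀ q : ℕ → E, (∀ n, c.map (q (n + 1)) = q n ∧ ‖q n‖ ≤ η ∧ c.func (q n) = 0) →
      ∀ n, c.mapRev^[n] (q 0) = q n := by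
  obtain ⟨η, hη, h⟩ := Metric.eventually_nhds_iff.1 c.eventually_mapRev_map
  refine ⟨η / 2, half_pos hη, fun q hq n => ?_⟩
  induction n with
  | zero => rfl
  | succ n ih =>
    rw [Function.iterate_succ_apply', ih, ← (hq n).1]
    exact h (by rw [dist_zero_right]; exact (hq (n + 1)).2.1.trans_lt (half_lt_self hη)) (hq (n + 1)).2.2

/-- A lower bound for finitely many positive numbers. -/
theorem exists_pos_le {ι : Type*} [Finite ι] (g : ι → ℝ) (hg : ∀ i, 0 < g i) :
    ∃ η > 0, ∀ i, η ≤ g i := by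
  rcases isEmpty_or_nonempty ι with h | h
  · exact ⟨1, one_pos, fun i => h.elim i⟩
  · obtain ⟨i, hi⟩ := Finite.exists_min g
    exact ⟨g i, hg i, hi⟩

/-- Orbits with prescribed numbers of loops around hyperbolic cycles, between excursions along
given transverse connections. -/
theorem exists_shadowing_orbits [ProperSpace E] (hφ : IsFlow f φ) {I : Type*} [Finite I]
    (cyc : I → HyperbolicCycle f φ) {k : ℕ} (V : Fin (k + 1 + 1) → I) {ε : ℝ} (hε : 0 < ε) :
    ∃ δ > 0, ∀ (x : Fin (k + 1) → E)
      (cr : ∀ j : Fin (k + 1), Crossing (cyc (V j.castSucc)) (cyc (V j.succ)) (x j) δ),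
      (∀ j, (∀ s ≤ 0, dist (φ ((cr j).depart + s) (x j)) (φ s (cyc (V j.castSucc)).base) < ε) ∧
        (∀ s ≥ 0, dist (φ ((cr j).arrive + s) (x j)) (φ s (cyc (V j.succ)).base) < ε)) ∧
      ∀ ε' > 0, ∃ M : ℕ, 1 ≤ M ∧
        (∀ N : Fin (k + 1) → ℕ, (∀ j : Fin (k + 1), 0 < (j : ℕ) → M ≤ N j) →
          ∃ (z : E) (a : Fin (k + 1 + 1) → ℝ) (b : Fin (k + 1) → ℝ),
            Tendsto (fun t => Metric.infDist (φ t z) (cyc (V 0)).orbit) atBot (𝓝 0) ∧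
            Tendsto (fun t => Metric.infDist (φ t z) (cyc (V (Fin.last (k + 1)))).orbit)
              atTop (𝓝 0) ∧
            (∃ t, dist (φ t z) (φ (cr 0).depart (x 0)) < ε') ∧
            (∃ t, dist (φ t z) (φ (cr (Fin.last k)).arrive (x (Fin.last k))) < ε') ∧
            (∀ s ≤ 0, dist (φ (b 0 + s) z) (φ s (cyc (V 0)).base) < ε) ∧
            (∀ j, a j.succ = b j + ((cr j).arrive - (cr j).depart) ∧
              ∀ s ∈ Icc 0 ((cr j).arrive - (cr j).depart),
                dist (φ (b j + s) z) (φ ((cr j).depart + s) (x j)) < ε) ∧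
            (∀ j : Fin (k + 1), 0 < (j : ℕ) →
              b j = a j.castSucc + N j * (cyc (V j.castSucc)).period ∧
              ∀ s ∈ Icc 0 (N j * (cyc (V j.castSucc)).period),
                dist (φ (a j.castSucc + s) z) (φ s (cyc (V j.castSucc)).base) < ε) ∧
            (∀ s ≥ 0, dist (φ (a (Fin.last (k + 1)) + s) z)
              (φ s (cyc (V (Fin.last (k + 1)))).base) < ε)) ∧
        (V (Fin.last (k + 1)) = V 0 → ∀ N : Fin (k + 1) → ℕ, (∀ j, M ≤ N j) →
          ∃ (z : E) (P : ℝ) (a : Fin (k + 1 + 1) → ℝ) (b : Fin (k + 1) → ℝ), 0 < P ∧ φ P z = z ∧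
            (∀ j, a j.succ = b j + ((cr j).arrive - (cr j).depart) ∧
              ∀ s ∈ Icc 0 ((cr j).arrive - (cr j).depart),
                dist (φ (b j + s) z) (φ ((cr j).depart + s) (x j)) < ε) ∧
            (∀ j : Fin (k + 1), b j = a j.castSucc + N j * (cyc (V j.castSucc)).period ∧
              ∀ s ∈ Icc 0 (N j * (cyc (V j.castSucc)).period),
                dist (φ (a j.castSucc + s) z) (φ s (cyc (V j.castSucc)).base) < ε) ∧
            |P - (a (Fin.last (k + 1)) - a 0)| < ε) := by
  obtain ⟨ηf, hηf, hfw⟩ := (cyc (V (Fin.last (k + 1)))).exists_shadow_forward hε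
  obtain ⟨ηb, hηb, hbw⟩ := (cyc (V 0)).exists_shadow_backward hε
  obtain ⟨ηr, hηr, hrev⟩ := (cyc (V 0)).iterate_mapRev_eq
  obtain ⟨η, hη, β, hβ, hβε, htimes⟩ := exists_itinerary_times cyc hφ V
    (show 0 < min (ε / 2) ηf by positivity)
  choose δw hδw hwin using fun j : Fin (k + 1) =>
    (cyc (V j.castSucc)).exists_window (cyc (V j.succ)) hε
  obtain ⟨δ₁, hδ₁, hδ₁le⟩ := exists_pos_le δw hδw
  have hrad := (cyc (V 0)).isReturnTime.pos
  set m := min (min (min ηf ηb) (min ηr η)) (min δ₁ (cyc (V 0)).radius) with hm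
  have hm0 : 0 < m := by positivity
  have hmf : m ≤ ηf := (min_le_left _ _).trans ((min_le_left _ _).trans (min_le_left _ _))
  have hmb : m ≤ ηb := (min_le_left _ _).trans ((min_le_left _ _).trans (min_le_right _ _))
  have hmr : m ≤ ηr := (min_le_left _ _).trans ((min_le_right _ _).trans (min_le_left _ _))
  have hmη : m ≤ η := (min_le_left _ _).trans ((min_le_right _ _).trans (min_le_right _ _))
  have hmd : m ≤ δ₁ := (min_le_right _ _).trans (min_le_left _ _)
  have hmrad : m ≤ (cyc (V 0)).radius := (min_le_right _ _).trans (min_le_right _ _)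
  refine ⟨m / 3, by positivity, fun x cr => ⟨fun j => hwin j (x j) _ (cr j) (by
    linarith [hδ₁le j]), fun ε' hε' => ?_⟩⟩
  have hG : ∀ᶠ ρ in 𝓝[>] (0 : ℝ), ∀ y, ‖y - (cr (Fin.last k)).p 0‖ ≤ ρ →
      (cyc (V (Fin.last (k + 1)))).func ((cr (Fin.last k)).G 0 y) = 0 ∧
      dist ((cr (Fin.last k)).G 0 y) ((cr (Fin.last k)).p 1) < ε' := by
    have h1 := ((cr (Fin.last k)).isTransition.deriv 0).continuousAt
    have h2 := h1.eventually (Metric.ball_mem_nhds _ hε')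
    rw [(cr (Fin.last k)).map_p_zero] at h2
    obtain ⟨r, hr, h3⟩ := Metric.eventually_nhds_iff.1 ((cr (Fin.last k)).arrive_mem.and h2)
    filter_upwards [Ioo_mem_nhdsGT hr] with ρ hρ y hy
    exact h3 (by rw [dist_eq_norm]; exact hy.trans_lt hρ.2)
  obtain ⟨ρ, ⟨⟨hρt, hρG⟩, hρ0⟩, hρm⟩ := (((htimes x _ cr).and hG).and
    (Ioo_mem_nhdsGT (lt_min (show 0 < m / 3 by positivity) hε'))).and self_mem_nhdsWithin |>.exists
  have hρ : 0 < ρ := hρm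
  have hρ3 : ρ < m / 3 := hρ0.2.trans_le (min_le_left _ _)
  have hρε : ρ < ε' := hρ0.2.trans_le (min_le_right _ _)
  have hρm' : ρ + m / 3 < m := by linarith
  obtain ⟨M₁, hM₁⟩ := exists_connecting_itinerary cyc cr hρ (by positivity) (hρm'.trans_le hmrad)
  have hpart2 : ∃ M₂ : ℕ, V (Fin.last (k + 1)) = V 0 → ∀ N : Fin (k + 1) → ℕ, (∀ j, M₂ ≤ N j) →
      ∃ y : Fin (k + 1 + 1) → E, y (Fin.last (k + 1)) = y 0 ∧
        IsItinerary cyc cr ρ (ρ + m / 3) (fun j => N (j + 1)) y := by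
    by_cases hV : V (Fin.last (k + 1)) = V 0
    · obtain ⟨M, hM⟩ := exists_periodic_itinerary cyc hV cr hρ
      exact ⟨M, fun _ => hM⟩
    · exact ⟨0, fun h => absurd h hV⟩
  obtain ⟨M₂, hM₂⟩ := hpart2
  have hε2 : min (ε / 2) ηf < ε := (min_le_left _ _).trans_lt (half_lt_self hε)
  have hcl : ∀ (c : ℝ) (g : Fin (k + 1) → ℝ),
      (Fin.cons (α := fun _ => ℝ) c g : Fin (k + 1 + 1) → ℝ) (Fin.last (k + 1)) = g (Fin.last k) :=
    fun _ _ => rfl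
  refine ⟨max (max M₁ M₂) 1, le_max_right _ _, fun N hN => ?_, fun hV N hN => ?_⟩
  · obtain ⟨y, hy, ⟨q, hq0, hq⟩, hyf⟩ := hM₁ N fun j hj =>
      ((le_max_left _ _).trans (le_max_left _ _)).trans (hN j hj)
    obtain ⟨S, B, hS0, hB0, hB, hSB, hSz, -, hfol, hwind⟩ := hρt _ y (hy.mono (hρm'.le.trans hmη))
    set z := (cyc (V 0)).base + y 0 with hz
    have hqr : ∀ n, (cyc (V 0)).mapRev^[n] (y 0) = q n := fun n => by
      rw [← hq0]
      exact hrev q (fun n => ⟨(hq n).1, (hq n).2.1.trans (hρm'.le.trans hmr), (hq n).2.2⟩) n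
    obtain ⟨hb1, hb2⟩ := hbw (y 0) (by rw [← hq0]; exact (hq 0).2.2) fun n => by
      rw [hqr]; exact (hq n).2.1.trans (hρm'.le.trans hmb)
    have hlast : y (Fin.last (k + 1)) = (cr (Fin.last k)).G 0 (y (Fin.last k).castSucc) := by
      have := hy.step (Fin.last k)
      rw [Fin.snoc_last] at this
      exact this.symm
    obtain ⟨hl1, hl2⟩ := hρG _ (hy.near (Fin.last k))
    rw [← hlast] at hl1 hl2
    obtain ⟨hf1, hf2⟩ := (hfw _ hl1).2 fun n => (hyf n).trans (hρm'.le.trans hmf)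
    have hBl : B (Fin.last (k + 1)) = B (Fin.last k).castSucc +
        ((cr (Fin.last k)).arrive - (cr (Fin.last k)).depart) := by
      have := hB (Fin.last k)
      rw [Fin.snoc_last, Nat.cast_zero, zero_mul, add_zero] at this
      exact this
    have hφl : ∀ t, φ t z = φ (t - S (Fin.last (k + 1)))
        ((cyc (V (Fin.last (k + 1)))).base + y (Fin.last (k + 1))) := fun t => by
      rw [← hSz, ← hφ.add, sub_add_cancel]
    refine ⟨z, Fin.cons 0 fun j => B j.castSucc + ((cr j).arrive - (cr j).depart),
      fun j => B j.castSucc, hb2, ?_, ⟨0, ?_⟩, ⟨S (Fin.last (k + 1)), ?_⟩, fun s hs => ?_,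
      fun j => ⟨by rw [Fin.cons_succ], fun s hs => (hfol j s hs).trans hε2⟩, fun j hj => ?_,
      fun s hs => ?_⟩
    · simp only [hφl]
      exact hf2.comp (tendsto_atTop_add_const_right _ _ tendsto_id)
    · rw [hφ.zero, (cr 0).depart_eq, hz]
      have := hy.near 0
      simp only [Fin.castSucc_zero] at this ⊢
      rw [dist_add_left, dist_eq_norm]
      exact this.trans_lt hρε
    · rw [hSz, (cr (Fin.last k)).arrive_eq]
      exact (dist_add_left _ _ _).trans_lt hl2
    · simp only [Fin.castSucc_zero, hB0, zero_add]
      exact hb1 s hs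
    · obtain ⟨i, rfl⟩ := Fin.exists_succ_eq.2 (show j ≠ 0 by rintro rfl; simp at hj)
      rw [← Fin.succ_castSucc, Fin.cons_succ]
      have h1 := hB i.castSucc
      have h2 := hwind i.castSucc
      rw [Fin.snoc_castSucc] at h1 h2
      exact ⟨h1, fun s hs => (h2 s hs _ (by simpa using hβ.le)).trans hε2⟩
    · rw [hcl, ← hBl, hφl]
      refine hf1 s hs _ ?_
      rw [show B (Fin.last (k + 1)) + s - S (Fin.last (k + 1)) - s =
        -(S (Fin.last (k + 1)) - B (Fin.last (k + 1))) by ring, abs_neg]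
      exact (hSB _).trans (hβε.trans (min_le_right _ _))
  · obtain ⟨y, hy0, hy⟩ := hM₂ hV N fun j =>
      ((le_max_right _ _).trans (le_max_left _ _)).trans (hN j)
    obtain ⟨S, B, hS0, hB0, hB, hSB, hSz, hSlt, hfol, hwind⟩ :=
      hρt _ y (hy.mono (hρm'.le.trans hmη))
    set z := (cyc (V 0)).base + y 0 with hz
    have hper : φ (S (Fin.last (k + 1))) z = z := by rw [hSz, hV, hy0]
    have hp0 : (cyc (V (Fin.last k).succ)).period = (cyc (V 0)).period :=
      congrArg (fun i => (cyc i).period) hV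
    have hb0 : (cyc (V (Fin.last k).succ)).base = (cyc (V 0)).base :=
      congrArg (fun i => (cyc i).base) hV
    have hBl : B (Fin.last (k + 1)) = B (Fin.last k).castSucc +
        ((cr (Fin.last k)).arrive - (cr (Fin.last k)).depart) + N 0 * (cyc (V 0)).period := by
      have := hB (Fin.last k)
      rw [Fin.last_add_one, hp0] at this
      exact this
    -- The orbit starts at its departure from the first vertex, so the winding there occupies
    -- negative times. One period `S (Fin.last (k + 1))` later it is the winding at the end of the
    -- chain; the clocks differ by the drift only.
    refine ⟨z, S (Fin.last (k + 1)), Fin.cons (-(N 0 * (cyc (V 0)).period))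
      fun j => B j.castSucc + ((cr j).arrive - (cr j).depart), fun j => B j.castSucc, ?_, hper,
      fun j => ⟨by rw [Fin.cons_succ], fun s hs => (hfol j s hs).trans hε2⟩, fun j => ?_, ?_⟩
    · rw [← hS0]
      exact Fin.strictMono_iff_lt_succ.2 hSlt (Fin.last_pos)
    · induction j using Fin.cases with
      | zero =>
        simp only [Fin.castSucc_zero, Fin.cons_zero, hB0, neg_add_cancel, true_and]
        intro s hs
        have h2 := hwind (Fin.last k)
        rw [Fin.last_add_one, hp0, hb0] at h2
        have h3 := h2 s hs (-(N 0 * (cyc (V 0)).period) + s + S (Fin.last (k + 1))) (by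
          rw [show -(N 0 * (cyc (V 0)).period) + s + S (Fin.last (k + 1)) -
            (B (Fin.last k).castSucc + ((cr (Fin.last k)).arrive - (cr (Fin.last k)).depart) + s) =
            S (Fin.last (k + 1)) - B (Fin.last (k + 1)) by rw [hBl]; ring]
          exact hSB _)
        rw [hφ.add, hper] at h3
        exact h3.trans hε2
      | succ i =>
        rw [← Fin.succ_castSucc, Fin.cons_succ]
        have h1 := hB i.castSucc
        have h2 := hwind i.castSucc
        rw [Fin.coeSucc_eq_succ] at h1 h2
        exact ⟨h1, fun s hs => (h2 s hs _ (by simpa using hβ.le)).trans hε2⟩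
    · rw [hcl, Fin.cons_zero, sub_neg_eq_add, ← hBl]
      exact (hSB _).trans_lt (hβε.trans_lt hε2)

end ShadowingOrbits

/-! ### Scalar and operator linear equations. -/

section LinearEquations

theorem exists_exp_factor {g m : ℝ → ℝ} (hm : Continuous m)
    (hg : ∀ t, HasDerivAt g (-(m t) * g t) t) :
    ∃ I : ℝ → ℝ, I 0 = 0 ∧ (∀ t, HasDerivAt I (m t) t) ∧ ∀ t, g t = Real.exp (-I t) * g 0 := by
  have hI : ∀ t, HasDerivAt (fun t => ∫ s in (0 : ℝ)..t, m s) (m t) t := fun t =>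
    intervalIntegral.integral_hasDerivAt_right (hm.intervalIntegrable _ _)
      hm.aestronglyMeasurable.stronglyMeasurableAtFilter hm.continuousAt
  refine ⟨fun t => ∫ s in (0 : ℝ)..t, m s, by simp, hI, fun t => ?_⟩
  have hd : ∀ t, HasDerivAt (fun t => Real.exp (∫ s in (0 : ℝ)..t, m s) * g t) 0 t := fun t => by
    have h := (hI t).exp.mul (hg t)
    have e : Real.exp (∫ s in (0 : ℝ)..t, m s) * m t * g t +
      Real.exp (∫ s in (0 : ℝ)..t, m s) * (-(m t) * g t) = 0 := by ring
    rwa [e] at h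
  have h := is_const_of_deriv_eq_zero (fun t => (hd t).differentiableAt) (fun t => (hd t).deriv) t 0
  simp only [intervalIntegral.integral_same, Real.exp_zero, one_mul] at h
  rw [← h, ← mul_assoc, ← Real.exp_add, neg_add_cancel, Real.exp_zero, one_mul]

theorem eq_of_hasDerivAt_linear {E : Type*} [NormedAddCommGroup E] [NormedSpace ℝ E]
    {A : ℝ → E →L[ℝ] E} {K : ℝ} (hA : ∀ t, ‖A t‖ ≤ K) {u w : ℝ → E}
    (hu : ∀ t, HasDerivAt u (A t (u t)) t) (hw : ∀ t, HasDerivAt w (A t (w t)) t)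
    (h0 : u 0 = w 0) : u = w :=
  ODE_solution_unique_univ (v := fun t x => A t x) (K := K.toNNReal) (s := fun _ => univ) (t₀ := 0)
    (fun t => ((A t).lipschitz.weaken (by
      rw [← NNReal.coe_le_coe]; exact (hA t).trans (Real.le_coe_toNNReal K))).lipschitzOnWith)
    (fun t => ⟨hu t, mem_univ _⟩) (fun t => ⟨hw t, mem_univ _⟩) h0

end LinearEquations

/-! ### The modified field and the hyperbolicity of its cycles. -/

section CutoffField

variable {F : Phase → Phase} {H : Phase → ℝ} {χ : Phase → ℝ} {R c : ℝ} {φ : ℝ → Phase → Phase}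

/-- A bump function that is `1` on the ball of radius `R`. -/
structure IsCutoff (χ : Phase → ℝ) (R : ℝ) : Prop where
  smooth : ContDiff ℝ 2 χ
  hasCompactSupport : HasCompactSupport χ
  nonneg : ∀ x, 0 ≤ χ x
  eq_one : ∀ x, ‖x‖ < R → χ x = 1

theorem exists_isCutoff {R : ℝ} (hR : 0 < R) : ∃ χ, IsCutoff χ R := by
  let b : ContDiffBump (0 : Phase) := ⟨R, R + 1, hR, by linarith⟩
  exact ⟨b, b.contDiff, b.hasCompactSupport, fun x => b.nonneg,
    fun x hx => b.one_of_mem_closedBall (by simpa using hx.le)⟩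

/-- The field `F` with a term added off the level set `H = c` that makes this level set attracting,
and cut off far away. -/
noncomputable def cutoffField (F : Phase → Phase) (H : Phase → ℝ) (c : ℝ) (χ : Phase → ℝ)
    (x : Phase) : Phase :=
  χ x • (F x - (H x - c) • gradient H x)

theorem ContDiff.gradient (hH : ContDiff ℝ ∞ H) : ContDiff ℝ ∞ (gradient H) :=
  (InnerProductSpace.toDual ℝ Phase).symm.contDiff.comp (hH.fderiv_right (by simp))

theorem IsCutoff.contDiff_cutoffField (hχ : IsCutoff χ R) (hF : ContDiff ℝ ∞ F)
    (hH : ContDiff ℝ ∞ H) : ContDiff ℝ 2 (cutoffField F H c χ) :=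
  hχ.smooth.smul ((contDiff_infty.1 hF 2).sub (((contDiff_infty.1 hH 2).sub
    contDiff_const).smul (contDiff_infty.1 (ContDiff.gradient hH) 2)))

theorem IsCutoff.exists_isFlow (hχ : IsCutoff χ R) (hF : ContDiff ℝ ∞ F)
    (hH : ContDiff ℝ ∞ H) : ∃ φ, IsFlow (cutoffField F H c χ) φ :=
  _root_.exists_isFlow (hχ.contDiff_cutoffField hF hH) hχ.hasCompactSupport.smul_right

theorem IsCutoff.cutoffField_eq (hχ : IsCutoff χ R) {x : Phase} (hx : ‖x‖ < R) (hc : H x = c) :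
    cutoffField F H c χ x = F x := by
  simp [cutoffField, hχ.eq_one x hx, hc]

/-- On the level set the factor `H - c` vanishes, so the product rule leaves no second derivative of
`H`. -/
theorem IsCutoff.fderiv_cutoffField (hχ : IsCutoff χ R) (hF : ContDiff ℝ ∞ F)
    (hH : ContDiff ℝ ∞ H) {x : Phase} (hx : ‖x‖ < R) (hc : H x = c) (w : Phase) :
    fderiv ℝ (cutoffField F H c χ) x w = fderiv ℝ F x w - fderiv ℝ H x w • gradient H x := by
  have h1 : cutoffField F H c χ =ᶠ[𝓝 x] fun y => F y - (H y - c) • gradient H y := by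
    have : ∀ᶠ y in 𝓝 x, ‖y‖ < R := continuous_norm.continuousAt.eventually_lt continuousAt_const hx
    filter_upwards [this] with y hy
    simp [cutoffField, hχ.eq_one y hy]
  have hF' := (hF.differentiable (by simp) x).hasFDerivAt
  have hH' := (hH.differentiable (by simp) x).hasFDerivAt
  have hG' := ((ContDiff.gradient hH).differentiable (by simp) x).hasFDerivAt
  have h2 := hF'.sub ((hH'.sub_const c).smul hG')
  rw [h1.fderiv_eq, HasFDerivAt.fderiv (f := fun y => F y - (H y - c) • gradient H y) h2]
  simp [hc]

namespace IsConservedQuantity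

theorem fderiv_apply (hH : IsConservedQuantity F H) (x : Phase) : fderiv ℝ H x (F x) = 0 := by
  have := hH.orthogonal x
  rw [real_inner_comm, inner_gradient_left] at this
  exact this

/-- Differentiate `DH(x)(F x) = 0` in the direction `w` and use the symmetry of the second
derivative. -/
theorem fderiv_fderiv (hH : IsConservedQuantity F H) (hF : ContDiff ℝ ∞ F) (x w : Phase) :
    fderiv ℝ (fderiv ℝ H) x (F x) w + fderiv ℝ H x (fderiv ℝ F x w) = 0 := by
  have hF' := (hF.differentiable (by simp) x).hasFDerivAt
  have hH' := ((hH.smooth.fderiv_right (m := ∞) (by simp)).differentiable (by simp)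
    x).hasFDerivAt
  have h1 := hH'.clm_apply hF'
  have h2 : (fun y => fderiv ℝ H y (F y)) = fun _ => 0 := funext hH.fderiv_apply
  rw [h2] at h1
  have h3 := congrArg (fun L : Phase →L[ℝ] ℝ => L w) (h1.unique (hasFDerivAt_const 0 x))
  have hs : IsSymmSndFDerivAt ℝ H x :=
    hH.smooth.contDiffAt.isSymmSndFDerivAt (by simpa using ENat.LEInfty.out)
  rw [hs.eq (F x) w]
  simpa [add_comm] using h3

/-- Growth of the differential of `H` along a variation of an orbit. -/
theorem hasDerivAt_fderiv_variation (hH : IsConservedQuantity F H) (hF : ContDiff ℝ ∞ F)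
    {γ w : ℝ → Phase} {a t : ℝ} (hγ : HasDerivAt γ (F (γ t)) t)
    (hw : HasDerivAt w (fderiv ℝ F (γ t) (w t) - a • gradient H (γ t)) t) :
    HasDerivAt (fun t => fderiv ℝ H (γ t) (w t)) (-(a * ‖gradient H (γ t)‖ ^ 2)) t := by
  have hH' := ((hH.smooth.fderiv_right (m := ∞) (by simp)).differentiable (by simp)
    (γ t)).hasFDerivAt
  have h := (hH'.comp_hasDerivAt t hγ).clm_apply hw
  have h2 := hH.fderiv_fderiv hF (γ t) (w t)
  have h3 : fderiv ℝ H (γ t) (gradient H (γ t)) = ‖gradient H (γ t)‖ ^ 2 := by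
    rw [← inner_gradient_left, real_inner_self_eq_norm_sq]
  refine h.congr_deriv ?_
  simp only [map_sub, map_smul, h3, smul_eq_mul, Function.comp_apply]
  linarith

/-- The part of the field along `F` does not change `H`; the added gradient term gives the rate of
decay. -/
theorem hasDerivAt_flow (hH : IsConservedQuantity F H) (hφ : IsFlow (cutoffField F H c χ) φ)
    (z : Phase) (t : ℝ) : HasDerivAt (fun t => H (φ t z) - c)
      (-(χ (φ t z) * ‖gradient H (φ t z)‖ ^ 2) * (H (φ t z) - c)) t := by
  have hH' := (hH.smooth.differentiable (by simp) (φ t z)).hasFDerivAt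
  have h := (hH'.comp_hasDerivAt t (hφ.hasDerivAt z t)).sub_const c
  refine h.congr_deriv ?_
  have h3 : fderiv ℝ H (φ t z) (gradient H (φ t z)) = ‖gradient H (φ t z)‖ ^ 2 := by
    rw [← inner_gradient_left, real_inner_self_eq_norm_sq]
  simp only [cutoffField, map_sub, map_smul, h3, smul_eq_mul, hH.fderiv_apply]
  ring

/-- The level set attracts, and deviations from it grow backwards in time. -/
theorem exists_exp_flow (hH : IsConservedQuantity F H) (hχ : IsCutoff χ R)
    (hφ : IsFlow (cutoffField F H c χ) φ) (z : Phase) :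
    ∃ I : ℝ → ℝ, I 0 = 0 ∧ (∀ t, HasDerivAt I (χ (φ t z) * ‖gradient H (φ t z)‖ ^ 2) t) ∧
      ∀ t, H (φ t z) - c = Real.exp (-I t) * (H z - c) := by
  have hc : Continuous fun t => φ t z := hφ.continuous.comp (continuous_const.prodMk continuous_id)
  have hm : Continuous fun t => χ (φ t z) * ‖gradient H (φ t z)‖ ^ 2 :=
    (hχ.smooth.continuous.comp hc).mul ((((ContDiff.gradient hH.smooth).continuous.comp hc).norm).pow 2)
  obtain ⟨I, h0, hI, h⟩ := exists_exp_factor hm (hH.hasDerivAt_flow hφ z)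
  refine ⟨I, h0, hI, fun t => ?_⟩
  have := h t
  rwa [hφ.zero] at this

end IsConservedQuantity

theorem IsCutoff.flow_eq (hχ : IsCutoff χ R) (hφ : IsFlow (cutoffField F H c χ) φ) {γ : ℝ → Phase}
    (hγ : IsTrajectory F γ) (hc : ∀ t, H (γ t) = c) (hR : ∀ t, ‖γ t‖ < R) (t : ℝ) :
    φ t (γ 0) = γ t := by
  have := hφ.eq_of_hasDerivAt (u := γ) (fun t => by
    rw [hχ.cutoffField_eq (hR t) (hc t)]; exact hγ t) t 0
  rw [← this, add_zero]

theorem IsPeriodicOrbit.isCompact_range {γ : ℝ → Phase} {T : ℝ} (hγ : IsPeriodicOrbit F γ T) :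
    IsCompact (range γ) := by
  have h : range γ = γ '' Icc 0 T := by
    refine Subset.antisymm ?_ (image_subset_range _ _)
    rintro _ ⟨t, rfl⟩
    obtain ⟨s, hs, h⟩ := hγ.periodic.exists_mem_Ico₀ hγ.pos t
    exact ⟨s, ⟨hs.1, hs.2.le⟩, h.symm⟩
  rw [h]
  exact isCompact_Icc.image (continuous_iff_continuousAt.2 fun t => (hγ.trajectory t).continuousAt)

/-- At a zero of the field the orbit would be constant by uniqueness, against minimality of the
period at `T / 2`. -/
theorem IsPeriodicOrbit.field_ne_zero {γ : ℝ → Phase} {T : ℝ} (hγ : IsPeriodicOrbit F γ T)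
    (hφ : IsFlow (cutoffField F H c χ) φ) (hχ : IsCutoff χ R) (hc : ∀ t, H (γ t) = c)
    (hR : ∀ t, ‖γ t‖ < R) : F (γ 0) ≠ 0 := by
  intro h0
  refine hγ.minimal (T / 2) ⟨half_pos hγ.pos, half_lt_self hγ.pos⟩ ?_
  have := hφ.eq_of_hasDerivAt (u := fun _ => γ 0) (fun t => by
    rw [hχ.cutoffField_eq (hR 0) (hc 0), h0]; exact hasDerivAt_const _ _) (T / 2) 0
  rw [hχ.flow_eq hφ hγ.trajectory hc hR] at this
  exact this.symm

/-- A hyperbolic periodic orbit of `F` is a hyperbolic cycle of the cut off field. -/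
theorem IsPeriodicOrbit.exists_hyperbolicCycle {γ : ℝ → Phase} {T : ℝ}
    (hγ : IsPeriodicOrbit F γ T) (hF : ContDiff ℝ ∞ F) (hH : IsConservedQuantity F H)
    (hreg : ∀ t, gradient H (γ t) ≠ 0) (hhyp : IsHyperbolicOrbit F γ T) (hχ : IsCutoff χ R)
    (hc : ∀ t, H (γ t) = c) (hR : ∀ t, ‖γ t‖ < R) (hφ : IsFlow (cutoffField F H c χ) φ) :
    ∃ C : HyperbolicCycle (cutoffField F H c χ) φ, C.base = γ 0 ∧ C.period = T ∧
      ∃ μ : ℝ, |μ| < 1 ∧ ∀ v, fderiv ℝ H (γ 0) (C.lin v) = μ * fderiv ℝ H (γ 0) v := by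
  obtain ⟨Φ, hΦ, hcount, hcirc⟩ := hhyp
  have hflow := hχ.flow_eq hφ hγ.trajectory hc hR
  have hF0 := hγ.field_ne_zero hφ hχ hc hR
  have hT0 : γ T = γ 0 := by simpa using hγ.periodic 0
  have hfield : ∀ t, cutoffField F H c χ (γ t) = F (γ t) := fun t =>
    hχ.cutoffField_eq (hR t) (hc t)
  have hDF : Continuous (fderiv ℝ F) := hF.continuous_fderiv (by simp)
  obtain ⟨K, hK⟩ := hγ.isCompact_range.exists_bound_of_continuousOn hDF.continuousOn
  have hK' : ∀ t, ‖fderiv ℝ F (γ t)‖ ≤ K := fun t => hK _ (mem_range_self t)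
  have hγc : Continuous γ := continuous_iff_continuousAt.2 fun t => (hγ.trajectory t).continuousAt
  have hGc : Continuous (gradient H) :=
    (ContDiff.gradient hH.smooth).continuous
  have hP : ∀ v t, HasDerivAt (fun t => fderiv ℝ (φ t) (γ 0) v)
      (fderiv ℝ F (γ t) (fderiv ℝ (φ t) (γ 0) v) -
        fderiv ℝ H (γ t) (fderiv ℝ (φ t) (γ 0) v) • gradient H (γ t)) t := fun v t => by
    have h := hφ.variational (γ 0) t v
    rwa [hflow, hχ.fderiv_cutoffField hF hH.smooth (hR t) (hc t)] at h
  have hP0 : ∀ v, fderiv ℝ (φ 0) (γ 0) v = v := fun v => by rw [hφ.fderiv_zero_time]; rfl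
  have hΦv : ∀ v t, HasDerivAt (fun t => Φ t v) (fderiv ℝ F (γ t) (Φ t v)) t := fun v t => by
    simpa using (hΦ.variational t).clm_apply (hasDerivAt_const t v)
  -- Along the linearized modified flow `DH` obeys a scalar linear equation with rate `-‖∇H‖²`, the
  -- source of `μ < 1`.
  have hexp : ∀ v, ∃ I : ℝ → ℝ, I 0 = 0 ∧ (∀ t, HasDerivAt I (‖gradient H (γ t)‖ ^ 2) t) ∧
      ∀ t, fderiv ℝ H (γ t) (fderiv ℝ (φ t) (γ 0) v) = Real.exp (-I t) * fderiv ℝ H (γ 0) v := by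
    intro v
    obtain ⟨I, h0, hI, h⟩ := exists_exp_factor ((hGc.comp hγc).norm.pow 2) (fun t =>
      (hH.hasDerivAt_fderiv_variation hF (hγ.trajectory t) (hP v t)).congr_deriv
        (show _ = -(‖gradient H (γ t)‖ ^ 2) * fderiv ℝ H (γ t) (fderiv ℝ (φ t) (γ 0) v) by ring))
    refine ⟨I, h0, hI, fun t => ?_⟩
    rw [h t, hP0]
  obtain ⟨I, hI0, hI, -⟩ := hexp 0
  have hIT : 0 < I T := by
    have hmono : StrictMono I := strictMono_of_deriv_pos fun t => by
      rw [(hI t).deriv]; exact pow_pos (norm_pos_iff.2 (hreg t)) 2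
    rw [← hI0]; exact hmono hγ.pos
  set μ := Real.exp (-I T) with hμ
  have hμ1 : |μ| < 1 := by
    rw [hμ, abs_of_pos (Real.exp_pos _), Real.exp_lt_one_iff]; linarith
  have hDP : ∀ v, fderiv ℝ H (γ 0) (fderiv ℝ (φ T) (γ 0) v) = μ * fderiv ℝ H (γ 0) v := by
    intro v
    obtain ⟨J, hJ0, hJ, h⟩ := hexp v
    have hJI : J T = I T := by
      have h1 : ∀ t, HasDerivAt (fun t => J t - I t) 0 t := fun t => by
        exact ((hJ t).sub (hI t)).congr_deriv (sub_self _)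
      have h2 := is_const_of_deriv_eq_zero (fun t => (h1 t).differentiableAt)
        (fun t => (h1 t).deriv) T 0
      simp only [hJ0, hI0] at h2
      linarith
    have := h T
    rwa [hT0, hJI] at this
  -- On `ker DH` the added term of the variational equation vanishes for all times, so both
  -- linearized flows agree.
  have hPΦ : ∀ v, fderiv ℝ H (γ 0) v = 0 → fderiv ℝ (φ T) (γ 0) v = Φ T v := by
    intro v hv
    obtain ⟨J, -, -, h⟩ := hexp v
    have h1 := eq_of_hasDerivAt_linear (A := fun t => fderiv ℝ F (γ t)) hK'
      (u := fun t => fderiv ℝ (φ t) (γ 0) v) (w := fun t => Φ t v) (fun t => by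
        have h2 := hP v t
        rwa [h t, hv, mul_zero, zero_smul, sub_zero] at h2) (hΦv v) (by
        simp only [hP0, hΦ.initial]; rfl)
    exact congrFun h1 T
  have hΦF : Φ T (F (γ 0)) = F (γ 0) := by
    have h1 := eq_of_hasDerivAt_linear (A := fun t => fderiv ℝ F (γ t)) hK'
      (u := fun t => Φ t (F (γ 0))) (w := fun t => F (γ t)) (hΦv _) (fun t => by
        exact ((hF.differentiable (by simp) (γ t)).hasFDerivAt).comp_hasDerivAt t
          (hγ.trajectory t)) (by simp [hΦ.initial])
    have h2 := congrFun h1 T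
    simpa [hT0] using h2
  have hDΦ : ∀ v, fderiv ℝ H (γ 0) (Φ T v) = fderiv ℝ H (γ 0) v := by
    intro v
    have h1 : ∀ t, HasDerivAt (fun t => fderiv ℝ H (γ t) (Φ t v)) 0 t := fun t => by
      simpa using hH.hasDerivAt_fderiv_variation hF (a := 0) (hγ.trajectory t)
        (by simpa using hΦv v t)
    have h2 := is_const_of_deriv_eq_zero (fun t => (h1 t).differentiableAt)
      (fun t => (h1 t).deriv) T 0
    simpa [hT0, hΦ.initial] using h2
  set ℓ : Phase →L[ℝ] ℝ := innerSL ℝ (F (γ 0)) with hℓ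
  have hℓ0 : ℓ (cutoffField F H c χ (γ 0)) ≠ 0 := by
    rw [hfield]; simpa [hℓ] using hF0
  have hper : φ T (γ 0) = γ 0 := by rw [hflow, hT0]
  have hper' : φ (-T) (γ 0) = γ 0 := by
    conv_lhs => rw [← hper]
    exact hφ.neg_apply T _
  obtain ⟨θ, r, hθ⟩ := exists_isReturnTime hφ hφ.continuous_field hper hγ.pos hℓ0
  obtain ⟨θ', r', hθ'⟩ := exists_isReturnTime hφ.reverse hφ.reverse.continuous_field
    (T := T) hper' hγ.pos (ℓ := ℓ) (by rw [map_neg]; exact neg_ne_zero.2 hℓ0)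
  set A := fderiv ℝ (returnMap φ (γ 0) θ) 0 with hA
  have hAv : ∀ v, ∃ a : ℝ, A v = fderiv ℝ (φ T) (γ 0) v + a • F (γ 0) := fun v => by
    obtain ⟨⟨a, ha⟩, -⟩ := hθ.fderiv_returnMap (y := 0) (by simpa using hθ.pos) v
    rw [hθ.value, add_zero, hper, hfield] at ha
    exact ⟨a, ha⟩
  have hDA : ∀ v, fderiv ℝ H (γ 0) (A v) = μ * fderiv ℝ H (γ 0) v := fun v => by
    obtain ⟨a, ha⟩ := hAv v
    rw [ha, map_add, map_smul, hH.fderiv_apply, smul_zero, add_zero, hDP]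
  have hD : fderiv ℝ H (γ 0) ≠ 0 := fun h => hreg 0 (by rw [gradient, h, _root_.map_zero])
  obtain ⟨Γ, hΓ⟩ := exists_isGreenKernel_return (Φ := Φ T) (A := A) (D := fderiv ℝ H (γ 0))
    (v₀ := F (γ 0)) (μ := μ) hcount hcirc hD hDΦ hF0 hΦF (hH.fderiv_apply _)
    (fun v hv => by
      obtain ⟨a, ha⟩ := hAv v
      rw [ha, hPΦ v hv, add_sub_cancel_left]
      exact Submodule.smul_mem _ _ (Submodule.mem_span_singleton_self _))
    (by
      have := (hθ.fderiv_returnMap (y := 0) (by simpa using hθ.pos) 0).2.2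
      rwa [add_zero, hfield] at this) hDA hμ1
  refine ⟨⟨γ 0, T, ℓ, θ, r, θ', r', Γ, hθ, hθ', hℓ0, fun s hs h => ?_, hΓ⟩, rfl, rfl, μ, hμ1, hDA⟩
  rw [hflow] at h
  exact hγ.minimal s hs h

end CutoffField

/-! ### Stable manifolds of `F` seen through the modified flow. -/

section IntegralCurves

variable {F f : Phase → Phase} {H : Phase → ℝ} {γ γ' u w h : ℝ → Phase} {S : Set Phase} {c R : ℝ}
  {φ : ℝ → Phase → Phase}

/-- `F` is only locally Lipschitz, but on a compact time interval both curves stay in a common ball.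
-/
theorem eqOn_Icc_of_isIntegralCurveOn (hF : ContDiff ℝ 1 F) {b : ℝ}
    (hu : IsIntegralCurveOn u (fun _ => F) (Icc 0 b))
    (hw : IsIntegralCurveOn w (fun _ => F) (Icc 0 b)) (h0 : u 0 = w 0) : EqOn u w (Icc 0 b) := by
  obtain ⟨A, hA⟩ := isCompact_Icc.exists_bound_of_continuousOn hu.continuousOn
  obtain ⟨B, hB⟩ := isCompact_Icc.exists_bound_of_continuousOn hw.continuousOn
  obtain ⟨K, hK⟩ := hF.locallyLipschitz.locallyLipschitzOn.exists_lipschitzOnWith_of_compact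
    (isCompact_closedBall (0 : Phase) (max A B))
  refine ODE_solution_unique_of_mem_Icc_right (v := fun _ => F) (K := K)
    (s := fun _ => Metric.closedBall 0 (max A B)) (fun _ _ => hK) hu.continuousOn
    (fun t ht => (hu t ⟨ht.1, ht.2.le⟩).mono_of_mem_nhdsWithin (Icc_mem_nhdsGE_of_mem ht))
    (fun t ht => ?_) hw.continuousOn
    (fun t ht => (hw t ⟨ht.1, ht.2.le⟩).mono_of_mem_nhdsWithin (Icc_mem_nhdsGE_of_mem ht))
    (fun t ht => ?_) h0
  · simpa using Or.inl (hA t ⟨ht.1, ht.2.le⟩)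
  · simpa using Or.inr (hB t ⟨ht.1, ht.2.le⟩)

theorem IsIntegralCurveOn.reverse (hu : IsIntegralCurveOn u (fun _ => F) (Iic 0)) :
    IsIntegralCurveOn (fun t => u (-t)) (fun _ x => -F x) (Ici 0) := fun t ht => by
  have h1 := (hu (-t) (by simpa using ht)).scomp t (hasDerivAt_neg t).hasDerivWithinAt
    (s := Ici 0) (fun s hs => by simpa using hs)
  simpa [Function.comp_def] using h1

theorem IsTrajectory.reverse (hu : IsTrajectory F u) :
    IsTrajectory (fun x => -F x) fun t => u (-t) := fun t => by
  simpa [Function.comp_def] using (hu (-t)).scomp t (hasDerivAt_neg t)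

theorem mem_stableManifold_reverse {x : Phase} (hx : x ∈ unstableManifold F γ) :
    x ∈ stableManifold (fun x => -F x) γ := by
  obtain ⟨u, hu, h0, hlim⟩ := hx
  exact ⟨fun t => u (-t), hu.reverse, by simpa using h0, hlim.comp tendsto_neg_atTop_atBot⟩

theorem mem_stableTangent_reverse {x v : Phase} (hv : v ∈ unstableTangent F γ x) :
    v ∈ stableTangent (fun x => -F x) γ x := by
  obtain ⟨c, φ, hc, h0, hd, hφ, hlim⟩ := hv
  refine ⟨c, fun s t => φ s (-t), hc, h0, hd, fun s => ⟨(hφ s).1.reverse, by simpa using (hφ s).2⟩,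
    ?_⟩
  rw [Metric.tendstoUniformly_iff] at hlim ⊢
  exact fun ε hε => tendsto_neg_atTop_atBot.eventually (hlim ε hε)

theorem IsTrajectory.tendsto_infDist (hF : ContDiff ℝ 1 F) (hu : IsTrajectory F u)
    (h0 : u 0 ∈ stableManifold F γ) :
    Tendsto (fun t => Metric.infDist (u t) (range γ)) atTop (𝓝 0) := by
  obtain ⟨w, hw, hw0, hlim⟩ := h0
  refine hlim.congr' ?_
  filter_upwards [eventually_ge_atTop 0] with t ht
  rw [eqOn_Icc_of_isIntegralCurveOn hF (hw.mono Icc_subset_Ici_self)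
    (hu.isIntegralCurveOn _) hw0 ⟨ht, le_rfl⟩]

theorem IsTrajectory.tendsto_infDist_atBot (hF : ContDiff ℝ 1 F) (hu : IsTrajectory F u)
    (h0 : u 0 ∈ unstableManifold F γ) :
    Tendsto (fun t => Metric.infDist (u t) (range γ)) atBot (𝓝 0) := by
  have h := hu.reverse.tendsto_infDist (γ := γ) hF.neg
    (by simpa using mem_stableManifold_reverse h0)
  simpa [Function.comp_def] using h.comp tendsto_neg_atBot_atTop

theorem IsTrajectory.add_const (hu : IsTrajectory F u) (s : ℝ) :
    IsTrajectory F fun t => u (t + s) := fun t => (hu (t + s)).comp_add_const t s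

theorem IsTrajectory.mem_stableManifold (hu : IsTrajectory F u)
    (hlim : Tendsto (fun t => Metric.infDist (u t) (range γ)) atTop (𝓝 0)) (t : ℝ) :
    u t ∈ stableManifold F γ :=
  ⟨fun s => u (s + t), (hu.add_const t).isIntegralCurveOn _, by simp,
    hlim.comp (tendsto_atTop_add_const_right _ _ tendsto_id)⟩

theorem IsTrajectory.mem_unstableManifold (hu : IsTrajectory F u)
    (hlim : Tendsto (fun t => Metric.infDist (u t) (range γ)) atBot (𝓝 0)) (t : ℝ) :
    u t ∈ unstableManifold F γ :=
  ⟨fun s => u (s + t), (hu.add_const t).isIntegralCurveOn _, by simp,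
    hlim.comp (tendsto_atBot_add_const_right _ _ tendsto_id)⟩

/-- A continuous function that is constant on a compact set takes nearly the same value along
curves that tend to the set. -/
theorem tendsto_of_tendsto_infDist {ι : Type*} {l : Filter ι} {ψ : ι → Phase} (hS : IsCompact S)
    (hne : S.Nonempty) (hH : Continuous H) (hc : ∀ x ∈ S, H x = c)
    (hψ : Tendsto (fun i => Metric.infDist (ψ i) S) l (𝓝 0)) :
    Tendsto (fun i => H (ψ i)) l (𝓝 c) := by
  rw [Metric.tendsto_nhds]
  intro η hη
  obtain ⟨δ, hδ, hsub⟩ := hS.exists_thickening_subset_open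
    (Metric.isOpen_ball.preimage hH : IsOpen (H ⁻¹' Metric.ball c η))
    (fun x hx => by simpa [hc x hx] using hη)
  filter_upwards [hψ.eventually (gt_mem_nhds hδ)] with i hi
  exact hsub ((Metric.mem_thickening_iff_infDist_lt hne).2 hi)

/-- The flow of `f` preserves the level set `H = c`, on which `f` agrees with `F` up to radius `R`;
`H` is preserved by `F`. -/
structure IsLevelFlow (F f : Phase → Phase) (H : Phase → ℝ) (c R : ℝ) (φ : ℝ → Phase → Phase) :
    Prop where
  flow : IsFlow f φ
  smooth : ContDiff ℝ 1 F
  differentiable : Differentiable ℝ H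
  conserved : ∀ x, fderiv ℝ H x (F x) = 0
  eq_field : ∀ x, ‖x‖ < R → H x = c → f x = F x
  level : ∀ x t, H x = c → H (φ t x) = c

namespace IsLevelFlow

theorem reverse (L : IsLevelFlow F f H c R φ) :
    IsLevelFlow (fun x => -F x) (fun x => -f x) H c R fun t => φ (-t) where
  flow := L.flow.reverse
  smooth := L.smooth.neg
  differentiable := L.differentiable
  conserved x := by rw [map_neg, L.conserved, neg_zero]
  eq_field x h1 h2 := by rw [L.eq_field x h1 h2]
  level x t h := L.level x (-t) h

theorem conserved_curve (L : IsLevelFlow F f H c R φ)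
    (hu : IsIntegralCurveOn u (fun _ => F) (Ici 0)) {t : ℝ} (ht : 0 ≤ t) : H (u t) = H (u 0) := by
  refine constant_of_has_deriv_right_zero (f := fun t => H (u t)) (a := 0) (b := t)
    (L.differentiable.continuous.comp_continuousOn (hu.continuousOn.mono Icc_subset_Ici_self))
    (fun s hs => ?_) t ⟨ht, le_rfl⟩
  have h1 := ((L.differentiable (u s)).hasFDerivAt).comp_hasDerivWithinAt s (hu s hs.1)
  rw [L.conserved] at h1
  exact h1.mono (Ici_subset_Ici.2 hs.1)

theorem eq_of_tendsto (L : IsLevelFlow F f H c R φ) (hS : IsCompact S)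
    (hne : S.Nonempty) (hc : ∀ x ∈ S, H x = c) (hu : IsIntegralCurveOn u (fun _ => F) (Ici 0))
    (hlim : Tendsto (fun t => Metric.infDist (u t) S) atTop (𝓝 0)) : H (u 0) = c := by
  refine tendsto_nhds_unique ?_
    (tendsto_of_tendsto_infDist hS hne L.differentiable.continuous hc hlim)
  refine tendsto_const_nhds.congr' ?_
  filter_upwards [eventually_ge_atTop 0] with t ht
  rw [L.conserved_curve hu ht]

/-- The trajectories issuing from the curve lie in the level set, since `H` is conserved and they
converge to `γ`. Near the base point they stay in the ball: at late times by uniform convergence,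
before that by continuous dependence. So they are orbits of the modified flow. -/
theorem isStableDirection (L : IsLevelFlow F f H c R φ) (hS : IsCompact (range γ))
    (hc : ∀ t, H (γ t) = c) (hR : ∀ t, ‖γ t‖ < R - 1) {x : Phase}
    (hx : ∀ t, 0 ≤ t → ‖φ t x‖ < R - 1) {v : Phase} (hv : v ∈ stableTangent F γ x) :
    IsStableDirection φ (range γ) x v := by
  obtain ⟨C, ψ, hC, hC0, hCd, hψ, hlim⟩ := hv
  have hne : (range γ).Nonempty := range_nonempty γ
  have hlim' := hlim
  rw [Metric.tendstoUniformly_iff] at hlim'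
  obtain ⟨t₁, ht₁⟩ := eventually_atTop.1 (hlim' 1 one_pos)
  set tm := max t₁ 0 with htm
  have hfar : ∀ s t, tm ≤ t → ‖ψ s t‖ < R := by
    intro s t ht
    have h1 := ht₁ t ((le_max_left _ _).trans ht) s
    rw [dist_zero_left, Real.norm_eq_abs, abs_of_nonneg Metric.infDist_nonneg] at h1
    obtain ⟨_, ⟨r, rfl⟩, hr⟩ := (Metric.infDist_lt_iff hne).1 h1
    rw [dist_eq_norm] at hr
    have := norm_le_norm_add_norm_sub' (ψ s t) (γ r)
    linarith [hR r]
  obtain ⟨K, hK, hdist⟩ := L.flow.exists_dist_le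
  have hCc : ContinuousAt C 0 := hC.continuous.continuousAt
  have hU : ∀ᶠ s in 𝓝 (0 : ℝ), dist (C s) x < Real.exp (-(K * tm)) := by
    have := hCc.eventually (Metric.ball_mem_nhds (C 0) (Real.exp_pos (-(K * tm))))
    rwa [hC0] at this
  have key : ∀ s, dist (C s) x < Real.exp (-(K * tm)) → ∀ t, 0 ≤ t → φ t (C s) = ψ s t := by
    intro s hs
    have hlevel : H (C s) = c := by
      rw [← (hψ s).2]
      refine L.eq_of_tendsto hS hne (by rintro _ ⟨t, rfl⟩; exact hc t) (hψ s).1 ?_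
      exact hlim.tendsto_at s
    have hφb : ∀ t ∈ Icc 0 tm, ‖φ t (C s)‖ < R := by
      intro t ht
      have h1 := hdist t (C s) x
      have h2 : Real.exp (K * |t|) * dist (C s) x < 1 := by
        calc Real.exp (K * |t|) * dist (C s) x ≤ Real.exp (K * tm) * dist (C s) x := by
              rw [abs_of_nonneg ht.1]; gcongr; exact ht.2
          _ < Real.exp (K * tm) * Real.exp (-(K * tm)) := by gcongr
          _ = 1 := by rw [← Real.exp_add, add_neg_cancel, Real.exp_zero]
      have h3 := norm_le_norm_add_norm_sub' (φ t (C s)) (φ t x)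
      rw [dist_eq_norm] at h1
      linarith [hx t ht.1]
    have hnear : EqOn (fun t => φ t (C s)) (ψ s) (Icc 0 tm) := by
      refine eqOn_Icc_of_isIntegralCurveOn L.smooth (fun t ht => ?_)
        ((hψ s).1.mono Icc_subset_Ici_self) (by simp only [L.flow.zero, (hψ s).2])
      show HasDerivWithinAt _ (F (φ t (C s))) _ _
      rw [← L.eq_field _ (hφb t ht) (L.level _ _ hlevel)]
      exact (L.flow.hasDerivAt (C s) t).hasDerivWithinAt
    have hψR : ∀ t, 0 ≤ t → ‖ψ s t‖ < R := fun t ht => by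
      rcases le_total t tm with h1 | h1
      · rw [← hnear ⟨ht, h1⟩]; exact hφb t ⟨ht, h1⟩
      · exact hfar s t h1
    intro t ht
    have := L.flow.eq_of_integralCurveOn_Icc (u := ψ s) (a := 0) (b := t) (fun r hr => by
      have h1 : HasDerivWithinAt (ψ s) (F (ψ s r)) (Icc 0 t) r :=
        (hψ s).1.mono (Icc_subset_Ici_self : Icc 0 t ⊆ Ici 0) r hr
      rw [← L.eq_field _ (hψR r hr.1)
        (by rw [L.conserved_curve (hψ s).1 hr.1, (hψ s).2, hlevel])] at h1
      exact h1) t ⟨ht, le_rfl⟩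
    rw [this, sub_zero, (hψ s).2]
  refine ⟨C, hC0, ?_, _, hU, ?_⟩
  · rw [← hCd]
    exact (hC.differentiable one_ne_zero 0).hasDerivAt
  · rw [Metric.tendstoUniformlyOn_iff]
    intro ε hε
    filter_upwards [hlim' ε hε, eventually_ge_atTop 0] with t ht ht0 s hs
    rw [key s hs t ht0]
    exact ht s

theorem exists_isStableDirection (L : IsLevelFlow F f H c R φ)
    (hS : IsCompact (range γ)) (hS' : IsCompact (range γ')) (hc : ∀ t, H (γ t) = c)
    (hc' : ∀ t, H (γ' t) = c) (hR : ∀ t, ‖γ t‖ < R - 1) (hR' : ∀ t, ‖γ' t‖ < R - 1)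
    (hφh : ∀ t, φ t (h 0) = h t) (hhR : ∀ t, ‖h t‖ < R - 1)
    (htrans : IsTransverseAlong F H γ γ' h) (t : ℝ) (v : Phase)
    (hv : fderiv ℝ H (φ t (h 0)) v = 0) :
    ∃ v₁ v₂, IsStableDirection (fun t => φ (-t)) (range γ) (φ t (h 0)) v₁ ∧
      IsStableDirection φ (range γ') (φ t (h 0)) v₂ ∧ v₁ + v₂ = v := by
  have hadd : ∀ s, φ s (h t) = h (s + t) := fun s => by
    rw [← hφh t, ← L.flow.add, hφh]
  rw [hφh] at hv ⊢
  have hmem : v ∈ {w : Phase | fderiv ℝ H (h t) w = 0} := hv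
  rw [← htrans t] at hmem
  obtain ⟨v₁, h1, v₂, h2, h12⟩ := hmem
  refine ⟨v₁, v₂, ?_, ?_, h12⟩
  · exact L.reverse.isStableDirection hS hc hR (fun s _ => by rw [hadd]; exact hhR _)
      (mem_stableTangent_reverse h1)
  · exact L.isStableDirection hS' hc' hR' (fun s _ => by rw [hadd]; exact hhR _) h2

end IsLevelFlow

/-- Disjoint compact sets have disjoint neighbourhoods, and one curve cannot tend to both; two
orbits with a common point coincide. -/
theorem IsFlow.flowOrbit_eq_of_tendsto {x y : Phase} (hφ : IsFlow f φ)
    (hx : IsCompact (flowOrbit φ x)) (hy : IsCompact (flowOrbit φ y)) {l : Filter ℝ} [l.NeBot]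
    (h1 : Tendsto (fun t => Metric.infDist (u t) (flowOrbit φ x)) l (𝓝 0))
    (h2 : Tendsto (fun t => Metric.infDist (u t) (flowOrbit φ y)) l (𝓝 0)) :
    flowOrbit φ x = flowOrbit φ y := by
  by_cases hd : Disjoint (flowOrbit φ x) (flowOrbit φ y)
  · obtain ⟨δ, hδ, hd'⟩ := hd.exists_thickenings hx hy.isClosed
    obtain ⟨t, ht1, ht2⟩ := ((h1.eventually (gt_mem_nhds hδ)).and
      (h2.eventually (gt_mem_nhds hδ))).exists
    exact absurd ((Metric.mem_thickening_iff_infDist_lt (flowOrbit_nonempty _ _)).2 ht2)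
      (disjoint_left.1 hd' ((Metric.mem_thickening_iff_infDist_lt (flowOrbit_nonempty _ _)).2 ht1))
  · obtain ⟨_, ⟨s, rfl⟩, ⟨r, hr⟩⟩ := not_disjoint_iff.1 hd
    simp only at hr
    have e1 : y = φ (s - r) x := by
      rw [sub_eq_neg_add, hφ.add, ← hr, hφ.neg_apply]
    ext p
    constructor
    · rintro ⟨t, rfl⟩
      refine ⟨t - (s - r), ?_⟩
      simp only [e1, ← hφ.add, sub_add_cancel]
    · rintro ⟨t, rfl⟩
      refine ⟨t + (s - r), ?_⟩
      simp only [e1, ← hφ.add]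

theorem exists_norm_le_of_tendsto_infDist (hu : Continuous u) {S S' : Set Phase}
    (hS : IsCompact S) (hS' : IsCompact S') (hne : S.Nonempty) (hne' : S'.Nonempty)
    (hbot : Tendsto (fun t => Metric.infDist (u t) S) atBot (𝓝 0))
    (htop : Tendsto (fun t => Metric.infDist (u t) S') atTop (𝓝 0)) : ∃ B, ∀ t, ‖u t‖ ≤ B := by
  obtain ⟨A, hA⟩ := hS.isBounded.exists_norm_le
  obtain ⟨A', hA'⟩ := hS'.isBounded.exists_norm_le
  obtain ⟨a, ha⟩ := eventually_atBot.1 (hbot.eventually (gt_mem_nhds one_pos))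
  obtain ⟨b, hb⟩ := eventually_atTop.1 (htop.eventually (gt_mem_nhds one_pos))
  obtain ⟨M, hM⟩ := isCompact_Icc.exists_bound_of_continuousOn (s := Icc a b) hu.continuousOn
  refine ⟨max M (max (A + 1) (A' + 1)), fun t => ?_⟩
  by_cases h1 : t ≤ a
  · obtain ⟨y, hy, hd⟩ := (Metric.infDist_lt_iff hne).1 (ha t h1)
    rw [dist_eq_norm] at hd
    refine le_max_of_le_right (le_max_of_le_left ?_)
    linarith [norm_le_norm_add_norm_sub' (u t) y, hA y hy]
  by_cases h2 : b ≤ t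
  · obtain ⟨y, hy, hd⟩ := (Metric.infDist_lt_iff hne').1 (hb t h2)
    rw [dist_eq_norm] at hd
    refine le_max_of_le_right (le_max_of_le_right ?_)
    linarith [norm_le_norm_add_norm_sub' (u t) y, hA' y hy]
  · exact le_max_of_le_left (hM t ⟨(not_le.1 h1).le, (not_le.1 h2).le⟩)

end IntegralCurves

/-! ### Orbits of the modified flow that lie in the level set. -/

section LevelSets

variable {F : Phase → Phase} {H : Phase → ℝ} {χ : Phase → ℝ} {R c : ℝ} {φ : ℝ → Phase → Phase}

theorem Iic_subset_of_blocks {k : ℕ} {a : Fin (k + 1 + 1) → ℝ} {b : Fin (k + 1) → ℝ} {G : Set ℝ}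
    (h0 : Iic (b 0) ⊆ G) (hf : ∀ j, Icc (b j) (a j.succ) ⊆ G)
    (hw : ∀ j : Fin (k + 1), 0 < (j : ℕ) → Icc (a j.castSucc) (b j) ⊆ G) :
    Iic (a (Fin.last (k + 1))) ⊆ G := by
  have key : ∀ j, Iic (b j) ⊆ G := by
    intro j
    induction j using Fin.induction with
    | zero => exact h0
    | succ i ih =>
      intro t ht
      rcases le_total t (b i.castSucc) with h1 | h1
      · exact ih h1
      rcases le_total t (a i.castSucc.succ) with h2 | h2
      · exact hf _ ⟨h1, h2⟩
      · exact hw i.succ (by simp) ⟨by rwa [← Fin.succ_castSucc], ht⟩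
  intro t ht
  rcases le_total t (b (Fin.last k)) with h1 | h1
  · exact key _ h1
  · exact hf (Fin.last k) ⟨h1, by rwa [Fin.succ_last]⟩

theorem IsFlow.mem_flowOrbit {f : Phase → Phase} (hφ : IsFlow f φ) {x z : Phase} {s : ℝ}
    (h : φ s z ∈ flowOrbit φ x) (t : ℝ) : φ t z ∈ flowOrbit φ x := by
  obtain ⟨r, hr⟩ := h
  refine ⟨t - s + r, ?_⟩
  simp only at hr ⊢
  rw [hφ.add, hr, ← hφ.add, sub_add_cancel]

namespace IsConservedQuantity

theorem apply_trajectory (hH : IsConservedQuantity F H) {u : ℝ → Phase} (hu : IsTrajectory F u)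
    (t : ℝ) : H (u t) = H (u 0) := by
  have hd : ∀ t, HasDerivAt (fun t => H (u t)) 0 t := fun t => by
    have := ((hH.smooth.differentiable (by simp) (u t)).hasFDerivAt).comp_hasDerivAt t (hu t)
    rwa [hH.fderiv_apply] at this
  exact is_const_of_deriv_eq_zero (fun t => (hd t).differentiableAt) (fun t => (hd t).deriv) t 0

theorem level_flow (hH : IsConservedQuantity F H) (hχ : IsCutoff χ R)
    (hφ : IsFlow (cutoffField F H c χ) φ) (z : Phase) (t : ℝ) (hz : H z = c) : H (φ t z) = c := by
  obtain ⟨I, -, -, h⟩ := hH.exists_exp_flow hχ hφ z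
  have := h t
  rw [hz, sub_self, mul_zero] at this
  linarith

theorem isLevelFlow (hH : IsConservedQuantity F H) (hF : ContDiff ℝ ∞ F) (hχ : IsCutoff χ R)
    (hφ : IsFlow (cutoffField F H c χ) φ) : IsLevelFlow F (cutoffField F H c χ) H c R φ where
  flow := hφ
  smooth := contDiff_infty.1 hF 1
  differentiable := hH.smooth.differentiable (by simp)
  conserved := hH.fderiv_apply
  eq_field _ := hχ.cutoffField_eq
  level x t := hH.level_flow hχ hφ x t

/-- Orbits that come out of the level set stay in it. -/
theorem eq_of_tendsto_atBot (hH : IsConservedQuantity F H) (hχ : IsCutoff χ R)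
    (hφ : IsFlow (cutoffField F H c χ) φ) {S : Set Phase} (hS : IsCompact S) (hne : S.Nonempty)
    (hc : ∀ x ∈ S, H x = c) {z : Phase}
    (hlim : Tendsto (fun t => Metric.infDist (φ t z) S) atBot (𝓝 0)) : H z = c := by
  obtain ⟨I, hI0, hI, h⟩ := hH.exists_exp_flow hχ hφ z
  have hmono : Monotone I := monotone_of_deriv_nonneg (fun t => (hI t).differentiableAt) fun t => by
    rw [(hI t).deriv]; exact mul_nonneg (hχ.nonneg _) (sq_nonneg _)
  have h1 := tendsto_of_tendsto_infDist hS hne hH.smooth.continuous hc hlim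
  have h2 : Tendsto (fun t => |H (φ t z) - c|) atBot (𝓝 0) := by
    simpa using (h1.sub_const c).abs
  -- For negative times `I ≤ 0`, so `|H - c|` is at least its value at `z`, while it tends to `0`.
  have h3 : |H z - c| ≤ 0 := by
    refine ge_of_tendsto h2 ?_
    filter_upwards [eventually_le_atBot 0] with t ht
    rw [h t, abs_mul, abs_of_pos (Real.exp_pos _)]
    refine le_mul_of_one_le_left (abs_nonneg _) (Real.one_le_exp ?_)
    have := hmono ht
    rw [hI0] at this
    linarith
  have := abs_nonpos_iff.1 h3
  linarith

/-- A periodic orbit that meets a regular point of `H` lies in the level set. -/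
theorem eq_of_periodic (hH : IsConservedQuantity F H) (hχ : IsCutoff χ R)
    (hφ : IsFlow (cutoffField F H c χ) φ) {z : Phase} {P t₀ : ℝ} (hP : 0 < P) (hz : φ P z = z)
    (hR : ‖φ t₀ z‖ < R) (hreg : gradient H (φ t₀ z) ≠ 0) : H z = c := by
  set w := φ t₀ z with hw
  have hwP : φ P w = w := by rw [hw, ← hφ.add, add_comm, hφ.add, hz]
  suffices hwc : H w = c by
    have := hH.level_flow hχ hφ w (-t₀) hwc
    rwa [hw, hφ.neg_apply] at this
  by_contra hne
  obtain ⟨I, hI0, hI, h⟩ := hH.exists_exp_flow hχ hφ w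
  have hmono : Monotone I := monotone_of_deriv_nonneg (fun t => (hI t).differentiableAt) fun t => by
    rw [(hI t).deriv]; exact mul_nonneg (hχ.nonneg _) (sq_nonneg _)
  -- Periodicity forces the monotone exponent back to `0` after time `P`, hence it is constant in
  -- between; but its derivative at `0` is `‖∇H‖² > 0`.
  have hIP : I P = 0 := by
    have h1 := h P
    rw [hwP] at h1
    have h2 := (mul_eq_right₀ (sub_ne_zero.2 hne)).1 h1.symm
    simpa using h2
  have h1 : HasDerivWithinAt I 0 (Ioi 0) 0 := by
    refine (hasDerivWithinAt_const (0 : ℝ) (Ioi 0) (0 : ℝ)).congr_of_eventuallyEq ?_ hI0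
    filter_upwards [Ioo_mem_nhdsGT hP] with t ht
    have h2 := hmono ht.1.le
    have h3 := hmono ht.2.le
    rw [hI0] at h2
    rw [hIP] at h3
    exact le_antisymm h3 h2
  have h2 := (uniqueDiffWithinAt_Ioi (0 : ℝ)).eq_deriv _ ((hI 0).hasDerivWithinAt) h1
  rw [hφ.zero, hχ.eq_one _ hR, one_mul] at h2
  exact hreg (norm_eq_zero.1 (pow_eq_zero_iff two_ne_zero |>.1 h2))

end IsConservedQuantity

end LevelSets

/-! ### The theorem for the original field. -/

theorem mainTheorem1
    (F : Phase → Phase) (hF : ContDiff ℝ ∞ F)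
    (H : Phase → ℝ) (hH : IsConservedQuantity F H)
    (p : ℕ) (γ : Fin p → ℝ → Phase) (T : Fin p → ℝ)
    (hγ : ∀ i, IsPeriodicOrbit F (γ i) (T i))
    (hlevel : ∀ i j, ∀ t, H (γ i t) = H (γ j t))
    (hregular : ∀ i, ∀ t, gradient H (γ i t) ≠ 0)
    (hhyp : ∀ i, IsHyperbolicOrbit F (γ i) (T i))
    (W₀ : Set (ℝ → Phase)) (hfin : W₀.Finite)
    (hW₀ : ∀ h ∈ W₀, ∃ i j, IsConnection F (γ i) (γ j) h ∧ IsTransverseAlong F H (γ i) (γ j) h)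
    (k : ℕ) (hk : 1 ≤ k) (E : Fin k → ℝ → Phase) (V : Fin (k + 1) → Fin p)
    (hwalk : IsWalk F γ W₀ E V)
    (ε : ℝ) (hε : 0 < ε) :
    ∃ σ τ : Fin k → ℝ, IsTransitWindow γ E V ε σ τ ∧ ∃ M : ℕ, 1 ≤ M ∧
      -- part (1): `N j` belongs to the vertex `V j`, and `N 0` plays no role
      (∀ N : Fin k → ℕ, (∀ j : Fin k, 0 < (j : ℕ) → M ≤ N j) →
        ∃ u : ℝ → Phase, IsConnection F (γ (V 0)) (γ (V (Fin.last k))) u ∧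
          ∃ (a : Fin (k + 1) → ℝ) (b : Fin k → ℝ),
            (∀ s ≤ 0, dist (u (b ⟨0, hk⟩ + s)) (γ (V 0) s) < ε) ∧
            (∀ j, FollowsEdge E ε σ τ u a b j) ∧
            (∀ j : Fin k, 0 < (j : ℕ) → WindsAround γ T V ε u a b j (N j)) ∧
            (∀ s ≥ 0, dist (u (a (Fin.last k) + s)) (γ (V (Fin.last k)) s) < ε)) ∧
      -- part (2): closed walks
      (V (Fin.last k) = V 0 →
        ∀ N : Fin k → ℕ, (∀ j, M ≤ N j) →
          ∃ u : ℝ → Phase, IsTrajectory F u ∧ F (u 0) ≠ 0 ∧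
            ∃ P : ℝ, 0 < P ∧ Function.Periodic u P ∧
              ∃ (a : Fin (k + 1) → ℝ) (b : Fin k → ℝ),
                (∀ j, FollowsEdge E ε σ τ u a b j) ∧
                (∀ j, WindsAround γ T V ε u a b j (N j)) ∧
                |P - (a (Fin.last k) - a 0)| < ε) := by
  obtain ⟨k, rfl⟩ : ∃ k', k = k' + 1 := ⟨k - 1, by omega⟩
  have hγc : ∀ i, IsCompact (range (γ i)) := fun i => (hγ i).isCompact_range
  have hγne : ∀ i, (range (γ i)).Nonempty := fun i => range_nonempty _
  have hF1 : ContDiff ℝ 1 F := contDiff_infty.1 hF 1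
  set c := H (γ (V 0) 0) with hc
  have hHγ : ∀ i t, H (γ i t) = c := fun i t => by
    rw [hlevel i (V 0) t, hH.apply_trajectory (hγ (V 0)).trajectory]
  have hHS : ∀ i, ∀ x ∈ range (γ i), H x = c := by
    rintro i _ ⟨t, rfl⟩
    exact hHγ i t
  -- The labels supplied with `E j` need not be those of the walk, because the list of orbits may
  -- contain repetitions; only the ranges of the orbits can be compared.
  choose vi vj hconn htrans using fun j => hW₀ (E j) (hwalk j).1
  have hE : ∀ j, IsTrajectory F (E j) := fun j => (hconn j).trajectory
  have hEbot : ∀ j, Tendsto (fun t => Metric.infDist (E j t) (range (γ (V j.castSucc)))) atBot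
      (𝓝 0) := fun j => (hE j).tendsto_infDist_atBot hF1 ((hwalk j).2.1 0)
  have hEtop : ∀ j, Tendsto (fun t => Metric.infDist (E j t) (range (γ (V j.succ)))) atTop
      (𝓝 0) := fun j => (hE j).tendsto_infDist hF1 ((hwalk j).2.2 0)
  have hHE : ∀ j t, H (E j t) = c := fun j t => by
    rw [hH.apply_trajectory (hE j)]
    refine tendsto_nhds_unique ?_ (tendsto_of_tendsto_infDist (hγc _) (hγne _)
      hH.smooth.continuous (hHS _) (hEtop j))
    exact tendsto_const_nhds.congr fun t => (hH.apply_trajectory (hE j) t).symm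
  -- a ball that contains all orbits
  choose Bγ hBγ using fun i => (hγc i).isBounded.exists_norm_le
  choose BE hBE using fun j => exists_norm_le_of_tendsto_infDist
    (IsIntegralCurve.continuous (hE j)) (hγc _) (hγc _) (hγne _) (hγne _) (hEbot j) (hEtop j)
  obtain ⟨B₁, hB₁⟩ := Finite.exists_le Bγ
  obtain ⟨B₂, hB₂⟩ := Finite.exists_le BE
  -- All given orbits lie within radius `R - 3`, so points at distance less than `2` from them are
  -- still inside the ball where the cutoff is `1`.
  set R := max (max B₁ B₂) 0 + 3 with hRdef
  have hR0 : 0 < R := by positivity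
  have hγB : ∀ i t, ‖γ i t‖ ≤ R - 3 := fun i t => by
    have h1 := (hBγ i _ (mem_range_self t)).trans (hB₁ i)
    have h2 : B₁ ≤ max (max B₁ B₂) 0 := (le_max_left _ _).trans (le_max_left _ _)
    linarith
  have hEB : ∀ j t, ‖E j t‖ ≤ R - 3 := fun j t => by
    have h1 := (hBE j t).trans (hB₂ j)
    have h2 : B₂ ≤ max (max B₁ B₂) 0 := (le_max_right _ _).trans (le_max_left _ _)
    linarith
  have hball : ∀ x y : Phase, ‖y‖ ≤ R - 3 → dist x y < 2 → ‖x‖ < R := fun x y hy hxy => by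
    rw [dist_eq_norm] at hxy
    linarith [norm_le_norm_add_norm_sub' x y]
  obtain ⟨χ, hχ⟩ := exists_isCutoff hR0
  obtain ⟨φ, hφ⟩ := hχ.exists_isFlow (c := c) hF hH.smooth
  have hL := hH.isLevelFlow hF hχ hφ
  have hφγ : ∀ i t, φ t (γ i 0) = γ i t := fun i =>
    hχ.flow_eq hφ (hγ i).trajectory (hHγ i) fun t => by linarith [hγB i t]
  have hφE : ∀ j t, φ t (E j 0) = E j t := fun j =>
    hχ.flow_eq hφ (hE j) (hHE j) fun t => by linarith [hEB j t]
  choose cyc hbase hperiod μ hμ hlin using fun i => (hγ i).exists_hyperbolicCycle hF hH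
    (hregular i) (hhyp i) hχ (hHγ i) (fun t => by linarith [hγB i t]) hφ
  have hγorb : ∀ i, flowOrbit φ (γ i 0) = range (γ i) := fun i => by
    simp only [flowOrbit, hφγ]
  have horb : ∀ i, (cyc i).orbit = range (γ i) := fun i => by
    rw [HyperbolicCycle.orbit, hbase, hγorb]
  have hrange : ∀ i i' (u : ℝ → Phase) (l : Filter ℝ), l.NeBot →
      Tendsto (fun t => Metric.infDist (u t) (range (γ i))) l (𝓝 0) →
      Tendsto (fun t => Metric.infDist (u t) (range (γ i'))) l (𝓝 0) →
      range (γ i) = range (γ i') := fun i i' u l hl h1 h2 => by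
    rw [← hγorb, ← hγorb] at *
    exact hφ.flowOrbit_eq_of_tendsto (by rw [hγorb]; exact hγc i) (by rw [hγorb]; exact hγc i')
      h1 h2
  have hvi : ∀ j, range (γ (vi j)) = range (γ (V j.castSucc)) := fun j =>
    hrange _ _ (E j) atBot inferInstance
      ((hE j).tendsto_infDist_atBot hF1 ((hconn j).unstable 0)) (hEbot j)
  have hvj : ∀ j, range (γ (vj j)) = range (γ (V j.succ)) := fun j =>
    hrange _ _ (E j) atTop inferInstance
      ((hE j).tendsto_infDist hF1 ((hconn j).stable 0)) (hEtop j)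
  -- the size of the neighbourhoods
  obtain ⟨S, hS0, hS⟩ := hφ.exists_dist_time_le
  have hF0 : ∀ i, F (γ i 0) ≠ 0 := fun i =>
    (hγ i).field_ne_zero hφ hχ (hHγ i) fun t => by linarith [hγB i t]
  have hreg : ∀ i, ∃ r > 0, ∀ y, dist y (γ i 0) < r → gradient H y ≠ 0 ∧ F y ≠ 0 := fun i => by
    have h1 : ∀ᶠ y in 𝓝 (γ i 0), gradient H y ≠ 0 :=
      (ContDiff.gradient hH.smooth).continuous.continuousAt.eventually_ne (hregular i 0)
    have h2 : ∀ᶠ y in 𝓝 (γ i 0), F y ≠ 0 :=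
      hF.continuous.continuousAt.eventually_ne (hF0 i)
    obtain ⟨r, hr, h⟩ := Metric.eventually_nhds_iff.1 (h1.and h2)
    exact ⟨r, hr, fun y hy => h hy⟩
  choose r hr hrreg using hreg
  obtain ⟨r₀, hr₀, hr₀le⟩ := exists_pos_le r hr
  -- The bound `1` keeps shadowing orbits in the ball, `1 / (S + 1)` limits the motion during a time
  -- `ε₀` to distance `1`, and `r₀` provides a point on the periodic orbit where `∇H` and `F` do not
  -- vanish.
  set ε₀ := min (min ε 1) (min (1 / (S + 1)) r₀) with hε₀
  have hε₀pos : 0 < ε₀ := by positivity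
  have hε₀ε : ε₀ ≤ ε := (min_le_left _ _).trans (min_le_left _ _)
  have hε₀1 : ε₀ ≤ 1 := (min_le_left _ _).trans (min_le_right _ _)
  have hε₀S : S * ε₀ ≤ 1 := by
    have h1 : ε₀ ≤ 1 / (S + 1) := (min_le_right _ _).trans (min_le_left _ _)
    rw [le_div_iff₀ (by positivity)] at h1
    linarith [hε₀pos]
  have hε₀r : ∀ i, ε₀ ≤ r i := fun i =>
    ((min_le_right _ _).trans (min_le_right _ _)).trans (hr₀le i)
  obtain ⟨δ, hδ, hshadow⟩ := exists_shadowing_orbits hφ cyc V hε₀pos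
  have hcr : ∀ j, Nonempty (Crossing (cyc (V j.castSucc)) (cyc (V j.succ)) (E j 0) δ) := fun j => by
    refine HyperbolicCycle.exists_crossing _ _ (dH := fderiv ℝ H) (μ := μ (V j.succ))
      ?_ ?_ ?_ ?_ (hμ _) ?_ ?_ hδ
    · simpa only [hφE, horb] using hEbot j
    · simpa only [hφE, horb] using hEtop j
    · exact (hH.smooth.continuous_fderiv (by simp)).continuousAt
    · rw [hbase]; exact hlin _
    · rw [hbase]
      exact fun h => hregular (V j.succ) 0 (by rw [gradient, h, map_zero])
    · intro t v hv
      rw [horb, horb, ← hvi, ← hvj]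
      exact hL.exists_isStableDirection (hγc _) (hγc _) (hHγ _) (hHγ _)
        (fun t => by linarith [hγB (vi j) t]) (fun t => by linarith [hγB (vj j) t]) (hφE j)
        (fun t => by linarith [hEB j t]) (htrans j) t v hv
  have cr := fun j => (hcr j).some
  obtain ⟨hwin, hmain⟩ := hshadow (fun j => E j 0) cr
  simp only [hbase, hperiod, hφγ, hφE, horb] at hwin hmain
  have hdist : ∀ (i : Fin p) (x : Phase), x ∉ range (γ i) → 0 < Metric.infDist x (range (γ i)) :=
    fun i x hx => ((hγc i).isClosed.notMem_iff_infDist_pos (hγne i)).1 hx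
  -- An orbit that passes closer to this point than the cycle does cannot lie in the cycle; the same
  -- is arranged at the last arrival.
  have hd₁ := hdist (V 0) (E 0 (cr 0).depart) (by
    have := ((hconn 0).nontrivial (cr 0).depart).1
    rwa [hvi 0] at this)
  have hd₂ := hdist (V (Fin.last (k + 1))) (E (Fin.last k) (cr (Fin.last k)).arrive) (by
    have := ((hconn (Fin.last k)).nontrivial (cr (Fin.last k)).arrive).2
    rwa [hvj (Fin.last k)] at this)
  obtain ⟨M, hM, hM₁, hM₂⟩ := hmain _ (lt_min hd₁ hd₂)
  -- orbits in the level set that stay in the ball are trajectories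
  have htraj : ∀ z, H z = c → (∀ t, ‖φ t z‖ < R) → IsTrajectory F fun t => φ t z :=
    fun z hz hzR t => by
      have h1 := hφ.hasDerivAt z t
      rwa [hχ.cutoffField_eq (hzR t) (hL.level z t hz)] at h1
  have hnot : ∀ i z t (x : Phase), dist (φ t z) x < Metric.infDist x (range (γ i)) →
      ∀ s, φ s z ∉ range (γ i) := fun i z t x hx s hs => by
    rw [← hγorb] at hs
    have h1 := hφ.mem_flowOrbit hs t
    rw [hγorb] at h1
    have h2 := Metric.infDist_le_dist_of_mem (x := x) h1
    rw [dist_comm] at h2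
    linarith
  refine ⟨fun j => (cr j).depart, fun j => (cr j).arrive,
    ⟨fun j => (cr j).lt, fun j s hs => ((hwin j).1 s hs).trans_le hε₀ε,
      fun j s hs => ((hwin j).2 s hs).trans_le hε₀ε⟩, M, hM, fun N hN => ?_, fun hV N hN => ?_⟩
  · obtain ⟨z, a, b, hbot, htop, ⟨t₁, ht₁⟩, ⟨t₂, ht₂⟩, hbefore, hfollow, hwind, hafter⟩ := hM₁ N hN
    have hz : H z = c := hH.eq_of_tendsto_atBot hχ hφ (hγc _) (hγne _) (hHS _) hbot
    have hzR : ∀ t, ‖φ t z‖ < R := by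
      have h1 : Iic (a (Fin.last (k + 1))) ⊆ {t | ‖φ t z‖ < R} := by
        refine Iic_subset_of_blocks (b := b) (fun t ht => ?_) (fun j t ht => ?_)
          fun j hj t ht => ?_
        · have := hbefore (t - b 0) (sub_nonpos.2 ht)
          rw [add_sub_cancel] at this
          exact hball _ _ (hγB _ _) (by linarith)
        · obtain ⟨h1, h2⟩ := hfollow j
          have := h2 (t - b j) ⟨by linarith [ht.1], by linarith [ht.2]⟩
          rw [add_sub_cancel] at this
          exact hball _ _ (hEB _ _) (by linarith)
        · obtain ⟨h1, h2⟩ := hwind j hj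
          have := h2 (t - a j.castSucc) ⟨by linarith [ht.1], by linarith [ht.2]⟩
          rw [add_sub_cancel] at this
          exact hball _ _ (hγB _ _) (by linarith)
      intro t
      rcases le_total t (a (Fin.last (k + 1))) with h2 | h2
      · exact h1 h2
      · have := hafter (t - a (Fin.last (k + 1))) (sub_nonneg.2 h2)
        rw [add_sub_cancel] at this
        exact hball _ _ (hγB _ _) (by linarith)
    have hu := htraj z hz hzR
    exact ⟨fun t => φ t z, ⟨hu, hu.mem_unstableManifold hbot, hu.mem_stableManifold htop,
      fun t => ⟨hnot _ z t₁ _ (ht₁.trans_le (min_le_left _ _)) t,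
        hnot _ z t₂ _ (ht₂.trans_le (min_le_right _ _)) t⟩⟩, a, b,
      fun s hs => (hbefore s hs).trans_le hε₀ε,
      fun j => ⟨(hfollow j).1, fun s hs => ((hfollow j).2 s hs).trans_le hε₀ε⟩,
      fun j hj => ⟨(hwind j hj).1, fun s hs => ((hwind j hj).2 s hs).trans_le hε₀ε⟩,
      fun s hs => (hafter s hs).trans_le hε₀ε⟩
  · obtain ⟨z, P, a, b, hP, hPz, hfollow, hwind, hPa⟩ := hM₂ hV N hN
    have ha0 : dist (φ (a 0) z) (γ (V 0) 0) < ε₀ := by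
      have := (hwind 0).2 0 ⟨le_rfl, mul_nonneg (Nat.cast_nonneg _) (hγ _).pos.le⟩
      rwa [add_zero] at this
    have ha0R : ‖φ (a 0) z‖ < R := hball _ _ (hγB _ 0) (by linarith)
    obtain ⟨ha0H, ha0F⟩ := hrreg _ _ (ha0.trans_le (hε₀r _))
    have hz : H z = c := hH.eq_of_periodic hχ hφ hP hPz ha0R ha0H
    have hper : Function.Periodic (fun t => φ t z) P := hφ.apply_periodic hPz
    have hzR : ∀ t, ‖φ t z‖ < R := by
      have h1 : Iic (a (Fin.last (k + 1))) ⊆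
          {t | a 0 ≤ t → ∃ y, ‖y‖ ≤ R - 3 ∧ dist (φ t z) y < 1} := by
        have hw : ∀ j, Icc (a j.castSucc) (b j) ⊆
            {t | a 0 ≤ t → ∃ y, ‖y‖ ≤ R - 3 ∧ dist (φ t z) y < 1} := fun j t ht _ => by
          obtain ⟨h1, h2⟩ := hwind j
          have := h2 (t - a j.castSucc) ⟨by linarith [ht.1], by linarith [ht.2]⟩
          rw [add_sub_cancel] at this
          exact ⟨_, hγB _ _, by linarith⟩
        refine Iic_subset_of_blocks (b := b) (fun t ht h0 => hw 0 ⟨h0, ht⟩ h0) (fun j t ht _ => ?_)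
          fun j _ => hw j
        obtain ⟨h1, h2⟩ := hfollow j
        have := h2 (t - b j) ⟨by linarith [ht.1], by linarith [ht.2]⟩
        rw [add_sub_cancel] at this
        exact ⟨_, hEB _ _, by linarith⟩
      have ha : a 0 ≤ a (Fin.last (k + 1)) := by
        refine Fin.monotone_iff_le_succ.2 (fun j => ?_) (Fin.zero_le _)
        rw [(hfollow j).1, (hwind j).1]
        have h1 := mul_nonneg (Nat.cast_nonneg (α := ℝ) (N j)) (hγ (V j.castSucc)).pos.le
        linarith [(cr j).lt]
      intro t
      obtain ⟨s, hs, hst⟩ := hper.exists_mem_Ico hP t (a 0)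
      rw [hst]
      rcases le_total s (a (Fin.last (k + 1))) with h2 | h2
      · obtain ⟨y, hy, hd⟩ := h1 h2 hs.1
        exact hball _ _ hy (by linarith)
      -- The blocks cover the time from `a 0` to the last arrival, and the period may exceed this by
      -- less than `ε₀`. In the gap the orbit moves by at most `1`.
      · obtain ⟨y, hy, hd⟩ := h1 (mem_Iic.2 le_rfl) ha
        have h3 := hS s (a (Fin.last (k + 1))) z
        have h4 : S * |s - a (Fin.last (k + 1))| ≤ 1 := by
          refine le_trans (mul_le_mul_of_nonneg_left ?_ hS0) hε₀S
          rw [abs_of_nonneg (sub_nonneg.2 h2)]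
          linarith [hs.2, (abs_lt.1 hPa).2]
        have h5 := dist_triangle (φ s z) (φ (a (Fin.last (k + 1))) z) y
        exact hball _ _ hy (by linarith)
    refine ⟨fun t => φ t z, htraj z hz hzR, fun h0 => ?_, P, hP, hper, a, b,
      fun j => ⟨(hfollow j).1, fun s hs => ((hfollow j).2 s hs).trans_le hε₀ε⟩,
      fun j => ⟨(hwind j).1, fun s hs => ((hwind j).2 s hs).trans_le hε₀ε⟩, hPa.trans_le hε₀ε⟩
    replace h0 : F z = 0 := by simpa only [hφ.zero] using h0
    have h1 := hφ.eq_of_hasDerivAt (u := fun _ => z) (fun t => by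
      have h2 := hzR 0
      rw [hφ.zero] at h2
      rw [hχ.cutoffField_eq h2 hz, h0]
      exact hasDerivAt_const _ _) (a 0) 0
    rw [← h1] at ha0F
    exact ha0F h0
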